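/- Indices run over $0,\dots,3$ and are moved with the Minkowski metric $g=\mathrm{diag}(-1,1,1,1)$. Let $N\ge 1$, let $F(X_0,\dots,X_N)$ be a real function, $F_{m,n}=\partial^2F/\partial X_m\partial X_n$, and consider the tensors $$A^{\alpha\alpha_1\cdots\alpha_m\beta_1\cdots\beta_n}=\int F_{m,n}(\lambda,\lambda_\mu p^\mu,\dots,\lambda_{\mu_1\cdots\mu_N}p^{\mu_1}\cdots p^{\mu_N})\,p^\alpha p^{\alpha_1}\cdots p^{\alpha_m}p^{\beta_1}\cdots p^{\beta_n}\,\frac{dp^1dp^2dp^3}{p^0},\qquad p^0=|\vec p|,$$ at an equilibrium state, i.e. $\lambda_{\mu_1\cdots\mu_n}=0$ for $n\ge 2$, with $\lambda_\mu$ time-like; $F$ is assumed $C^2$ near each argument that occurs (for $\vec p\ne0$) and all these integrals ($0\le m,n\le N$) are assumed to converge. Put $\gamma=\sqrt{-\lambda_\mu\lambda^\mu}$, $u_\alpha=\gamma^{-1}\lambda_\alpha$, $h_{\alpha\beta}=g_{\alpha\beta}+u_\alpha u_\beta$. Let $\xi_\alpha\xi^\alpha=-1$, $\eta_\alpha\eta^\alpha=1$,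 $\eta_\alpha\xi^\alpha=0$, let $c\in\mathbb R$, $\varphi_\alpha=\eta_\alpha-c\,\xi_\alpha$, $\varphi=\sqrt{h^{\alpha\beta}\varphi_\alpha\varphi_\beta}$, and let $v$ be a unit vector orthogonal to $u$ with $h_\alpha^\beta\varphi_\beta=\varphi v_\alpha$ (so $v_\alpha=\varphi^{-1}h_\alpha^\beta\varphi_\beta$ if $\varphi\neq0$). Put $K_{\alpha\beta}=h_{\alpha\beta}-v_\alpha v_\beta$ and $$K_{\beta_1}^{<_2\gamma_1}\cdots K_{\beta_p}^{\gamma_p>}=\sum_{s=0}^{[p/2]}a_s\,K_{(\beta_1\beta_2}\cdots K_{\beta_{2s-1}\beta_{2s}}K_{\beta_{2s+1}}^{(\gamma_{2s+1}}\cdots K_{\beta_p)}^{\gamma_p}K^{\gamma_1\gamma_2}\cdots K^{\gamma_{2s-1}\gamma_{2s})},$$ $a_0=1$, $a_s=(-\tfrac14)^s\frac{p}{(p-2s)!}\frac{(p-s-1)!}{s!}$ for $s\ge 1$. The characteristic system is $$\sum_{n=0}^N\varphi_\alpha A^{\alpha\alpha_1\cdots\alpha_m\beta_1\cdots\beta_n}\,\delta\lambda_{\beta_1\cdots\beta_n}=0,\qquad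 m=0,\dots,N,\tag{$*$}$$ for symmetric tensors $\delta\lambda_{\beta_1\cdots\beta_n}$ ($0\le n\le N$) with zero $4$-dimensional traces; $c$ is a wave speed if $(*)$ has a nonzero solution. For $p+h+k=n\le N$ put $$X_{(h,k)}^{\gamma_1\cdots\gamma_p}=K_{\beta_1}^{<_2\gamma_1}\cdots K_{\beta_p}^{\gamma_p>}u_{\beta_{p+1}}\cdots u_{\beta_{p+h}}v_{\beta_{p+h+1}}\cdots v_{\beta_n}\,\delta\lambda^{\beta_1\cdots\beta_n}.$$ For $0\le p\le N$ let $M_p$ be the square matrix with rows labelled by $(a,b)$, $p+a+b=m\le N$, and columns labelled by $(h,k)$, $p+h+k=n\le N$, with entries $$G_{m,n}\,\bigl(-\varphi_\mu u^\mu\,C_{p,b,n,k}+\varphi\,D_{p,b,n,k}\bigr),\qquad G_{m,n}=\varepsilon^{m+n+1}\int_0^\infty F_{m,n}(\lambda,\varepsilon\rho\gamma,0,\dots,0)\,\rho^{m+n+2}\,d\rho,$$ where $\varepsilon=\operatorname{sign}\lambda_0$ is the sign of $\lambda_\mu p^\mu$ and, with $m+n-a=p+b+n=:L$, $$C_{p,b,n,k}=\sum_{r=[(2p+b+1)/2]}^{[L/2]}\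 \sum_{s=p}^{[(2r-b)/2]}\ \sum_{\substack{0\le T\le s-p\\ 2r-b-2s+2T=k}}\frac{4\pi}{2r+1}\binom{L}{2r}(-1)^{L}\binom rs\frac{(2r-2s)!}{(2r-2s-b)!}\frac{n!}{L!}\frac{(2s)!!}{(2s-2p)!!}\binom{s-p}{T}(-1)^T,$$ $$D_{p,b,n,k}=\sum_{r=[(2p+b+2)/2]}^{[(L+1)/2]}\ \sum_{s=p}^{[(2r-b-1)/2]}\ \sum_{\substack{0\le T\le s-p\\ 2r-b-2s+2T-1=k}}\frac{4\pi}{2r+1}\binom{L+1}{2r}(-1)^{L+1}\binom rs\frac{(2r-2s)!}{(2r-2s-b-1)!}\frac{n!}{(L+1)!}\frac{(2s)!!}{(2s-2p)!!}\binom{s-p}{T}(-1)^T.$$ Then: 1. The map $\delta\lambda\mapsto X$ is a bijection from the families of symmetric trace-less tensors $(\delta\lambda_{\beta_1\cdots\beta_n})_{0\le n\le N}$ onto the families $(X_{(h,k)}^{\gamma_1\cdots\gamma_p})_{p+h+k\le N}$ of symmetric tensors orthogonal to $u$ and $v$ with zero $2$-dimensional traces. 2. For all such $\delta\lambda$ and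 all $p+a+b=m\le N$, contracting the left-hand side of the $m$-th equation of $(*)$ with $K_{\alpha_1}^{<_2\gamma_1}\cdots K_{\alpha_p}^{\gamma_p>}u_{\alpha_{p+1}}\cdots u_{\alpha_{p+a}}v_{\alpha_{p+a+1}}\cdots v_{\alpha_m}$ gives $\sum_{(h,k)}(M_p)_{(a,b),(h,k)}X_{(h,k)}^{\gamma_1\cdots\gamma_p}$. In particular only tensors $X$ of the same order $p$ occur, their coefficients are scalars, only equations with $m\ge p$ contribute, and only unknowns $\delta\lambda_{\beta_1\cdots\beta_n}$ with $n\ge p$ are present. 3. $(*)$ holds if and only if for every $p=0,\dots,N$ the subsystem $\sum_{(h,k)}(M_p)_{(a,b),(h,k)}X_{(h,k)}^{\gamma_1\cdots\gamma_p}=0$ (for all $(a,b)$ with $p+a+b\le N$) holds; these subsystems are independent, i.e. $\delta\lambda\mapsto X$ maps the solutions of $(*)$ bijectively onto the families whose members, for each $p$ separately, solve the $p$-th subsystem. 4. The real number $c$ is a wave speed if and only if $\det M_p=0$ for some $p\in\{0,\dots,N\}$. -/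

import Mathlib

namespace ExtendedThermo

/-! Indices run over `Fin 4`, the index `0` being the time direction. -/

/-- Diagonal entries `-1, 1, 1, 1` of the Minkowski metric; since the metric is diagonal and equal to
its inverse, an index is lowered or raised by multiplication with `eta`. -/
def eta (a : Fin 4) : ℝ := if a = 0 then -1 else 1

/-- Components `g_{ab}` of the Minkowski metric. -/
def metric (a b : Fin 4) : ℝ := if a = b then eta a else 0

/-- The Minkowski product `x_μ y^μ` of two covectors. -/
def mdot (x y : Fin 4 → ℝ) : ℝ := ∑ a, eta a * x a * y a

/-- Components of a tensor of order `n` on four-dimensional space-time. -/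
abbrev Tensor (n : ℕ) := (Fin n → Fin 4) → ℝ

/-- Raise all indices of a tensor. -/
def raise {n : ℕ} (T : Tensor n) : Tensor n := fun β => (∏ i, eta (β i)) * T β

/-- Invariance under permutations of the indices. -/
def IsSymm {n : ℕ} (T : Tensor n) : Prop :=
  ∀ (σ : Equiv.Perm (Fin n)) (β : Fin n → Fin 4), T (β ∘ σ) = T β

/-- A symmetric tensor all of whose four-dimensional traces vanish. -/
def IsSymmTraceless {n : ℕ} (T : Tensor n) : Prop :=
  IsSymm T ∧ ∀ (i j : Fin n), i ≠ j → ∀ β : Fin n → Fin 4,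
    ∑ a, eta a * T (Function.update (Function.update β i a) j a) = 0

/-! ### The field equations -/

/-- The four-momentum `p^α = (|q|, q)` of a massless particle with spatial momentum `q`. -/
noncomputable def fourMomentum (q : EuclideanSpace ℝ (Fin 3)) : Fin 4 → ℝ :=
  Fin.cons ‖q‖ (fun i => q i)

/-- The arguments `λ, λ_μ p^μ, …, λ_{μ₁…μ_N} p^{μ₁}⋯p^{μ_N}` of the function `F`. -/
noncomputable def args (N : ℕ) (lam : (n : ℕ) → Tensor n) (q : EuclideanSpace ℝ (Fin 3)) :
    Fin (N + 1) → ℝ :=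
  fun n => ∑ μ : Fin n → Fin 4, lam n μ * ∏ i, fourMomentum q (μ i)

/-- The second partial derivative `F_{m,n} = ∂²F / ∂X_m ∂X_n`. -/
noncomputable def secondPartial {N : ℕ} (F : (Fin (N + 1) → ℝ) → ℝ) (m n : Fin (N + 1))
    (x : Fin (N + 1) → ℝ) : ℝ :=
  fderiv ℝ (fun y => fderiv ℝ F y (Pi.single n 1)) x (Pi.single m 1)

/-- The integrand of `A^{α α₁…α_m β₁…β_n}` with respect to `d³q`; recall `dP = d³q / p⁰`. -/
noncomputable def coeffIntegrand {N : ℕ} (F : (Fin (N + 1) → ℝ) → ℝ) (lam : (n : ℕ) → Tensor n)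
    (m n : Fin (N + 1)) (α : Fin 4) (μ : Fin m → Fin 4) (β : Fin n → Fin 4)
    (q : EuclideanSpace ℝ (Fin 3)) : ℝ :=
  secondPartial F m n (args N lam q) * fourMomentum q α * (∏ i, fourMomentum q (μ i)) *
    (∏ i, fourMomentum q (β i)) / fourMomentum q 0

/-- `A^{α α₁…α_m β₁…β_n}`. -/
noncomputable def coeffA {N : ℕ} (F : (Fin (N + 1) → ℝ) → ℝ) (lam : (n : ℕ) → Tensor n)
    (m n : Fin (N + 1)) (α : Fin 4) (μ : Fin m → Fin 4) (β : Fin n → Fin 4) : ℝ :=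
  ∫ q, coeffIntegrand F lam m n α μ β q

/-- All integrals defining the tensors `A^{α α₁…α_m β₁…β_n}` with `m, n ≤ N` converge. -/
def CoeffsConverge {N : ℕ} (F : (Fin (N + 1) → ℝ) → ℝ) (lam : (n : ℕ) → Tensor n) : Prop :=
  ∀ (m n : Fin (N + 1)) (α : Fin 4) (μ : Fin m → Fin 4) (β : Fin n → Fin 4),
    MeasureTheory.Integrable (coeffIntegrand F lam m n α μ β)

/-- The Lagrange multipliers at equilibrium: only the scalar `λ` and the covector `λ_μ` survive. -/
def equilibrium (l0 : ℝ) (l : Fin 4 → ℝ) : (n : ℕ) → Tensor n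
  | 0 => fun _ => l0
  | 1 => fun μ => l (μ 0)
  | _ + 2 => 0

/-- The unknowns: a family `δλ_{β₁…β_n}`, `n = 0, …, N`, of tensors. -/
abbrev Unknowns (N : ℕ) := (n : Fin (N + 1)) → Tensor n

/-- The family consists of symmetric trace-less tensors. -/
def Admissible {N : ℕ} (d : Unknowns N) : Prop := ∀ n, IsSymmTraceless (d n)

/-- The left-hand side `∑_n φ_α A^{α α₁…α_m β₁…β_n} δλ_{β₁…β_n}` of the `m`-th equation of the
characteristic system. -/
noncomputable def charLHS {N : ℕ} (F : (Fin (N + 1) → ℝ) → ℝ) (lam : (n : ℕ) → Tensor n)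
    (φ : Fin 4 → ℝ) (d : Unknowns N) (m : Fin (N + 1)) : Tensor m :=
  fun μ => ∑ n : Fin (N + 1), ∑ α : Fin 4, ∑ β : Fin n → Fin 4,
    φ α * coeffA F lam m n α μ β * d n β

/-- The characteristic system: the equations with `m = 0, …, N`. -/
def SolvesCharSystem {N : ℕ} (F : (Fin (N + 1) → ℝ) → ℝ) (lam : (n : ℕ) → Tensor n)
    (φ : Fin 4 → ℝ) (d : Unknowns N) : Prop :=
  ∀ m, charLHS F lam φ d m = 0

/-- The number `c` is a wave speed (for the directions `ξ`, `η`): the characteristic system with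
`φ_α = η_α - c ξ_α` has a nonzero solution made of symmetric trace-less tensors. -/
def IsWaveSpeed {N : ℕ} (F : (Fin (N + 1) → ℝ) → ℝ) (lam : (n : ℕ) → Tensor n)
    (ξ η : Fin 4 → ℝ) (c : ℝ) : Prop :=
  ∃ d : Unknowns N, Admissible d ∧ d ≠ 0 ∧ SolvesCharSystem F lam (η - c • ξ) d

/-! ### The projectors and the 2-dimensional trace-less part -/

/-- `γ = √(-λ_μ λ^μ)`. -/
noncomputable def gam (l : Fin 4 → ℝ) : ℝ := √(-mdot l l)

/-- `u_α = γ⁻¹ λ_α`. -/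
noncomputable def vel (l : Fin 4 → ℝ) : Fin 4 → ℝ := (gam l)⁻¹ • l

/-- `h_{αβ} = g_{αβ} + u_α u_β`. -/
def hLow (u : Fin 4 → ℝ) (a b : Fin 4) : ℝ := metric a b + u a * u b

/-- `√(h^{αβ} φ_α φ_β)`. -/
noncomputable def spatialNorm (u φ : Fin 4 → ℝ) : ℝ :=
  √(∑ a, ∑ b, (eta a * eta b * hLow u a b) * φ a * φ b)

/-- `K_{αβ} = h_{αβ} - v_α v_β`. -/
def KLow (u v : Fin 4 → ℝ) (a b : Fin 4) : ℝ := hLow u a b - v a * v b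

/-- `K_α^β`. -/
def KMix (u v : Fin 4 → ℝ) (a b : Fin 4) : ℝ := eta b * KLow u v a b

/-- `K^{αβ}`. -/
def KUp (u v : Fin 4 → ℝ) (a b : Fin 4) : ℝ := eta a * eta b * KLow u v a b

/-- `a_s = (-1/4)^s p/(p-2s)! (p-s-1)!/s!`, with `a_0 = 1` (also for `p = 0`). -/
noncomputable def aCoeff (p s : ℕ) : ℝ :=
  if s = 0 then 1 else (-1 / 4) ^ s * (p / (p - 2 * s).factorial : ℝ) * ((p - s - 1).factorial / s.factorial : ℝ)

/-- The tensor `K_{β₁}^{<₂ γ₁} ⋯ K_{β_p}^{γ_p>}`: the sum over `s ≤ p/2` of `a_s` times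
`K_{β₁β₂} ⋯ K_{β_{2s-1}β_{2s}} K_{β_{2s+1}}^{γ_{2s+1}} ⋯ K_{β_p}^{γ_p} K^{γ₁γ₂} ⋯ K^{γ_{2s-1}γ_{2s}}`
symmetrized over all the `β` (the permutation `σ`) and over all the `γ` (the permutation `τ`). -/
noncomputable def KTraceless (u v : Fin 4 → ℝ) (p : ℕ) (β γ : Fin p → Fin 4) : ℝ :=
  ∑ s ∈ Finset.range (p / 2 + 1), aCoeff p s *
    (((p.factorial : ℝ) * (p.factorial : ℝ))⁻¹ * ∑ σ : Equiv.Perm (Fin p), ∑ τ : Equiv.Perm (Fin p),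
      (∏ j : Fin (p / 2), if (j : ℕ) < s then
          KLow u v (β (σ ⟨2 * j, by omega⟩)) (β (σ ⟨2 * j + 1, by omega⟩)) *
            KUp u v (γ (τ ⟨2 * j, by omega⟩)) (γ (τ ⟨2 * j + 1, by omega⟩))
        else 1) *
      ∏ i : Fin p, if 2 * s ≤ (i : ℕ) then KMix u v (β (σ i)) (γ (τ i)) else 1)

/-- `K_{β₁}^{<₂ γ₁} ⋯ K_{β_p}^{γ_p>} u_{β_{p+1}} ⋯ u_{β_{p+h}} v_{β_{p+h+1}} ⋯ v_{β_{p+h+k}}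
T^{β₁ ⋯ β_{p+h+k}}`. -/
noncomputable def contractUV (u v : Fin 4 → ℝ) (p h k : ℕ) (T : Tensor (p + h + k)) : Tensor p :=
  fun γ => ∑ β : Fin p → Fin 4, ∑ x : Fin h → Fin 4, ∑ y : Fin k → Fin 4,
    KTraceless u v p β γ * (∏ i, u (x i)) * (∏ i, v (y i)) * T (Fin.append (Fin.append β x) y)

/-- A symmetric tensor `X^{γ₁…γ_p}` orthogonal to `u` and `v` whose 2-dimensional traces vanish. -/
def IsPlanarTraceless (u v : Fin 4 → ℝ) {p : ℕ} (X : Tensor p) : Prop :=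
  IsSymm X ∧
  (∀ (i : Fin p) (γ : Fin p → Fin 4), ∑ a, u a * X (Function.update γ i a) = 0) ∧
  (∀ (i : Fin p) (γ : Fin p → Fin 4), ∑ a, v a * X (Function.update γ i a) = 0) ∧
  ∀ (i j : Fin p), i ≠ j → ∀ γ : Fin p → Fin 4,
    ∑ a, ∑ b, KLow u v a b * X (Function.update (Function.update γ i a) j b) = 0

/-! ### The subsystems -/

/-- Pairs `(h, k)` of natural numbers with `p + h + k ≤ N`. -/
abbrev Pairs (N p : ℕ) := {x : Fin (N + 1) × Fin (N + 1) // p + x.1 + x.2 ≤ N}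

/-- The order `p + h + k` attached to a pair `(h, k)`. -/
def Pairs.order {N p : ℕ} (x : Pairs N p) : Fin (N + 1) :=
  ⟨p + x.1.1 + x.1.2, Nat.lt_succ_of_le x.2⟩

/-- The new unknowns: tensors `X_{(h,k)}^{γ₁…γ_p}` for `0 ≤ p ≤ N` and `p + h + k ≤ N`. -/
abbrev NewUnknowns (N : ℕ) := (p : Fin (N + 1)) → Pairs N p → Tensor p

/-- The family consists of 2-dimensionally trace-less symmetric tensors orthogonal to `u`, `v`. -/
def NewAdmissible {N : ℕ} (u v : Fin 4 → ℝ) (X : NewUnknowns N) : Prop :=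
  ∀ p i, IsPlanarTraceless u v (X p i)

/-- The change of unknowns `δλ ↦ X`; the tensor `X_{(h,k)}^{γ₁…γ_p}` is built from
`δλ_{β₁…β_n}` with `n = p + h + k`. -/
noncomputable def changeUnknowns {N : ℕ} (u v : Fin 4 → ℝ) (d : Unknowns N) : NewUnknowns N :=
  fun p i => contractUV u v p i.1.1 i.1.2 (raise (d i.order))

/-- The projection `K^{<₂}⋯K^{>} u⋯u v⋯v` (`a` factors `u`, `b` factors `v`) of the equation of order
`m = p + a + b` of the characteristic system. -/
noncomputable def projectedLHS {N : ℕ} (F : (Fin (N + 1) → ℝ) → ℝ) (lam : (n : ℕ) → Tensor n)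
    (φ u v : Fin 4 → ℝ) (d : Unknowns N) (p : Fin (N + 1)) (i : Pairs N p) : Tensor p :=
  contractUV u v p i.1.1 i.1.2 (charLHS F lam φ d i.order)

/-- The scalar `∫₀^∞ F_{m,n}(λ, ργ, 0, …, 0) ρ^{m+n+2} dρ` if `λ_μ p^μ > 0` for the four-momenta,
that is if `ε = sign λ_0` is `1`. For the opposite time orientation of `λ_μ` one has
`λ_μ p^μ = -ργ` and the extra factor is `ε^{m+n+1}`. -/
noncomputable def radialG {N : ℕ} (F : (Fin (N + 1) → ℝ) → ℝ) (l0 : ℝ) (l : Fin 4 → ℝ)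
    (m n : Fin (N + 1)) : ℝ :=
  Real.sign (l 0) ^ ((m : ℕ) + n + 1) * ∫ ρ in Set.Ioi (0 : ℝ),
    secondPartial F m n
      (fun i => if (i : ℕ) = 0 then l0 else if (i : ℕ) = 1 then Real.sign (l 0) * (ρ * gam l) else 0) *
      ρ ^ ((m : ℕ) + n + 2)

/-- The coefficient of `-φ_μ u^μ G_{m,n} X_{(n-p-k,k)}^{γ₁…γ_p}` in the projection of the `m`-th equation
with `p + a + b = m`; it depends on `m` and `a` only through `m + n - a = p + b + n`. The terms of the
triple sum that multiply `X_{(n-p-k,k)}` are those with `2r - b - 2s + 2T = k`. -/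
noncomputable def coeffTime (p b n k : ℕ) : ℝ :=
  ∑ r ∈ Finset.Icc ((2 * p + b + 1) / 2) ((p + b + n) / 2),
  ∑ s ∈ Finset.Icc p ((2 * r - b) / 2), ∑ T ∈ Finset.range (s - p + 1),
    if 2 * r + 2 * T = k + b + 2 * s then
      4 * Real.pi / (2 * r + 1) * ((p + b + n).choose (2 * r) : ℝ) * (-1) ^ (p + b + n) *
        (r.choose s : ℝ) * ((2 * r - 2 * s).factorial / (2 * r - 2 * s - b).factorial : ℝ) *
        (n.factorial / (p + b + n).factorial : ℝ) *
        ((2 * s).doubleFactorial / (2 * s - 2 * p).doubleFactorial : ℝ) *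
        ((s - p).choose T : ℝ) * (-1) ^ T
    else 0

/-- The coefficient of `φ G_{m,n} X_{(n-p-k,k)}^{γ₁…γ_p}`, `φ = √(h^{αβ} φ_α φ_β)`, in the same equation;
the terms of the triple sum that multiply `X_{(n-p-k,k)}` are those with `2r - b - 2s + 2T - 1 = k`. -/
noncomputable def coeffSpace (p b n k : ℕ) : ℝ :=
  ∑ r ∈ Finset.Icc ((2 * p + b + 2) / 2) ((p + b + n + 1) / 2),
  ∑ s ∈ Finset.Icc p ((2 * r - b - 1) / 2), ∑ T ∈ Finset.range (s - p + 1),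
    if 2 * r + 2 * T = k + 1 + b + 2 * s then
      4 * Real.pi / (2 * r + 1) * ((p + b + n + 1).choose (2 * r) : ℝ) * (-1) ^ (p + b + n + 1) *
        (r.choose s : ℝ) * ((2 * r - 2 * s).factorial / (2 * r - 2 * s - b - 1).factorial : ℝ) *
        (n.factorial / (p + b + n + 1).factorial : ℝ) *
        ((2 * s).doubleFactorial / (2 * s - 2 * p).doubleFactorial : ℝ) *
        ((s - p).choose T : ℝ) * (-1) ^ T
    else 0

/-- The square matrix of scalar coefficients of the subsystem of index `p`: rows are labelled by
`(a, b)` (equations of order `m = p + a + b`), columns by `(h, k)` (unknowns `X_{(h,k)}^{γ₁…γ_p}` coming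
from order `n = p + h + k`). -/
noncomputable def subMatrix {N : ℕ} (F : (Fin (N + 1) → ℝ) → ℝ) (l0 : ℝ) (l φ : Fin 4 → ℝ)
    (p : Fin (N + 1)) : Matrix (Pairs N p) (Pairs N p) ℝ :=
  Matrix.of fun i j => radialG F l0 l i.order j.order *
    (-mdot φ (vel l) * coeffTime p i.1.2 j.order j.1.2 +
      spatialNorm (vel l) φ * coeffSpace p i.1.2 j.order j.1.2)

/-- The homogeneous system with coefficient matrix `M` for tensors `X_{(h,k)}^{γ₁…γ_p}`. -/
def SolvesSubsystem {N p : ℕ} (M : Matrix (Pairs N p) (Pairs N p) ℝ) (X : Pairs N p → Tensor p) :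
    Prop :=
  ∀ i, ∑ j, M i j • X j = 0

end ExtendedThermo

/-!
Choose an orthonormal frame `u, v, e₂, e₃` and put `E = e₂ + i e₃`, `E' = e₂ - i e₃`. The whole
argument takes place in the null coordinates belonging to `u, v, E, E'`.

*Tensors as functionals.* A symmetric tensor `T` of order `n` is a linear functional `umbral T` on
polynomials in four variables, concentrated in degree `n`: its value on a product of linear forms is the
contraction of `T` with their coefficient vectors. `T` is trace-less exactly when the functional kills
the ideal of the metric, that is, when `E E'` may be replaced by `U² - V²` (`umbral_E_E'`), where
`U, V, E, E'` are the linear forms of the frame. So a real symmetric trace-less tensor is the same thing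
as a family of numbers `Φ(E^p U^h V^k)`, `p + h + k = n`, that are real for `p = 0`
(`eq_zero_of_umbral`, `exists_traceless`); its values on `E'^p U^h V^k` are the complex conjugates.

*The change of unknowns.* By Girard's formula for power sums of two quantities, the projector
`K^{<₂}⋯K^{>}` is `2^{-p} (E^p ⊗ E'^p + E'^p ⊗ E^p)` (`KTraceless_eq`). Hence `X_{(h,k)}` is
`2^{-p} (Φ(E^p U^h V^k) E'^p + c.c.)` (`contractUV_eq`), and every planar trace-less tensor of order `p`
is of this form. The families `X` therefore carry exactly the numbers that make up the trace-less
tensors `δλ`, and `δλ ↦ X` is bijective (`bijOn_changeUnknowns`).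

*The projected equations.* The left-hand sides of the characteristic system are trace-less themselves,
because the four-momentum is null, so they are also known through their contractions with
`E^p u^a v^b`. Such a contraction is an integral over the light cone; `d³q / p⁰` is Lorentz invariant
(`integral_cone_eq`), so one may use the coordinates `(-|q|, q)` of the momentum in the frame. At
equilibrium `F_{m,n}` depends on `|q|` only, and polar coordinates split the integral into the radial
factor `G_{m,n}` and an integral over the unit sphere (`integral_factor`). With `t` the coordinate along
`v` and `w` the complex coordinate in the plane of `e₂, e₃`, the latter is
`∫ w^p t^b Φ((-U + t V + (w̄ E + w E') / 2)^n)`, where `b` is raised by one for the part of `φ` along `v`.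
By rotation invariance only the terms with as many factors `w` as `w̄` survive; each of them contains
`E^p (E E')^j`, which the trace condition turns into `E^p (U² - V²)^j`. The moments of the sphere follow
from Gaussian integrals, and the result has exactly the coefficients `C_{p,b,n,k}`
(`sphereInt_eq_coeffTime`). The coefficients `D_{p,b,n,k}` are those with `b + 1` in place of `b`
(`coeffTime_succ`).

*Conclusion.* Comparing contractions gives the decoupling (`AdaptedFrame.projectedLHS_eq`), the
equivalence of the system with the subsystems (`AdaptedFrame.solves_iff`), and, since each order `p`
admits a nonzero planar trace-less tensor, the determinant criterion for wave speeds
(`AdaptedFrame.exists_solution_iff`).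
-/

namespace ExtendedThermo

open MvPolynomial MeasureTheory

/-! ### Symmetric tensors as linear functionals on polynomials -/

/-- The exponent vector of the monomial `∏ i, X (ι i)`: it counts how often each index occurs. -/
noncomputable def expo {n : ℕ} (ι : Fin n → Fin 4) : Fin 4 →₀ ℕ := ∑ i, Finsupp.single (ι i) 1

theorem prod_X_eq_monomial {n : ℕ} (ι : Fin n → Fin 4) :
    ∏ i, (X (ι i) : MvPolynomial (Fin 4) ℂ) = monomial (expo ι) 1 := by
  rw [expo, monomial_sum_one]
  rfl

theorem expo_apply {n : ℕ} (ι : Fin n → Fin 4) (a : Fin 4) :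
    expo ι a = Fintype.card {i // ι i = a} := by
  simp [expo, Finsupp.finsetSum_apply, Finsupp.single_apply, Fintype.card_subtype]

theorem degree_expo {n : ℕ} (ι : Fin n → Fin 4) : (expo ι).degree = n := by
  simp [expo]

/-- Index tuples with equal counts differ by a permutation. -/
theorem exists_perm_of_expo_eq {n : ℕ} {ι κ : Fin n → Fin 4} (h : expo ι = expo κ) :
    ∃ σ : Equiv.Perm (Fin n), κ = ι ∘ σ := by
  have hc : ∀ a, Nonempty ({i // κ i = a} ≃ {i // ι i = a}) := fun a =>
    Fintype.card_eq.mp (by rw [← expo_apply, ← expo_apply, h])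
  have e := fun a => (hc a).some
  refine ⟨(Equiv.sigmaFiberEquiv κ).symm.trans
    ((Equiv.sigmaCongrRight e).trans (Equiv.sigmaFiberEquiv ι)), ?_⟩
  funext i
  simp only [Function.comp, Equiv.trans_apply, Equiv.sigmaFiberEquiv, Equiv.coe_fn_mk,
    Equiv.coe_fn_symm_mk, Equiv.sigmaCongrRight_apply]
  exact ((e (κ i) ⟨i, rfl⟩).2).symm

theorem exists_expo_eq {n : ℕ} {k : Fin 4 →₀ ℕ} (h : k.degree = n) :
    ∃ ι : Fin n → Fin 4, expo ι = k := by
  induction n generalizing k with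
  | zero =>
    refine ⟨Fin.elim0, ?_⟩
    rw [Finsupp.degree_eq_zero_iff] at h
    simp [expo, h]
  | succ n ih =>
    obtain ⟨a, ha⟩ : ∃ a, k a ≠ 0 := by
      by_contra! hk
      have : k = 0 := Finsupp.ext hk
      simp [this] at h
    have hk : Finsupp.single a 1 + (k - Finsupp.single a 1) = k := by
      rw [add_tsub_cancel_of_le]
      exact Finsupp.single_le_iff.mpr (Nat.one_le_iff_ne_zero.mpr ha)
    obtain ⟨ι, hι⟩ := ih (k := k - Finsupp.single a 1) (by
      rw [← hk, map_add, Finsupp.degree_single] at h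
      omega)
    refine ⟨Fin.cons a ι, ?_⟩
    rw [← hk, ← hι, expo, Fin.sum_univ_succ]
    simp [expo]

open Classical in
/-- The linear functional on `ℂ[X₀, …, X₃]` attached to a symmetric tensor `T` of order `n`: it takes
the monomial `∏ i, X (ι i)` of degree `n` to the component `T ι` and kills the other monomials. -/
noncomputable def umbral {n : ℕ} (T : (Fin n → Fin 4) → ℂ) : MvPolynomial (Fin 4) ℂ →ₗ[ℂ] ℂ :=
  (basisMonomials (Fin 4) ℂ).constr ℂ
    fun k => if h : ∃ ι : Fin n → Fin 4, expo ι = k then T h.choose else 0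

/-- A real tensor with complex values. -/
def toComplex {n : ℕ} (T : Tensor n) : (Fin n → Fin 4) → ℂ := fun ι => (T ι : ℂ)

/-- Invariance of a complex tensor under permutations of the indices. -/
def IsSymmC {n : ℕ} (T : (Fin n → Fin 4) → ℂ) : Prop :=
  ∀ (σ : Equiv.Perm (Fin n)) (β : Fin n → Fin 4), T (β ∘ σ) = T β

theorem IsSymm.toComplex {n : ℕ} {T : Tensor n} (hT : IsSymm T) : IsSymmC (toComplex T) :=
  fun σ β => congrArg (fun x : ℝ => (x : ℂ)) (hT σ β)

theorem umbral_prod_X {n : ℕ} {T : (Fin n → Fin 4) → ℂ} (hT : IsSymmC T) (ι : Fin n → Fin 4) :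
    umbral T (∏ i, X (ι i)) = T ι := by
  have hex : ∃ κ : Fin n → Fin 4, expo κ = expo ι := ⟨ι, rfl⟩
  have := (basisMonomials (Fin 4) ℂ).constr_basis ℂ
    (fun k => open Classical in if h : ∃ ι : Fin n → Fin 4, expo ι = k then T h.choose else 0)
    (expo ι)
  rw [prod_X_eq_monomial]
  rw [coe_basisMonomials] at this
  rw [umbral, this, dif_pos hex]
  obtain ⟨σ, hσ⟩ := exists_perm_of_expo_eq hex.choose_spec
  exact (hT σ _).symm.trans (congrArg T hσ.symm)

theorem umbral_monomial_of_degree_ne {n : ℕ} (T : (Fin n → Fin 4) → ℂ) {k : Fin 4 →₀ ℕ}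
    (hk : k.degree ≠ n) (c : ℂ) : umbral T (monomial k c) = 0 := by
  have := (basisMonomials (Fin 4) ℂ).constr_basis ℂ
    (fun k => open Classical in if h : ∃ ι : Fin n → Fin 4, expo ι = k then T h.choose else 0) k
  rw [coe_basisMonomials] at this
  have h1 : monomial k c = c • monomial k (1 : ℂ) := by simp [smul_monomial]
  rw [h1, map_smul, umbral, this, dif_neg, smul_zero]
  rintro ⟨ι, hι⟩
  exact hk (hι ▸ degree_expo ι)

/-- The linear form `∑ a, x_a X_a`. -/
noncomputable def lin (x : Fin 4 → ℂ) : MvPolynomial (Fin 4) ℂ := ∑ a, C (x a) * X a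

/-- The functional of `T` takes a product of linear forms to the full contraction of `T` with their
coefficient vectors. -/
theorem umbral_prod_lin {n : ℕ} {T : (Fin n → Fin 4) → ℂ} (hT : IsSymmC T)
    (x : Fin n → Fin 4 → ℂ) :
    umbral T (∏ i, lin (x i)) = ∑ β : Fin n → Fin 4, T β * ∏ i, x i (β i) := by
  simp only [lin]
  rw [Finset.prod_univ_sum, Fintype.piFinset_univ, map_sum]
  refine Finset.sum_congr rfl fun β _ => ?_
  rw [Finset.prod_mul_distrib, ← map_prod, ← smul_eq_C_mul, map_smul, umbral_prod_X hT,
    smul_eq_mul, mul_comm]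

theorem umbral_lin_pow {n : ℕ} {T : (Fin n → Fin 4) → ℂ} (hT : IsSymmC T) (x : Fin 4 → ℂ) :
    umbral T (lin x ^ n) = ∑ β : Fin n → Fin 4, T β * ∏ i, x (β i) := by
  rw [← umbral_prod_lin hT fun _ => x]
  simp

/-- The quadratic form `∑ a, η_a X_a²` of the Minkowski metric. -/
noncomputable def quad : MvPolynomial (Fin 4) ℂ := ∑ a, C (eta a : ℂ) * (X a * X a)

theorem umbral_mul_eq_zero {n : ℕ} {T : (Fin n → Fin 4) → ℂ} (Q : MvPolynomial (Fin 4) ℂ)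
    (h : ∀ (m : ℕ) (ι : Fin m → Fin 4), umbral T (Q * ∏ i, X (ι i)) = 0)
    (P : MvPolynomial (Fin 4) ℂ) : umbral T (Q * P) = 0 := by
  induction P using MvPolynomial.induction_on' with
  | monomial k c =>
    obtain ⟨ι, hι⟩ := exists_expo_eq (k := k) rfl
    have h1 : monomial k c = c • monomial k (1 : ℂ) := by simp [smul_monomial]
    rw [h1, mul_smul_comm, map_smul, ← hι, ← prod_X_eq_monomial, h, smul_zero]
  | add p q hp hq => rw [mul_add, map_add, hp, hq, add_zero]

/-- The functional of a symmetric trace-less tensor vanishes on the ideal of the metric. -/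
theorem umbral_quad_mul {n : ℕ} {T : Tensor n} (hT : IsSymmTraceless T)
    (P : MvPolynomial (Fin 4) ℂ) : umbral (toComplex T) (quad * P) = 0 := by
  refine umbral_mul_eq_zero quad (fun m ι => ?_) P
  have h2 : ∀ a, X a * X a * ∏ i, X (ι i) =
      ∏ i, (X ((Fin.cons a (Fin.cons a ι) : Fin (m + 2) → Fin 4) i) : MvPolynomial (Fin 4) ℂ) := by
    intro a
    simp [Fin.prod_univ_succ, mul_assoc]
  rw [quad, Finset.sum_mul, map_sum]
  by_cases hm : m + 2 = n
  · subst hm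
    have h0 := hT.2 0 1 (by simp) (Fin.cons 0 (Fin.cons 0 ι))
    have h3 : ∀ a, Function.update (Function.update (Fin.cons 0 (Fin.cons 0 ι) : Fin (m + 2) → Fin 4)
        0 a) 1 a = Fin.cons a (Fin.cons a ι) := by
      intro a
      rw [Fin.update_cons_zero, show (1 : Fin (m + 2)) = Fin.succ 0 from rfl, ← Fin.cons_update,
        Fin.update_cons_zero]
    simp only [h3] at h0
    have h4 : ∀ a, umbral (toComplex T) (C (eta a : ℂ) * (X a * X a) * ∏ i, X (ι i)) =
        ((eta a * T (Fin.cons a (Fin.cons a ι)) : ℝ) : ℂ) := by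
      intro a
      rw [mul_assoc, h2, ← smul_eq_C_mul, map_smul, umbral_prod_X hT.1.toComplex]
      simp [toComplex]
    rw [Finset.sum_congr rfl fun a _ => h4 a, ← Complex.ofReal_sum, h0, Complex.ofReal_zero]
  · refine Finset.sum_eq_zero fun a _ => ?_
    rw [mul_assoc, h2, prod_X_eq_monomial, C_mul_monomial, umbral_monomial_of_degree_ne]
    rwa [degree_expo]

/-- Polarization: a symmetric tensor is determined by its values on the powers of a vector. -/
theorem IsSymmC.ext_of_diagonal {n : ℕ} {T S : (Fin n → Fin 4) → ℂ} (hT : IsSymmC T) (hS : IsSymmC S)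
    (h : ∀ x : Fin 4 → ℂ, ∑ β, T β * ∏ i, x (β i) = ∑ β, S β * ∏ i, x (β i)) : T = S := by
  have hp : ∑ β : Fin n → Fin 4, C (T β) * ∏ i, (X (β i) : MvPolynomial (Fin 4) ℂ) =
      ∑ β : Fin n → Fin 4, C (S β) * ∏ i, X (β i) := by
    refine MvPolynomial.funext fun x => ?_
    simpa using h x
  funext γ
  have hc := congrArg (coeff (expo γ)) hp
  have key : ∀ {R : (Fin n → Fin 4) → ℂ}, IsSymmC R →
      coeff (expo γ) (∑ β : Fin n → Fin 4, C (R β) * ∏ i, (X (β i) : MvPolynomial (Fin 4) ℂ)) =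
        (Finset.univ.filter fun β : Fin n → Fin 4 => expo β = expo γ).card * R γ := by
    intro R hR
    rw [coeff_sum, ← nsmul_eq_mul, ← Finset.sum_const, Finset.sum_filter]
    refine Finset.sum_congr rfl fun β _ => ?_
    rw [prod_X_eq_monomial, C_mul_monomial, coeff_monomial, mul_one]
    split_ifs with hb
    · obtain ⟨σ, rfl⟩ := exists_perm_of_expo_eq hb
      rw [hR]
    · rfl
  rw [key hT, key hS] at hc
  refine mul_left_cancel₀ ?_ hc
  rw [Nat.cast_ne_zero]
  exact (Finset.card_pos.mpr ⟨γ, by simp⟩).ne'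

/-! ### The 2-dimensional trace-less projector -/

/-- Splitting off the value at `0` in a sum over tuples. -/
theorem sum_fin_succ_fun {J : Type*} [Fintype J] {p : ℕ} (g : (Fin (p + 1) → J) → ℂ) :
    ∑ f, g f = ∑ a, ∑ f : Fin p → J, g (Fin.cons a f) := by
  rw [← (Fin.consEquiv fun _ : Fin (p + 1) => J).sum_comp, Fintype.sum_prod_type]
  rfl

/-- A sum over tuples of a product in which the first `2 s` entries occur in consecutive pairs and the
others one by one; `w` is a weight on single entries. -/
theorem sum_pairing {J : Type*} [Fintype J] (G : J → J → ℂ) (H w : J → ℂ) (M : ℕ) :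
    ∀ (p s : ℕ) (hM : 2 * M ≤ p), s ≤ M →
      ∑ f : Fin p → J, (∏ j : Fin M, if (j : ℕ) < s then
          G (f ⟨2 * j, by omega⟩) (f ⟨2 * j + 1, by omega⟩) else 1) *
        (∏ i : Fin p, if 2 * s ≤ (i : ℕ) then H (f i) else 1) * ∏ i, w (f i) =
      (∑ a, ∑ b, G a b * w a * w b) ^ s * (∑ a, H a * w a) ^ (p - 2 * s) := by
  induction M with
  | zero =>
    intro p s hM hs
    obtain rfl : s = 0 := by omega
    simp [Fintype.sum_pow, Finset.prod_mul_distrib]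
  | succ M ih =>
    intro p s hM hs
    obtain rfl | ⟨s, rfl⟩ : s = 0 ∨ ∃ t, s = t + 1 := by cases s <;> simp
    · simp [Fintype.sum_pow, Finset.prod_mul_distrib]
    obtain ⟨p, rfl⟩ : ∃ q, p = q + 2 := ⟨p - 2, by omega⟩
    rw [sum_fin_succ_fun, pow_succ, show p + 2 - 2 * (s + 1) = p - 2 * s by omega,
      mul_right_comm, ← ih p s (by omega) (by omega), Finset.mul_sum]
    refine Finset.sum_congr rfl fun a _ => ?_
    rw [sum_fin_succ_fun, Finset.mul_sum]
    refine Finset.sum_congr rfl fun b _ => ?_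
    rw [Finset.sum_mul]
    refine Finset.sum_congr rfl fun f _ => ?_
    have h1 : (∏ j : Fin (M + 1), if (j : ℕ) < s + 1 then
          G ((Fin.cons a (Fin.cons b f) : Fin (p + 2) → J) ⟨2 * j, by omega⟩)
            ((Fin.cons a (Fin.cons b f) : Fin (p + 2) → J) ⟨2 * j + 1, by omega⟩) else 1) =
        G a b * ∏ j : Fin M, if (j : ℕ) < s then
          G (f ⟨2 * j, by omega⟩) (f ⟨2 * j + 1, by omega⟩) else 1 := by
      rw [Fin.prod_univ_succ]
      congr 1
      refine Finset.prod_congr rfl fun j _ => ?_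
      simp only [Fin.val_succ, Nat.add_lt_add_iff_right]
      rfl
    have h2 : (∏ i : Fin (p + 2), (if 2 * (s + 1) ≤ (i : ℕ) then
          H ((Fin.cons a (Fin.cons b f) : Fin (p + 2) → J) i) else 1)) =
        ∏ i : Fin p, (if 2 * s ≤ (i : ℕ) then H (f i) else 1) := by
      rw [Fin.prod_univ_succ, Fin.prod_univ_succ, if_neg (by simp), if_neg (by simp; omega), one_mul,
        one_mul]
      refine Finset.prod_congr rfl fun i _ => ?_
      simp only [Fin.val_succ, Fin.cons_succ]
      exact if_congr (by omega) rfl rfl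
    rw [h1, h2, Fin.prod_univ_succ, Fin.prod_univ_succ]
    simp only [Fin.cons_zero, Fin.cons_succ]
    ring

/-- The coefficients `a_s`, extended by zero to `2 s > p`. -/
noncomputable def waringCoeff (p s : ℕ) : ℂ := if 2 * s ≤ p then (aCoeff p s : ℂ) else 0

/-- The recursion that corresponds to `a^{p+2} + b^{p+2} = (a + b) (a^{p+1} + b^{p+1}) - a b (a^p + b^p)`. -/
theorem waringCoeff_rec (p s : ℕ) (hp : 1 ≤ p) :
    waringCoeff (p + 2) (s + 1) = waringCoeff (p + 1) (s + 1) - 1 / 4 * waringCoeff p s := by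
  have ha : ∀ q t : ℕ, aCoeff (2 * t + 1 + q) t = (-1 / 4) ^ t * (2 * t + 1 + q) *
      (t + q).factorial / ((q + 1).factorial * t.factorial) := by
    intro q t
    unfold aCoeff
    split_ifs with h
    · subst h
      simp only [Nat.factorial_zero, mul_zero, zero_add, Nat.cast_zero, Nat.cast_one, pow_zero,
        mul_one, one_mul, Nat.factorial_succ]
      have := (Nat.cast_ne_zero (R := ℝ)).mpr (Nat.factorial_ne_zero q)
      have h2 : (q : ℝ) + 1 ≠ 0 := by positivity
      push_cast
      field_simp
      ring
    · rw [show 2 * t + 1 + q - 2 * t = q + 1 by omega, show 2 * t + 1 + q - t - 1 = t + q by omega]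
      push_cast
      field_simp
  have hb : ∀ t : ℕ, 1 ≤ t → aCoeff (2 * t) t = 2 * (-1 / 4) ^ t := by
    intro t ht
    obtain ⟨t, rfl⟩ : ∃ r, t = r + 1 := ⟨t - 1, by omega⟩
    rw [aCoeff, if_neg (by omega), Nat.sub_self, show 2 * (t + 1) - (t + 1) - 1 = t by omega,
      Nat.factorial_succ]
    have := (Nat.cast_ne_zero (R := ℝ)).mpr (Nat.factorial_ne_zero t)
    have h2 : (t : ℝ) + 1 ≠ 0 := by positivity
    push_cast
    field_simp
    simp
  unfold waringCoeff
  rcases lt_trichotomy p (2 * s) with h | h | h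
  · rw [if_neg (by omega), if_neg (by omega), if_neg (by omega)]
    simp
  · rw [if_pos (by omega), if_neg (by omega), if_pos (by omega), show p + 2 = 2 * (s + 1) by omega,
      hb _ (by omega), h, hb _ (by omega)]
    push_cast
    ring
  · obtain ⟨q, rfl⟩ : ∃ q, p = 2 * s + 1 + q := ⟨p - 2 * s - 1, by omega⟩
    rw [if_pos (by omega), if_pos (by omega), if_pos (by omega), ha q s,
      show 2 * s + 1 + q + 2 = 2 * (s + 1) + 1 + q by omega, ha q (s + 1)]
    have h3 : aCoeff (2 * s + 1 + q + 1) (s + 1) = (-1 / 4) ^ (s + 1) * (2 * s + 2 + q) *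
        (s + q).factorial / (q.factorial * (s + 1).factorial) := by
      rw [aCoeff, if_neg (by omega), show 2 * s + 1 + q + 1 - 2 * (s + 1) = q by omega,
        show 2 * s + 1 + q + 1 - (s + 1) - 1 = s + q by omega]
      push_cast
      field_simp
      ring
    rw [h3, show s + 1 + q = s + q + 1 by omega, Nat.factorial_succ, Nat.factorial_succ,
      Nat.factorial_succ]
    have h1 := (Nat.cast_ne_zero (R := ℂ)).mpr (Nat.factorial_ne_zero q)
    have h2 := (Nat.cast_ne_zero (R := ℂ)).mpr (Nat.factorial_ne_zero s)
    have h4 : (q : ℂ) + 1 ≠ 0 := Nat.cast_add_one_ne_zero q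
    have h5 : (s : ℂ) + 1 ≠ 0 := Nat.cast_add_one_ne_zero s
    push_cast
    field_simp
    ring

theorem sum_waringCoeff_eq (P S : ℂ) {p K : ℕ} (hK : p / 2 + 1 ≤ K) :
    ∑ s ∈ Finset.range (p / 2 + 1), (aCoeff p s : ℂ) * P ^ s * S ^ (p - 2 * s) =
      ∑ s ∈ Finset.range K, waringCoeff p s * P ^ s * S ^ (p - 2 * s) := by
  rw [← Finset.sum_subset (Finset.range_mono hK) fun s _ hs => by
    rw [Finset.mem_range] at hs
    rw [waringCoeff, if_neg (by omega), zero_mul, zero_mul]]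
  refine Finset.sum_congr rfl fun s hs => ?_
  rw [Finset.mem_range] at hs
  rw [waringCoeff, if_pos (by omega)]

/-- The normalization of the trace-less projector: for `p = 0` the two conjugate terms coincide. -/
noncomputable def kap (p : ℕ) : ℂ := if p = 0 then 1 / 2 else (1 / 2) ^ p

/-- Girard's formula for the power sum of `a` and `b` in terms of `a b` and `a + b`. -/
theorem sum_aCoeff_eq (a b : ℂ) (p : ℕ) :
    ∑ s ∈ Finset.range (p / 2 + 1), (aCoeff p s : ℂ) * (a * b) ^ s * ((a + b) / 2) ^ (p - 2 * s) =
      kap p * (a ^ p + b ^ p) := by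
  have h1 : aCoeff 2 1 = -1 / 2 := by simp [aCoeff]; norm_num
  induction p using Nat.strong_induction_on with
  | _ p ih =>
    rcases p with _ | _ | _ | p
    · simp [aCoeff, kap]; norm_num
    · simp [aCoeff, kap]; ring
    · rw [Finset.sum_range_succ, Finset.sum_range_succ, h1]
      simp [aCoeff, kap]; ring
    · have h2 := ih (p + 2) (by omega)
      have h3 := ih (p + 1) (by omega)
      rw [sum_waringCoeff_eq (K := p + 4) _ _ (by omega)] at h2
      rw [sum_waringCoeff_eq (K := p + 3) _ _ (by omega)] at h3
      rw [sum_waringCoeff_eq (K := p + 4) _ _ (by omega)]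
      have h4 : kap (p + 1 + 1 + 1) * (a ^ (p + 1 + 1 + 1) + b ^ (p + 1 + 1 + 1)) =
          (a + b) / 2 * (kap (p + 2) * (a ^ (p + 2) + b ^ (p + 2))) -
            1 / 4 * (a * b) * (kap (p + 1) * (a ^ (p + 1) + b ^ (p + 1))) := by
        simp [kap]
        ring
      rw [h4, ← h2, ← h3, Finset.sum_range_succ', Finset.sum_range_succ' _ (p + 3), mul_add,
        Finset.mul_sum, Finset.mul_sum, add_sub_right_comm, ← Finset.sum_sub_distrib]
      congr 1
      · refine Finset.sum_congr rfl fun s _ => ?_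
        rw [show p + 1 + 1 + 1 = p + 1 + 2 from rfl, waringCoeff_rec (p + 1) s (by omega)]
        by_cases hs : 2 * (s + 1) ≤ p + 2
        · rw [show p + 1 + 2 - 2 * (s + 1) = p + 2 - 2 * (s + 1) + 1 by omega,
            show p + 1 - 2 * s = p + 2 - 2 * (s + 1) + 1 by omega]
          ring
        · rw [show waringCoeff (p + 1 + 1) (s + 1) = 0 from if_neg hs,
            show p + 1 + 2 - 2 * (s + 1) = p + 1 - 2 * s by omega]
          ring
      · simp [waringCoeff, aCoeff]
        ring

/-! ### Orthonormal frames and the null covectors of the plane orthogonal to `u` and `v` -/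

/-- Four covectors that are orthonormal for the Minkowski metric; the first one is time-like. -/
def IsFrame (e : Fin 4 → Fin 4 → ℝ) : Prop := ∀ a b, mdot (e a) (e b) = metric a b

/-- The dual form of orthonormality: a one-sided inverse of a square matrix is two-sided. -/
theorem IsFrame.complete {e : Fin 4 → Fin 4 → ℝ} (he : IsFrame e) (a b : Fin 4) :
    ∑ c, eta c * e c a * e c b = metric a b := by
  have h1 : Matrix.of e * (Matrix.of fun a b => eta a * e b a * eta b) = 1 := by
    ext i j
    have := he i j
    simp only [mdot, metric] at this
    simp only [Matrix.mul_apply, Matrix.of_apply, Matrix.one_apply]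
    have h2 : ∑ k, e i k * (eta k * e j k * eta j) = eta j * ∑ a, eta a * e i a * e j a := by
      rw [Finset.mul_sum]
      exact Finset.sum_congr rfl fun k _ => by ring
    rw [h2, this]
    split_ifs with h
    · subst h
      simp only [eta]
      split_ifs <;> norm_num
    · simp
  have h2 := mul_eq_one_comm.mp h1
  have h3 := congrFun (congrFun h2 a) b
  simp only [Matrix.mul_apply, Matrix.of_apply, Matrix.one_apply] at h3
  have h4 : ∑ c, eta a * e c a * eta c * e c b = eta a * ∑ c, eta c * e c a * e c b := by
    rw [Finset.mul_sum]
    exact Finset.sum_congr rfl fun k _ => by ring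
  rw [h4] at h3
  have h5 : eta a * eta a = 1 := by simp only [eta]; split_ifs <;> norm_num
  have h6 : ∑ c, eta c * e c a * e c b = eta a * (eta a * ∑ c, eta c * e c a * e c b) := by
    rw [← mul_assoc, h5, one_mul]
  rw [h6, h3, metric]
  split_ifs <;> simp

/-- The null covector `E = e₂ + i e₃`. -/
noncomputable def nullE (e : Fin 4 → Fin 4 → ℝ) (a : Fin 4) : ℂ := e 2 a + Complex.I * e 3 a

/-- The null covector `e₂ - i e₃`, conjugate to `E`. -/
noncomputable def nullE' (e : Fin 4 → Fin 4 → ℝ) (a : Fin 4) : ℂ := e 2 a - Complex.I * e 3 a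

theorem conj_nullE (e : Fin 4 → Fin 4 → ℝ) (a : Fin 4) :
    (starRingEnd ℂ) (nullE e a) = nullE' e a := by
  simp [nullE, nullE', Complex.ext_iff]

theorem eta_mul_self (a : Fin 4) : eta a * eta a = 1 := by
  simp only [eta]; split_ifs <;> norm_num

theorem eta_mul_self_complex (a : Fin 4) : (eta a : ℂ) * eta a = 1 := by
  exact_mod_cast eta_mul_self a

theorem IsFrame.KLow_eq {e : Fin 4 → Fin 4 → ℝ} (he : IsFrame e) (a b : Fin 4) :
    (KLow (e 0) (e 1) a b : ℂ) = (nullE e a * nullE' e b + nullE' e a * nullE e b) / 2 := by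
  have h := he.complete a b
  rw [Fin.sum_univ_four] at h
  have h2 : KLow (e 0) (e 1) a b = e 2 a * e 2 b + e 3 a * e 3 b := by
    rw [KLow, hLow, ← h]
    simp [eta]
    ring
  rw [h2, nullE, nullE, nullE', nullE']
  push_cast
  have := Complex.I_sq
  linear_combination ((e 3 a : ℂ) * e 3 b) * this

/-- The components with upper indices of a complex covector. -/
def up (x : Fin 4 → ℂ) (a : Fin 4) : ℂ := eta a * x a

theorem IsFrame.sum_eta_null {e : Fin 4 → Fin 4 → ℝ} (he : IsFrame e) :
    (∑ a, up (nullE e) a * nullE e a = 0 ∧ ∑ a, up (nullE' e) a * nullE' e a = 0 ∧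
      ∑ a, up (nullE' e) a * nullE e a = 2) ∧
    (∑ a, up (nullE e) a * (e 0 a : ℂ) = 0 ∧ ∑ a, up (nullE' e) a * (e 0 a : ℂ) = 0 ∧
      ∑ a, up (nullE e) a * (e 1 a : ℂ) = 0 ∧ ∑ a, up (nullE' e) a * (e 1 a : ℂ) = 0) := by
  have key : ∀ i j, ∑ a, (eta a : ℂ) * e i a * e j a = (metric i j : ℂ) := by
    intro i j
    rw [← he i j, mdot]
    push_cast
    rfl
  have k22 : ∑ a, (eta a : ℂ) * e 2 a * e 2 a = 1 := by rw [key]; simp [metric, eta]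
  have k33 : ∑ a, (eta a : ℂ) * e 3 a * e 3 a = 1 := by rw [key]; simp [metric, eta]
  have k23 : ∑ a, (eta a : ℂ) * e 2 a * e 3 a = 0 := by rw [key]; simp [metric]
  have k20 : ∑ a, (eta a : ℂ) * e 2 a * e 0 a = 0 := by rw [key]; simp [metric]
  have k30 : ∑ a, (eta a : ℂ) * e 3 a * e 0 a = 0 := by rw [key]; simp [metric]
  have k21 : ∑ a, (eta a : ℂ) * e 2 a * e 1 a = 0 := by rw [key]; simp [metric]
  have k31 : ∑ a, (eta a : ℂ) * e 3 a * e 1 a = 0 := by rw [key]; simp [metric]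
  have hI := Complex.I_sq
  simp only [Fin.sum_univ_four, up, nullE, nullE'] at *
  refine ⟨⟨?_, ?_, ?_⟩, ?_, ?_, ?_, ?_⟩
  · linear_combination k22 + (Complex.I ^ 2) * k33 + 2 * Complex.I * k23 + hI
  · linear_combination k22 + (Complex.I ^ 2) * k33 - 2 * Complex.I * k23 + hI
  · linear_combination k22 - (Complex.I ^ 2) * k33 - hI
  · linear_combination k20 + Complex.I * k30
  · linear_combination k20 - Complex.I * k30
  · linear_combination k21 + Complex.I * k31
  · linear_combination k21 - Complex.I * k31

/-- The tensor power `x_{β₁} ⋯ x_{β_p}`. -/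
def tpow (p : ℕ) (x : Fin 4 → ℂ) (β : Fin p → Fin 4) : ℂ := ∏ i, x (β i)

theorem isSymmC_tpow (p : ℕ) (x : Fin 4 → ℂ) : IsSymmC (tpow p x) := fun σ β =>
  Equiv.prod_comp σ fun i => x (β i)

theorem sum_tpow_mul (p : ℕ) (x y : Fin 4 → ℂ) :
    ∑ β, tpow p x β * ∏ i, y (β i) = (∑ a, x a * y a) ^ p := by
  rw [Fintype.sum_pow]
  simp [tpow, Finset.prod_mul_distrib]

/-- The contraction of the projector with `x^p` and `y^p`: the symmetrizations disappear, and what is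
left is the power sum of `(E·x)(E'·y)` and `(E'·x)(E·y)` in Girard's form. -/
theorem sum_KTraceless {e : Fin 4 → Fin 4 → ℝ} (he : IsFrame e) (p : ℕ) (x y : Fin 4 → ℂ) :
    ∑ β : Fin p → Fin 4, ∑ γ : Fin p → Fin 4,
        (KTraceless (e 0) (e 1) p β γ : ℂ) * (∏ i, x (β i)) * ∏ i, y (γ i) =
      kap p * (((∑ a, nullE e a * x a) * ∑ a, up (nullE' e) a * y a) ^ p +
        ((∑ a, nullE' e a * x a) * ∑ a, up (nullE e) a * y a) ^ p) := by
  set X := ∑ a, nullE e a * x a with hX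
  set X' := ∑ a, nullE' e a * x a with hX'
  set Y := ∑ a, up (nullE e) a * y a with hY
  set Y' := ∑ a, up (nullE' e) a * y a with hY'
  -- the summand of the definition, before the symmetrization
  set A : ℕ → (Fin p → Fin 4) → (Fin p → Fin 4) → ℂ := fun s β γ =>
    (∏ j : Fin (p / 2), if (j : ℕ) < s then
          (KLow (e 0) (e 1) (β ⟨2 * j, by omega⟩) (β ⟨2 * j + 1, by omega⟩) : ℂ) *
            KUp (e 0) (e 1) (γ ⟨2 * j, by omega⟩) (γ ⟨2 * j + 1, by omega⟩)
        else 1) *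
      ∏ i : Fin p, if 2 * s ≤ (i : ℕ) then (KMix (e 0) (e 1) (β i) (γ i) : ℂ) else 1 with hA
  have hK : ∀ β γ, (KTraceless (e 0) (e 1) p β γ : ℂ) = ∑ s ∈ Finset.range (p / 2 + 1),
      (aCoeff p s : ℂ) * (((p.factorial : ℂ) * p.factorial)⁻¹ * ∑ σ : Equiv.Perm (Fin p),
        ∑ τ : Equiv.Perm (Fin p), A s (β ∘ σ) (γ ∘ τ)) := by
    intro β γ
    rw [KTraceless]
    simp only [Complex.ofReal_sum, Complex.ofReal_mul, Complex.ofReal_prod, Complex.ofReal_inv,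
      Complex.ofReal_natCast, apply_ite Complex.ofReal, Complex.ofReal_one, hA, Function.comp]
  have hKl := he.KLow_eq
  have hG : ∑ f : Fin 4 × Fin 4, ∑ g : Fin 4 × Fin 4,
      (KLow (e 0) (e 1) f.1 g.1 : ℂ) * KUp (e 0) (e 1) f.2 g.2 * (x f.1 * y f.2) *
        (x g.1 * y g.2) = (X * Y') * (X' * Y) := by
    simp only [Fintype.sum_prod_type]
    have h1 : ∀ a b c d, (KLow (e 0) (e 1) a c : ℂ) * KUp (e 0) (e 1) b d * (x a * y b) *
        (x c * y d) = ((nullE e a * x a) * (nullE' e c * x c) + (nullE' e a * x a) *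
          (nullE e c * x c)) / 2 * (((up (nullE e) b * y b) * (up (nullE' e) d * y d) +
          (up (nullE' e) b * y b) * (up (nullE e) d * y d)) / 2) := by
      intro a b c d
      rw [KUp, hKl, Complex.ofReal_mul, hKl, Complex.ofReal_mul]
      simp only [up]
      ring
    simp only [h1]
    simp only [← Finset.mul_sum, ← Finset.sum_mul, ← Finset.sum_div, Finset.sum_add_distrib,
      ← hX, ← hX', ← hY, ← hY']
    ring
  have hH : ∑ f : Fin 4 × Fin 4, (KMix (e 0) (e 1) f.1 f.2 : ℂ) * (x f.1 * y f.2) =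
      (X * Y' + X' * Y) / 2 := by
    simp only [Fintype.sum_prod_type]
    have h1 : ∀ a b, (KMix (e 0) (e 1) a b : ℂ) * (x a * y b) =
        ((nullE e a * x a) * (up (nullE' e) b * y b) + (nullE' e a * x a) *
          (up (nullE e) b * y b)) / 2 := by
      intro a b
      rw [KMix, Complex.ofReal_mul, hKl]
      simp only [up]
      ring
    simp only [h1]
    simp only [← Finset.mul_sum, ← Finset.sum_mul, ← Finset.sum_div, Finset.sum_add_distrib,
      ← hX, ← hX', ← hY, ← hY']
  have hsum : ∀ s ∈ Finset.range (p / 2 + 1), ∑ β : Fin p → Fin 4, ∑ γ : Fin p → Fin 4,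
      A s β γ * (∏ i, x (β i)) * ∏ i, y (γ i) =
        ((X * Y') * (X' * Y)) ^ s * ((X * Y' + X' * Y) / 2) ^ (p - 2 * s) := by
    intro s hs
    rw [Finset.mem_range] at hs
    have h := sum_pairing (J := Fin 4 × Fin 4)
      (fun f g => (KLow (e 0) (e 1) f.1 g.1 : ℂ) * KUp (e 0) (e 1) f.2 g.2)
      (fun f => (KMix (e 0) (e 1) f.1 f.2 : ℂ)) (fun f => x f.1 * y f.2) (p / 2) p s (by omega)
      (by omega)
    rw [hG, hH] at h
    rw [← h, ← (Equiv.arrowProdEquivProdArrow (Fin p) (fun _ => Fin 4) (fun _ => Fin 4)).symm.sum_comp,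
      Fintype.sum_prod_type]
    refine Finset.sum_congr rfl fun β _ => Finset.sum_congr rfl fun γ _ => ?_
    simp only [hA, Finset.prod_mul_distrib, mul_assoc]
    rfl
  have hperm : ∀ s (σ τ : Equiv.Perm (Fin p)), ∑ β : Fin p → Fin 4, ∑ γ : Fin p → Fin 4,
      A s (β ∘ σ) (γ ∘ τ) * (∏ i, x (β i)) * ∏ i, y (γ i) =
        ∑ β : Fin p → Fin 4, ∑ γ : Fin p → Fin 4, A s β γ * (∏ i, x (β i)) * ∏ i, y (γ i) := by
    intro s σ τ
    rw [← (Equiv.arrowCongr σ (Equiv.refl (Fin 4))).sum_comp]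
    refine Finset.sum_congr rfl fun β _ => ?_
    rw [← (Equiv.arrowCongr τ (Equiv.refl (Fin 4))).sum_comp]
    refine Finset.sum_congr rfl fun γ _ => ?_
    have hx := Equiv.prod_comp σ.symm fun i => x (β i)
    have hy := Equiv.prod_comp τ.symm fun i => y (γ i)
    rw [← hx, ← hy]
    congr 3 <;> funext i <;> simp [Equiv.arrowCongr]
  rw [← sum_aCoeff_eq]
  calc _ = ∑ s ∈ Finset.range (p / 2 + 1), (aCoeff p s : ℂ) *
        (((p.factorial : ℂ) * p.factorial)⁻¹ * ∑ σ : Equiv.Perm (Fin p),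
        ∑ τ : Equiv.Perm (Fin p), ∑ β : Fin p → Fin 4, ∑ γ : Fin p → Fin 4,
          A s (β ∘ σ) (γ ∘ τ) * (∏ i, x (β i)) * ∏ i, y (γ i)) := by
        simp only [hK, Finset.sum_mul, Finset.mul_sum]
        rw [Finset.sum_congr rfl fun β _ => Finset.sum_comm, Finset.sum_comm]
        refine Finset.sum_congr rfl fun s _ => ?_
        rw [Finset.sum_congr rfl fun β _ => Finset.sum_comm, Finset.sum_comm]
        refine Finset.sum_congr rfl fun σ _ => ?_
        rw [Finset.sum_congr rfl fun β _ => Finset.sum_comm, Finset.sum_comm]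
        refine Finset.sum_congr rfl fun τ _ => ?_
        refine Finset.sum_congr rfl fun β _ => Finset.sum_congr rfl fun γ _ => ?_
        ring
    _ = _ := by
        refine Finset.sum_congr rfl fun s hs => ?_
        have hf : (p.factorial : ℂ) ≠ 0 := Nat.cast_ne_zero.mpr p.factorial_ne_zero
        simp only [hperm, hsum s hs, Finset.sum_const, Finset.card_univ, Fintype.card_perm,
          Fintype.card_fin, nsmul_eq_mul]
        field_simp

/-- The 2-dimensional trace-less projector is, up to normalization, the sum of the two rank one
projectors on the powers of the null covectors `E` and `E'` of the plane. -/
theorem KTraceless_eq {e : Fin 4 → Fin 4 → ℝ} (he : IsFrame e) (p : ℕ) (β γ : Fin p → Fin 4) :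
    (KTraceless (e 0) (e 1) p β γ : ℂ) = kap p * (tpow p (nullE e) β * tpow p (up (nullE' e)) γ +
      tpow p (nullE' e) β * tpow p (up (nullE e)) γ) := by
  have hβ : ∀ (γ) (σ : Equiv.Perm (Fin p)) (β), KTraceless (e 0) (e 1) p (β ∘ σ) γ =
      KTraceless (e 0) (e 1) p β γ := by
    intro γ σ β
    simp only [KTraceless, Function.comp]
    refine Finset.sum_congr rfl fun s _ => ?_
    congr 2
    exact Equiv.sum_comp (Equiv.mulLeft σ) fun ρ => ∑ τ : Equiv.Perm (Fin p),
      (∏ j : Fin (p / 2), if (j : ℕ) < s then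
          KLow (e 0) (e 1) (β (ρ ⟨2 * j, by omega⟩)) (β (ρ ⟨2 * j + 1, by omega⟩)) *
            KUp (e 0) (e 1) (γ (τ ⟨2 * j, by omega⟩)) (γ (τ ⟨2 * j + 1, by omega⟩))
        else 1) *
      ∏ i : Fin p, if 2 * s ≤ (i : ℕ) then KMix (e 0) (e 1) (β (ρ i)) (γ (τ i)) else 1
  have hγ : ∀ (β) (σ : Equiv.Perm (Fin p)) (γ), KTraceless (e 0) (e 1) p β (γ ∘ σ) =
      KTraceless (e 0) (e 1) p β γ := by
    intro β σ γ
    simp only [KTraceless, Function.comp]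
    refine Finset.sum_congr rfl fun s _ => ?_
    congr 2
    refine Finset.sum_congr rfl fun ρ _ => ?_
    exact Equiv.sum_comp (Equiv.mulLeft σ) fun τ =>
      (∏ j : Fin (p / 2), if (j : ℕ) < s then
          KLow (e 0) (e 1) (β (ρ ⟨2 * j, by omega⟩)) (β (ρ ⟨2 * j + 1, by omega⟩)) *
            KUp (e 0) (e 1) (γ (τ ⟨2 * j, by omega⟩)) (γ (τ ⟨2 * j + 1, by omega⟩))
        else 1) *
      ∏ i : Fin p, if 2 * s ≤ (i : ℕ) then KMix (e 0) (e 1) (β (ρ i)) (γ (τ i)) else 1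
  have hE := isSymmC_tpow p (nullE e)
  have hE' := isSymmC_tpow p (nullE' e)
  have hU := isSymmC_tpow p (up (nullE e))
  have hU' := isSymmC_tpow p (up (nullE' e))
  -- polarize in `γ` for fixed `x`, then in `β`
  have h1 : ∀ x : Fin 4 → ℂ, (fun γ => ∑ β : Fin p → Fin 4, (KTraceless (e 0) (e 1) p β γ : ℂ) *
      ∏ i, x (β i)) = fun γ => ∑ β : Fin p → Fin 4, kap p * (tpow p (nullE e) β *
        tpow p (up (nullE' e)) γ + tpow p (nullE' e) β * tpow p (up (nullE e)) γ) *
          ∏ i, x (β i) := by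
    intro x
    refine IsSymmC.ext_of_diagonal (fun σ γ => by simp only [hγ])
      (fun σ γ => by simp only [hU σ γ, hU' σ γ]) fun y => ?_
    have h := sum_KTraceless he p x y
    rw [Finset.sum_comm] at h
    simp only [Finset.sum_mul]
    rw [h, mul_pow, mul_pow, ← sum_tpow_mul, ← sum_tpow_mul, ← sum_tpow_mul, ← sum_tpow_mul,
      Finset.sum_mul_sum, Finset.sum_mul_sum, ← Finset.sum_add_distrib, Finset.mul_sum]
    symm
    rw [Finset.sum_comm]
    refine Finset.sum_congr rfl fun β _ => ?_
    rw [← Finset.sum_add_distrib, Finset.mul_sum]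
    refine Finset.sum_congr rfl fun γ _ => ?_
    ring
  have h2 := IsSymmC.ext_of_diagonal (T := fun β => (KTraceless (e 0) (e 1) p β γ : ℂ))
    (S := fun β => kap p * (tpow p (nullE e) β * tpow p (up (nullE' e)) γ +
      tpow p (nullE' e) β * tpow p (up (nullE e)) γ)) (fun σ β => by simp only [hβ])
      (fun σ β => by simp only [hE σ β, hE' σ β]) fun x => congrFun (h1 x) γ
  exact congrFun h2 β

/-! ### Contractions of symmetric tensors -/

/-- The covector `e_i` with complex components. -/
def cvec (e : Fin 4 → Fin 4 → ℝ) (i : Fin 4) (a : Fin 4) : ℂ := e i a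

/-- The new unknowns in terms of the functional of the tensor: their only two components are along `E'^p`
and `E^p`. -/
theorem contractUV_eq {e : Fin 4 → Fin 4 → ℝ} (he : IsFrame e) (p h k : ℕ) {T : Tensor (p + h + k)}
    (hT : IsSymm T) (γ : Fin p → Fin 4) :
    (contractUV (e 0) (e 1) p h k T γ : ℂ) = kap p *
      (tpow p (up (nullE' e)) γ * umbral (toComplex T)
          (lin (nullE e) ^ p * lin (cvec e 0) ^ h * lin (cvec e 1) ^ k) +
        tpow p (up (nullE e)) γ * umbral (toComplex T)
          (lin (nullE' e) ^ p * lin (cvec e 0) ^ h * lin (cvec e 1) ^ k)) := by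
  have key : ∀ w : Fin 4 → ℂ, umbral (toComplex T)
      (lin w ^ p * lin (cvec e 0) ^ h * lin (cvec e 1) ^ k) =
      ∑ β : Fin p → Fin 4, ∑ x : Fin h → Fin 4, ∑ y : Fin k → Fin 4,
        tpow p w β * (∏ i, (e 0 (x i) : ℂ)) * (∏ i, (e 1 (y i) : ℂ)) *
          T (Fin.append (Fin.append β x) y) := by
    intro w
    have h1 := umbral_prod_lin hT.toComplex (Fin.append (Fin.append (fun _ : Fin p => w)
      (fun _ : Fin h => cvec e 0)) (fun _ : Fin k => cvec e 1))
    rw [Fin.prod_univ_add, Fin.prod_univ_add] at h1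
    simp only [Fin.append_left, Fin.append_right, Finset.prod_const, Finset.card_univ,
      Fintype.card_fin] at h1
    rw [h1, ← (Fin.appendEquiv (p + h) k).sum_comp, Fintype.sum_prod_type,
      ← (Fin.appendEquiv p h).sum_comp, Fintype.sum_prod_type]
    refine Finset.sum_congr rfl fun β _ => Finset.sum_congr rfl fun x _ =>
      Finset.sum_congr rfl fun y _ => ?_
    rw [Fin.prod_univ_add, Fin.prod_univ_add]
    simp only [Fin.appendEquiv, Equiv.coe_fn_mk, Fin.append_left, Fin.append_right, toComplex, tpow,
      cvec]
    ring
  rw [key, key, contractUV]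
  push_cast
  simp only [KTraceless_eq he, Finset.mul_sum, ← Finset.sum_add_distrib]
  refine Finset.sum_congr rfl fun β _ => Finset.sum_congr rfl fun x _ =>
      Finset.sum_congr rfl fun y _ => ?_
  ring

/-! ### Null coordinates and trace-less tensors -/

theorem isHomogeneous_lin (x : Fin 4 → ℂ) : (lin x).IsHomogeneous 1 :=
  IsHomogeneous.sum _ _ _ fun a _ => by
    simpa using (isHomogeneous_C (Fin 4) (x a)).mul (isHomogeneous_X ℂ a)

theorem isHomogeneous_E_U_V (x y z : Fin 4 → ℂ) (p h k : ℕ) :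
    (lin x ^ p * lin y ^ h * lin z ^ k).IsHomogeneous (p + h + k) := by
  have := (((isHomogeneous_lin x).pow p).mul ((isHomogeneous_lin y).pow h)).mul
    ((isHomogeneous_lin z).pow k)
  simpa using this

theorem map_eq_zero_of_isHomogeneous {n : ℕ} (f : MvPolynomial (Fin 4) ℂ →+ ℂ)
    (hf : ∀ (k : Fin 4 →₀ ℕ) (c : ℂ), k.degree = n → f (monomial k c) = 0)
    {P : MvPolynomial (Fin 4) ℂ} (hP : P.IsHomogeneous n) : f P = 0 := by
  rw [P.as_sum, map_sum]
  refine Finset.sum_eq_zero fun k hk => hf k _ ?_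
  have := hP (mem_support_iff.mp hk)
  rwa [Finsupp.degree_eq_weight_one]

theorem umbral_of_isHomogeneous {n m : ℕ} (T : (Fin n → Fin 4) → ℂ) (hm : m ≠ n)
    {P : MvPolynomial (Fin 4) ℂ} (hP : P.IsHomogeneous m) : umbral T P = 0 :=
  map_eq_zero_of_isHomogeneous (umbral T).toAddMonoidHom
    (fun _ c hk => umbral_monomial_of_degree_ne T (hk ▸ hm) c) hP

/-- Real tensors give functionals that commute with complex conjugation. -/
theorem umbral_conj {n : ℕ} {T : Tensor n} (hT : IsSymm T) (P : MvPolynomial (Fin 4) ℂ) :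
    umbral (toComplex T) (map (starRingEnd ℂ) P) =
      (starRingEnd ℂ) (umbral (toComplex T) P) := by
  induction P using MvPolynomial.induction_on' with
  | monomial k c =>
    rw [map_monomial]
    by_cases hk : k.degree = n
    · obtain ⟨ι, rfl⟩ := exists_expo_eq hk
      have h1 : ∀ c : ℂ, monomial (expo ι) c = c • ∏ i, (X (ι i) : MvPolynomial (Fin 4) ℂ) := by
        intro c
        rw [prod_X_eq_monomial]
        simp [smul_monomial]
      rw [h1, h1, map_smul, map_smul, umbral_prod_X hT.toComplex]
      simp [toComplex]
    · rw [umbral_monomial_of_degree_ne _ hk, umbral_monomial_of_degree_ne _ hk, map_zero]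
  | add p q hp hq => simp only [map_add, hp, hq]

theorem map_conj_lin (x : Fin 4 → ℂ) :
    map (starRingEnd ℂ) (lin x) = lin fun a => (starRingEnd ℂ) (x a) := by
  simp [lin]

theorem umbral_nullE' {n : ℕ} {T : Tensor n} (hT : IsSymm T) (e : Fin 4 → Fin 4 → ℝ) (p h k : ℕ) :
    umbral (toComplex T) (lin (nullE' e) ^ p * lin (cvec e 0) ^ h * lin (cvec e 1) ^ k) =
      (starRingEnd ℂ) (umbral (toComplex T)
        (lin (nullE e) ^ p * lin (cvec e 0) ^ h * lin (cvec e 1) ^ k)) := by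
  rw [← umbral_conj hT]
  simp only [map_mul, map_pow, map_conj_lin, conj_nullE, cvec, Complex.conj_ofReal]
  rfl

/-- The coordinate `X_a` in terms of the null coordinates. -/
theorem IsFrame.X_eq {e : Fin 4 → Fin 4 → ℝ} (he : IsFrame e) (a : Fin 4) :
    C (eta a : ℂ) * X a = C (-(cvec e 0 a)) * lin (cvec e 0) + C (cvec e 1 a) * lin (cvec e 1) +
      C (nullE' e a / 2) * lin (nullE e) + C (nullE e a / 2) * lin (nullE' e) := by
  simp only [lin, Finset.mul_sum, ← Finset.sum_add_distrib]
  have h : ∀ b, C (-(cvec e 0 a)) * (C (cvec e 0 b) * X b) +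
      C (cvec e 1 a) * (C (cvec e 1 b) * X b) +
      C (nullE' e a / 2) * (C (nullE e b) * X b) + C (nullE e a / 2) * (C (nullE' e b) * X b) =
      (if a = b then C (eta a : ℂ) * X a else 0 : MvPolynomial (Fin 4) ℂ) := by
    intro b
    have hm := he.KLow_eq a b
    have h1 : (KLow (e 0) (e 1) a b : ℂ) = (if a = b then (eta a : ℂ) else 0) +
        cvec e 0 a * cvec e 0 b - cvec e 1 a * cvec e 1 b := by
      rw [KLow, hLow, metric]
      simp only [Complex.ofReal_sub, Complex.ofReal_add, Complex.ofReal_mul, cvec,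
        apply_ite Complex.ofReal, Complex.ofReal_zero]
    rw [h1] at hm
    have h2 : -(cvec e 0 a) * cvec e 0 b + cvec e 1 a * cvec e 1 b + nullE' e a / 2 * nullE e b +
        nullE e a / 2 * nullE' e b = if a = b then (eta a : ℂ) else 0 := by
      linear_combination -hm
    simp only [← mul_assoc, ← C_mul, ← add_mul, ← C_add, h2]
    split_ifs with hab
    · rw [hab]
    · simp
  rw [Finset.sum_congr rfl fun b _ => h b]
  simp

/-- The metric in null coordinates. -/
theorem IsFrame.quad_eq {e : Fin 4 → Fin 4 → ℝ} (he : IsFrame e) :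
    quad = lin (nullE e) * lin (nullE' e) - lin (cvec e 0) ^ 2 + lin (cvec e 1) ^ 2 := by
  have h : ∀ a, C (eta a : ℂ) * (X a * X a) = -(lin (cvec e 0) * (C (cvec e 0 a) * X a)) +
      lin (cvec e 1) * (C (cvec e 1 a) * X a) +
      C (1 / 2) * (lin (nullE e) * (C (nullE' e a) * X a)) +
        C (1 / 2) * (lin (nullE' e) * (C (nullE e a) * X a)) := by
    intro a
    rw [← mul_assoc, he.X_eq]
    simp only [div_eq_mul_inv, C_mul, C_neg, one_mul]
    ring
  rw [quad, Finset.sum_congr rfl fun a _ => h a]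
  simp only [Finset.sum_add_distrib, Finset.sum_neg_distrib, ← Finset.mul_sum]
  have hc : (C (1 / 2) : MvPolynomial (Fin 4) ℂ) + C (1 / 2) = 1 := by
    rw [← C_add]; norm_num
  change -(lin (cvec e 0) * lin (cvec e 0)) + lin (cvec e 1) * lin (cvec e 1) +
    C (1 / 2) * (lin (nullE e) * lin (nullE' e)) + C (1 / 2) * (lin (nullE' e) * lin (nullE e)) = _
  linear_combination (lin (nullE e) * lin (nullE' e)) * hc

/-- For a trace-less tensor the factor `E E'` can be traded for `U² - V²`. -/
theorem umbral_E_E' {e : Fin 4 → Fin 4 → ℝ} (he : IsFrame e) {n : ℕ} {T : Tensor n}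
    (hT : IsSymmTraceless T) (P : MvPolynomial (Fin 4) ℂ) :
    umbral (toComplex T) (lin (nullE e) * lin (nullE' e) * P) =
      umbral (toComplex T) ((lin (cvec e 0) ^ 2 - lin (cvec e 1) ^ 2) * P) := by
  have h := umbral_quad_mul hT P
  rw [he.quad_eq, show (lin (nullE e) * lin (nullE' e) - lin (cvec e 0) ^ 2 + lin (cvec e 1) ^ 2) * P
    = lin (nullE e) * lin (nullE' e) * P - (lin (cvec e 0) ^ 2 - lin (cvec e 1) ^ 2) * P by ring,
    map_sub, sub_eq_zero] at h
  exact h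

/-- The null basis `u, v, E, E'` of complex covectors. -/
noncomputable def nullBasis (e : Fin 4 → Fin 4 → ℝ) : Fin 4 → Fin 4 → ℂ :=
  ![cvec e 0, cvec e 1, nullE e, nullE' e]

/-- The coordinates `X_a` as linear forms in variables that stand for the null coordinates. -/
noncomputable def nullSubst (e : Fin 4 → Fin 4 → ℝ) (a : Fin 4) : MvPolynomial (Fin 4) ℂ :=
  C (eta a : ℂ) * (C (-(cvec e 0 a)) * X 0 + C (cvec e 1 a) * X 1 + C (nullE' e a / 2) * X 2 +
    C (nullE e a / 2) * X 3)

theorem aeval_nullBasis_nullSubst {e : Fin 4 → Fin 4 → ℝ} (he : IsFrame e)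
    (P : MvPolynomial (Fin 4) ℂ) :
    aeval (fun j => lin (nullBasis e j)) (aeval (nullSubst e) P) = P := by
  have h : (aeval (R := ℂ) fun j => lin (nullBasis e j)).comp (aeval (nullSubst e)) =
      AlgHom.id ℂ (MvPolynomial (Fin 4) ℂ) := by
    refine MvPolynomial.algHom_ext fun a => ?_
    have h1 := he.X_eq a
    simp only [AlgHom.comp_apply, aeval_X, nullSubst, AlgHom.id_apply, map_mul, map_add,
      algHom_C, algebraMap_eq, nullBasis, Matrix.cons_val_zero, Matrix.cons_val_one, Matrix.cons_val]
    rw [← h1, ← mul_assoc, ← C_mul, eta_mul_self_complex, C_1, one_mul]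
  exact DFunLike.congr_fun h P

/-- A symmetric trace-less tensor is determined by its contractions with powers of `E`, `u`, `v`. -/
theorem eq_zero_of_umbral {e : Fin 4 → Fin 4 → ℝ} (he : IsFrame e) {n : ℕ} {T : Tensor n}
    (hT : IsSymmTraceless T)
    (h : ∀ p h k, p + h + k = n → umbral (toComplex T)
      (lin (nullE e) ^ p * lin (cvec e 0) ^ h * lin (cvec e 1) ^ k) = 0) : T = 0 := by
  have h0 : ∀ p h k, umbral (toComplex T)
      (lin (nullE e) ^ p * lin (cvec e 0) ^ h * lin (cvec e 1) ^ k) = 0 := by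
    intro p q k
    by_cases hn : p + q + k = n
    · exact h p q k hn
    · exact umbral_of_isHomogeneous _ hn (isHomogeneous_E_U_V _ _ _ _ _ _)
  have h1 : ∀ d c a b, umbral (toComplex T) (lin (cvec e 0) ^ a * lin (cvec e 1) ^ b *
      lin (nullE e) ^ c * lin (nullE' e) ^ d) = 0 := by
    intro d
    induction d with
    | zero =>
      intro c a b
      rw [pow_zero, mul_one, mul_comm, ← mul_assoc]
      exact h0 c a b
    | succ d ih =>
      intro c a b
      rcases c with _ | c
      · have := umbral_nullE' hT.1 e (d + 1) a b
        rw [h0, map_zero] at this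
        rwa [pow_zero, mul_one, mul_comm, ← mul_assoc]
      · have h2 := umbral_E_E' he hT (lin (cvec e 0) ^ a * lin (cvec e 1) ^ b *
          lin (nullE e) ^ c * lin (nullE' e) ^ d)
        have h3 := ih c (a + 2) b
        have h4 := ih c a (b + 2)
        rw [sub_mul, map_sub] at h2
        generalize lin (cvec e 0) = U, lin (cvec e 1) = V, lin (nullE e) = E,
          lin (nullE' e) = E' at h2 h3 h4 ⊢
        rw [show U ^ (a + 2) * V ^ b * E ^ c * E' ^ d = U ^ 2 * (U ^ a * V ^ b * E ^ c * E' ^ d) by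
          ring] at h3
        rw [show U ^ a * V ^ (b + 2) * E ^ c * E' ^ d = V ^ 2 * (U ^ a * V ^ b * E ^ c * E' ^ d) by
          ring] at h4
        rw [h3, h4, sub_zero] at h2
        rw [← h2]
        congr 1
        ring
  have h2 : ∀ P : MvPolynomial (Fin 4) ℂ, umbral (toComplex T) P = 0 := by
    intro P
    rw [← aeval_nullBasis_nullSubst he P]
    induction aeval (nullSubst e) P using MvPolynomial.induction_on' with
    | monomial k c =>
      rw [aeval_monomial, algebraMap_eq, ← smul_eq_C_mul, map_smul,
        Finsupp.prod_fintype _ _ (by simp), Fin.prod_univ_four]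
      simp only [nullBasis, Matrix.cons_val_zero, Matrix.cons_val_one, Matrix.cons_val]
      rw [h1, smul_zero]
    | add p q hp hq => rw [map_add, map_add, hp, hq, add_zero]
  funext ι
  have := h2 (∏ i, X (ι i))
  rw [umbral_prod_X hT.1.toComplex] at this
  exact Complex.ofReal_eq_zero.mp this

theorem umbral_sub {n : ℕ} {T S : Tensor n} (hT : IsSymm T) (hS : IsSymm S)
    (P : MvPolynomial (Fin 4) ℂ) : umbral (toComplex (T - S)) P =
      umbral (toComplex T) P - umbral (toComplex S) P := by
  have hTS : IsSymm (T - S) := fun σ β => by simp [hT σ β, hS σ β]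
  induction P using MvPolynomial.induction_on' with
  | monomial k c =>
    by_cases hk : k.degree = n
    · obtain ⟨ι, rfl⟩ := exists_expo_eq hk
      have h1 : monomial (expo ι) c = c • ∏ i, (X (ι i) : MvPolynomial (Fin 4) ℂ) := by
        rw [prod_X_eq_monomial]
        simp [smul_monomial]
      rw [h1, map_smul, map_smul, map_smul, umbral_prod_X hT.toComplex, umbral_prod_X hS.toComplex,
        umbral_prod_X hTS.toComplex]
      simp [toComplex, mul_sub]
    · simp only [umbral_monomial_of_degree_ne _ hk, sub_zero]
  | add p q hp hq =>
    rw [map_add, map_add, map_add, hp, hq]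
    ring

theorem ext_of_umbral {e : Fin 4 → Fin 4 → ℝ} (he : IsFrame e) {n : ℕ} {T S : Tensor n}
    (hT : IsSymmTraceless T) (hS : IsSymmTraceless S)
    (h : ∀ p h k, p + h + k = n → umbral (toComplex T)
      (lin (nullE e) ^ p * lin (cvec e 0) ^ h * lin (cvec e 1) ^ k) = umbral (toComplex S)
      (lin (nullE e) ^ p * lin (cvec e 0) ^ h * lin (cvec e 1) ^ k)) : T = S := by
  rw [← sub_eq_zero]
  refine eq_zero_of_umbral he ⟨fun σ β => by simp [hT.1 σ β, hS.1 σ β], fun i j hij β => ?_⟩ ?_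
  · simp only [Pi.sub_apply, mul_sub, Finset.sum_sub_distrib, hT.2 i j hij β, hS.2 i j hij β,
      sub_zero]
  · intro p q k hn
    rw [umbral_sub hT.1 hS.1, h p q k hn, sub_self]

/-! ### Prescribing the contractions of a trace-less tensor -/

/-- The value of the functional on `E^c E'^d U^a V^b` if its values on `E^c U^a V^b` are `z c a b`, its
values on `E'^d U^a V^b` are the complex conjugates, and `E E'` counts as `U² - V²`. -/
noncomputable def normalForm (z : ℕ → ℕ → ℕ → ℂ) : ℕ → ℕ → ℕ → ℕ → ℂ
  | c, 0, a, b => z c a b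
  | 0, d + 1, a, b => (starRingEnd ℂ) (z (d + 1) a b)
  | c + 1, d + 1, a, b => normalForm z c d (a + 2) b - normalForm z c d a (b + 2)

/-- The linear functional with the values `normalForm` on monomials in the null coordinates. -/
noncomputable def normalFunctional (z : ℕ → ℕ → ℕ → ℂ) : MvPolynomial (Fin 4) ℂ →ₗ[ℂ] ℂ :=
  (basisMonomials (Fin 4) ℂ).constr ℂ fun k => normalForm z (k 2) (k 3) (k 0) (k 1)

theorem normalFunctional_monomial (z : ℕ → ℕ → ℕ → ℂ) (k : Fin 4 →₀ ℕ) (c : ℂ) :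
    normalFunctional z (monomial k c) = c * normalForm z (k 2) (k 3) (k 0) (k 1) := by
  have := (basisMonomials (Fin 4) ℂ).constr_basis ℂ
    (fun k => normalForm z (k 2) (k 3) (k 0) (k 1)) k
  rw [coe_basisMonomials] at this
  have h1 : monomial k c = c • monomial k (1 : ℂ) := by simp [smul_monomial]
  rw [h1, map_smul, normalFunctional, this, smul_eq_mul]

theorem normalFunctional_quad (z : ℕ → ℕ → ℕ → ℂ) (P : MvPolynomial (Fin 4) ℂ) :
    normalFunctional z ((X 2 * X 3 - X 0 ^ 2 + X 1 ^ 2) * P) = 0 := by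
  induction P using MvPolynomial.induction_on' with
  | monomial k c =>
    have h : ∀ j : Fin 4, (X j : MvPolynomial (Fin 4) ℂ) = monomial (Finsupp.single j 1) 1 :=
      fun _ => rfl
    rw [add_mul, sub_mul, sq, sq, h, h, h, h]
    simp only [monomial_mul, map_add, map_sub, normalFunctional_monomial]
    simp only [Finsupp.add_apply, Finsupp.single_apply, one_ne_zero, zero_ne_one, if_true, if_false,
      Fin.reduceEq, one_mul, mul_one, zero_add, add_zero, Nat.reduceAdd]
    rw [add_comm 1 (k 2), add_comm 1 (k 3), add_comm 2 (k 0), add_comm 2 (k 1)]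
    simp only [normalForm]
    ring
  | add p q hp hq => rw [mul_add, map_add, hp, hq, add_zero]

theorem aeval_nullSubst_lin {e : Fin 4 → Fin 4 → ℝ} (he : IsFrame e) :
    aeval (nullSubst e) (lin (cvec e 0)) = (X 0 : MvPolynomial (Fin 4) ℂ) ∧
    aeval (nullSubst e) (lin (cvec e 1)) = (X 1 : MvPolynomial (Fin 4) ℂ) ∧
    aeval (nullSubst e) (lin (nullE e)) = (X 2 : MvPolynomial (Fin 4) ℂ) ∧
    aeval (nullSubst e) (lin (nullE' e)) = (X 3 : MvPolynomial (Fin 4) ℂ) := by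
  have key : ∀ w : Fin 4 → ℂ, aeval (nullSubst e) (lin w) =
      C (-∑ a, eta a * cvec e 0 a * w a) * X 0 + C (∑ a, eta a * cvec e 1 a * w a) * X 1 +
      C ((∑ a, up (nullE' e) a * w a) / 2) * X 2 +
      C ((∑ a, up (nullE e) a * w a) / 2) * (X 3 : MvPolynomial (Fin 4) ℂ) := by
    intro w
    simp only [lin, map_sum, map_mul, algHom_C, algebraMap_eq, aeval_X, nullSubst, up, C_neg,
      div_eq_mul_inv, Finset.sum_mul, ← Finset.sum_add_distrib, ← Finset.sum_neg_distrib]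
    refine Finset.sum_congr rfl fun a _ => ?_
    ring
  have hm : ∀ i j, ∑ a, (eta a : ℂ) * e i a * e j a = (metric i j : ℂ) := by
    intro i j
    rw [← he i j, mdot]
    push_cast
    rfl
  obtain ⟨⟨h1, h2, h3⟩, h4, h5, h6, h7⟩ := he.sum_eta_null
  have hsw : ∀ x w : Fin 4 → ℂ, ∑ a, (eta a : ℂ) * x a * w a = ∑ a, up w a * x a :=
    fun x w => Finset.sum_congr rfl fun a _ => by simp only [up]; ring
  have h3' : ∑ a, up (nullE e) a * nullE' e a = 2 := by
    rw [← h3]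
    exact Finset.sum_congr rfl fun a _ => by simp only [up]; ring
  refine ⟨?_, ?_, ?_, ?_⟩
  · rw [key]
    simp only [cvec]
    rw [h4, h5, hm, hm]
    simp [metric, eta]
  · rw [key]
    simp only [cvec]
    rw [h6, h7, hm, hm]
    simp [metric, eta]
  · rw [key, hsw, hsw]
    simp only [cvec]
    rw [h4, h6, h1, h3]
    simp
  · rw [key, hsw, hsw]
    simp only [cvec]
    rw [h5, h7, h2, h3']
    simp

theorem prod_update_update {M : Type*} [CommMonoid M] (g : Fin 4 → M) {n : ℕ} {i j : Fin n}
    (hij : i ≠ j) (β : Fin n → Fin 4) (a b : Fin 4) :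
    ∏ k, g (Function.update (Function.update β i a) j b k) =
      g a * g b * ∏ k ∈ (Finset.univ.erase i).erase j, g (β k) := by
  rw [← Finset.mul_prod_erase Finset.univ _ (Finset.mem_univ i),
    ← Finset.mul_prod_erase (Finset.univ.erase i) _ (a := j) (by simp [hij.symm]),
    Function.update_self, Function.update_of_ne hij, Function.update_self, ← mul_assoc]
  congr 1
  refine Finset.prod_congr rfl fun k hk => ?_
  simp only [Finset.mem_erase] at hk
  rw [Function.update_of_ne hk.1, Function.update_of_ne hk.2.1]

/-- The contractions of a symmetric trace-less tensor with `E^p u^h v^k` can be prescribed, subject only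
to being real for `p = 0`. -/
theorem exists_traceless {e : Fin 4 → Fin 4 → ℝ} (he : IsFrame e) (n : ℕ) (z : ℕ → ℕ → ℕ → ℂ)
    (hz : ∀ h k, (starRingEnd ℂ) (z 0 h k) = z 0 h k) :
    ∃ T : Tensor n, IsSymmTraceless T ∧ ∀ p h k, p + h + k = n → umbral (toComplex T)
      (lin (nullE e) ^ p * lin (cvec e 0) ^ h * lin (cvec e 1) ^ k) = z p h k := by
  obtain ⟨hU, hV, hE, hE'⟩ := aeval_nullSubst_lin he
  set Ψ : MvPolynomial (Fin 4) ℂ →ₗ[ℂ] ℂ :=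
    (normalFunctional z).comp (aeval (nullSubst e)).toLinearMap with hΨ
  have hquad : ∀ P, Ψ (quad * P) = 0 := by
    intro P
    rw [hΨ, LinearMap.comp_apply, AlgHom.toLinearMap_apply, map_mul, he.quad_eq]
    simp only [map_add, map_sub, map_mul, map_pow, hU, hV, hE, hE']
    exact normalFunctional_quad z _
  have hsymm : IsSymm (fun ι : Fin n → Fin 4 => (Ψ (∏ i, X (ι i))).re) := by
    intro σ β
    simp only [Function.comp]
    rw [Equiv.prod_comp σ fun i => (X (β i) : MvPolynomial (Fin 4) ℂ)]
  refine ⟨fun ι => (Ψ (∏ i, X (ι i))).re, ⟨hsymm, ?_⟩, ?_⟩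
  · intro i j hij β
    have h := hquad (∏ k ∈ (Finset.univ.erase i).erase j, X (β k))
    rw [quad, Finset.sum_mul, map_sum] at h
    have h2 := congrArg Complex.re h
    rw [Complex.re_sum, Complex.zero_re] at h2
    rw [← h2]
    refine Finset.sum_congr rfl fun a _ => ?_
    beta_reduce
    rw [prod_update_update X hij, mul_assoc (C (eta a : ℂ)), ← smul_eq_C_mul, map_smul, smul_eq_mul,
      Complex.re_ofReal_mul]
  · intro p h k hn
    -- the functional of the real part is the mean of `Ψ` and its conjugate
    set f : MvPolynomial (Fin 4) ℂ →+ ℂ := AddMonoidHom.mk'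
      (fun P => umbral (toComplex fun ι : Fin n → Fin 4 => (Ψ (∏ i, X (ι i))).re) P -
        (Ψ P + (starRingEnd ℂ) (Ψ (map (starRingEnd ℂ) P))) / 2) (fun P Q => by
          simp only [map_add]
          ring) with hf
    have h1 : f (lin (nullE e) ^ p * lin (cvec e 0) ^ h * lin (cvec e 1) ^ k) = 0 := by
      refine map_eq_zero_of_isHomogeneous (n := n) f (fun q c hq => ?_)
        (hn ▸ isHomogeneous_E_U_V _ _ _ p h k)
      obtain ⟨ι, rfl⟩ := exists_expo_eq hq
      have h1 : ∀ c : ℂ, monomial (expo ι) c = c • ∏ i, (X (ι i) : MvPolynomial (Fin 4) ℂ) := by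
        intro c
        rw [prod_X_eq_monomial]
        simp [smul_monomial]
      simp only [hf, AddMonoidHom.mk'_apply, map_monomial]
      rw [h1, h1, map_smul, umbral_prod_X hsymm.toComplex, map_smul, map_smul, toComplex,
        Complex.re_eq_add_conj]
      simp only [smul_eq_mul, map_mul, Complex.conj_conj]
      ring
    simp only [hf, AddMonoidHom.mk'_apply] at h1
    rw [sub_eq_zero] at h1
    have h2 : map (starRingEnd ℂ) (lin (nullE e) ^ p * lin (cvec e 0) ^ h * lin (cvec e 1) ^ k) =
        lin (nullE' e) ^ p * lin (cvec e 0) ^ h * lin (cvec e 1) ^ k := by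
      simp only [map_mul, map_pow, map_conj_lin, conj_nullE, cvec, Complex.conj_ofReal]
      rfl
    rw [h1, h2]
    change (Ψ (lin (nullE e) ^ p * lin (cvec e 0) ^ h * lin (cvec e 1) ^ k) + (starRingEnd ℂ)
      (Ψ (lin (nullE' e) ^ p * lin (cvec e 0) ^ h * lin (cvec e 1) ^ k))) / 2 = z p h k
    rw [hΨ, LinearMap.comp_apply, LinearMap.comp_apply, AlgHom.toLinearMap_apply,
      AlgHom.toLinearMap_apply]
    simp only [map_mul, map_pow, hU, hV, hE, hE']
    have hmon : ∀ j : Fin 4, (X j ^ p * X 0 ^ h * X 1 ^ k : MvPolynomial (Fin 4) ℂ) =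
        monomial (Finsupp.single j p + Finsupp.single 0 h + Finsupp.single 1 k) 1 := by
      intro j
      simp only [X_pow_eq_monomial, monomial_mul, mul_one]
    rw [hmon, hmon, normalFunctional_monomial, normalFunctional_monomial]
    rcases p with _ | p
    · simp [Fin.ext_iff, normalForm, hz]
    · simp [Fin.ext_iff, normalForm]

/-! ### Planar trace-less tensors and the change of unknowns -/

theorem sum_update_mul {p : ℕ} (x y : Fin 4 → ℂ) (γ : Fin p → Fin 4) (i : Fin p) :
    ∑ a, y a * tpow p x (Function.update γ i a) =
      (∑ a, x a * y a) * ∏ j ∈ Finset.univ.erase i, x (γ j) := by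
  rw [Finset.sum_mul]
  refine Finset.sum_congr rfl fun a _ => ?_
  rw [tpow, ← Finset.mul_prod_erase Finset.univ _ (Finset.mem_univ i), Function.update_self,
    Finset.prod_congr rfl fun j hj => by rw [Function.update_of_ne (Finset.ne_of_mem_erase hj)]]
  ring

/-- Real tensors of the form `z E'^p + z' E^p` are planar and trace-less, as `E` and `E'` are null and
orthogonal to `u` and `v`. -/
theorem isPlanarTraceless_of_eq {e : Fin 4 → Fin 4 → ℝ} (he : IsFrame e) {p : ℕ} {Y : Tensor p}
    {z z' : ℂ} (hY : ∀ γ, (Y γ : ℂ) = tpow p (up (nullE' e)) γ * z + tpow p (up (nullE e)) γ * z') :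
    IsPlanarTraceless (e 0) (e 1) Y := by
  obtain ⟨⟨h1, h2, h3⟩, h4, h5, h6, h7⟩ := he.sum_eta_null
  refine ⟨fun σ β => ?_, fun i γ => ?_, fun i γ => ?_, fun i j hij γ => ?_⟩
  · have := hY (β ∘ σ)
    rw [isSymmC_tpow, isSymmC_tpow, ← hY] at this
    exact_mod_cast this
  · rw [← Complex.ofReal_eq_zero, Complex.ofReal_sum]
    simp only [Complex.ofReal_mul, hY, mul_add, ← mul_assoc, Finset.sum_add_distrib,
      ← Finset.sum_mul, sum_update_mul]
    rw [h4, h5]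
    simp
  · rw [← Complex.ofReal_eq_zero, Complex.ofReal_sum]
    simp only [Complex.ofReal_mul, hY, mul_add, ← mul_assoc, Finset.sum_add_distrib,
      ← Finset.sum_mul, sum_update_mul]
    rw [h6, h7]
    simp
  · rw [← Complex.ofReal_eq_zero, Complex.ofReal_sum]
    simp only [Complex.ofReal_sum, Complex.ofReal_mul, hY, he.KLow_eq]
    have key : ∀ x : Fin 4 → ℂ, (∑ a, x a * nullE e a) * (∑ b, x b * nullE' e b) = 0 →
        ∑ a, ∑ b, (nullE e a * nullE' e b + nullE' e a * nullE e b) / 2 *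
          tpow p x (Function.update (Function.update γ i a) j b) = 0 := by
      intro x hx
      have hu : ∀ a b, tpow p x (Function.update (Function.update γ i a) j b) =
          x a * x b * ∏ k ∈ (Finset.univ.erase i).erase j, x (γ k) :=
        fun a b => prod_update_update x hij γ a b
      have h8 : ∀ a b, (nullE e a * nullE' e b + nullE' e a * nullE e b) / 2 *
          (x a * x b * ∏ k ∈ (Finset.univ.erase i).erase j, x (γ k)) =
          ((x a * nullE e a) * (x b * nullE' e b) + (x a * nullE' e a) * (x b * nullE e b)) *
            ((∏ k ∈ (Finset.univ.erase i).erase j, x (γ k)) / 2) := by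
        intro a b
        ring
      simp only [hu, h8]
      simp only [← Finset.mul_sum, ← Finset.sum_mul, Finset.sum_add_distrib]
      rw [mul_comm (∑ a, x a * nullE' e a), hx]
      simp
    have hA := key (up (nullE' e)) (by rw [h2, mul_zero])
    have hB := key (up (nullE e)) (by rw [h1, zero_mul])
    simp only [mul_add, ← mul_assoc, Finset.sum_add_distrib, ← Finset.sum_mul, hA, hB]
    simp

theorem IsPlanarTraceless.isSymmTraceless {e : Fin 4 → Fin 4 → ℝ} {p : ℕ} {Y : Tensor p}
    (hY : IsPlanarTraceless (e 0) (e 1) Y) : IsSymmTraceless Y := by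
  refine ⟨hY.1, fun i j hij γ => ?_⟩
  have h0 : ∀ a b, metric a b = KLow (e 0) (e 1) a b - e 0 a * e 0 b + e 1 a * e 1 b := by
    intro a b
    rw [KLow, hLow]
    ring
  have h1 : ∑ a, ∑ b, metric a b * Y (Function.update (Function.update γ i a) j b) = 0 := by
    simp only [h0, add_mul, sub_mul, Finset.sum_add_distrib, Finset.sum_sub_distrib,
      hY.2.2.2 i j hij γ, mul_assoc, ← Finset.mul_sum, hY.2.1 j, hY.2.2.1 j]
    simp
  rw [← h1]
  refine Finset.sum_congr rfl fun a _ => ?_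
  simp [metric]

theorem umbral_lin_mul_eq_zero {p : ℕ} {Y : Tensor p} (hY : IsSymm Y) {w : Fin 4 → ℝ}
    (h : ∀ (i : Fin p) (γ : Fin p → Fin 4), ∑ a, w a * Y (Function.update γ i a) = 0)
    (P : MvPolynomial (Fin 4) ℂ) : umbral (toComplex Y) (lin (fun a => (w a : ℂ)) * P) = 0 := by
  refine umbral_mul_eq_zero _ (fun m ι => ?_) P
  have h2 : ∀ a, X a * ∏ i, X (ι i) =
      ∏ i, (X ((Fin.cons a ι : Fin (m + 1) → Fin 4) i) : MvPolynomial (Fin 4) ℂ) := by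
    intro a
    simp [Fin.prod_univ_succ]
  rw [lin, Finset.sum_mul, map_sum]
  by_cases hm : m + 1 = p
  · subst hm
    have h0 := h 0 (Fin.cons 0 ι)
    have h4 : ∀ a, umbral (toComplex Y) (C (w a : ℂ) * X a * ∏ i, X (ι i)) =
        ((w a * Y (Fin.cons a ι) : ℝ) : ℂ) := by
      intro a
      rw [mul_assoc, h2, ← smul_eq_C_mul, map_smul, umbral_prod_X hY.toComplex]
      simp [toComplex]
    simp only [Fin.update_cons_zero] at h0
    rw [Finset.sum_congr rfl fun a _ => h4 a, ← Complex.ofReal_sum, h0, Complex.ofReal_zero]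
  · refine Finset.sum_eq_zero fun a _ => ?_
    rw [mul_assoc, h2, prod_X_eq_monomial, C_mul_monomial, umbral_monomial_of_degree_ne]
    rwa [degree_expo]

/-- A planar trace-less tensor is determined by its contraction with `E^p`. -/
theorem IsPlanarTraceless.ext {e : Fin 4 → Fin 4 → ℝ} (he : IsFrame e) {p : ℕ} {Y Z : Tensor p}
    (hY : IsPlanarTraceless (e 0) (e 1) Y) (hZ : IsPlanarTraceless (e 0) (e 1) Z)
    (h : umbral (toComplex Y) (lin (nullE e) ^ p) = umbral (toComplex Z) (lin (nullE e) ^ p)) :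
    Y = Z := by
  refine ext_of_umbral he hY.isSymmTraceless hZ.isSymmTraceless fun q a b hq => ?_
  have key : ∀ {W : Tensor p}, IsPlanarTraceless (e 0) (e 1) W → a ≠ 0 ∨ b ≠ 0 →
      umbral (toComplex W) (lin (nullE e) ^ q * lin (cvec e 0) ^ a * lin (cvec e 1) ^ b) = 0 := by
    intro W hW hab
    rcases hab with ha | hb
    · obtain ⟨a, rfl⟩ := Nat.exists_eq_succ_of_ne_zero ha
      rw [pow_succ', show lin (nullE e) ^ q * (lin (cvec e 0) * lin (cvec e 0) ^ a) *
        lin (cvec e 1) ^ b = lin (cvec e 0) * (lin (nullE e) ^ q * lin (cvec e 0) ^ a *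
        lin (cvec e 1) ^ b) by ring]
      exact umbral_lin_mul_eq_zero hW.1 hW.2.1 _
    · obtain ⟨b, rfl⟩ := Nat.exists_eq_succ_of_ne_zero hb
      rw [pow_succ', show lin (nullE e) ^ q * lin (cvec e 0) ^ a * (lin (cvec e 1) *
        lin (cvec e 1) ^ b) = lin (cvec e 1) * (lin (nullE e) ^ q * lin (cvec e 0) ^ a *
        lin (cvec e 1) ^ b) by ring]
      exact umbral_lin_mul_eq_zero hW.1 hW.2.2.1 _
  by_cases hab : a ≠ 0 ∨ b ≠ 0
  · rw [key hY hab, key hZ hab]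
  · push Not at hab
    obtain ⟨rfl, rfl⟩ := hab
    obtain rfl : q = p := by omega
    simpa using h

/-- Since `E · E' = 2` and `E · E = 0`, contraction with `E^p` reads off the coefficient of `E'^p`. For
`p = 0` there is only one component, and `kap 0 = 1 / 2` compensates for counting it twice. -/
theorem umbral_nullE_pow {e : Fin 4 → Fin 4 → ℝ} (he : IsFrame e) {p : ℕ} {Y : Tensor p} {z z' : ℂ}
    (hz : p = 0 → z' = z) (hYs : IsSymm Y) (hY : ∀ γ, (Y γ : ℂ) =
      kap p * (tpow p (up (nullE' e)) γ * z + tpow p (up (nullE e)) γ * z')) :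
    umbral (toComplex Y) (lin (nullE e) ^ p) = z := by
  obtain ⟨⟨h1, h2, h3⟩, -⟩ := he.sum_eta_null
  rw [umbral_lin_pow hYs.toComplex]
  have h4 : ∀ β : Fin p → Fin 4, toComplex Y β * ∏ i, nullE e (β i) =
      kap p * z * (tpow p (up (nullE' e)) β * ∏ i, nullE e (β i)) +
        kap p * z' * (tpow p (up (nullE e)) β * ∏ i, nullE e (β i)) := by
    intro β
    rw [toComplex, hY]
    ring
  rw [Finset.sum_congr rfl fun β _ => h4 β, Finset.sum_add_distrib, ← Finset.mul_sum,
    ← Finset.mul_sum, sum_tpow_mul, sum_tpow_mul, h1, h3, kap]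
  rcases Nat.eq_zero_or_pos p with hp | hp
  · rw [hz hp, hp]
    simp
    ring
  · rw [if_neg hp.ne', zero_pow hp.ne', mul_zero, add_zero, mul_right_comm, ← mul_pow]
    norm_num

theorem isPlanarTraceless_contractUV {e : Fin 4 → Fin 4 → ℝ} (he : IsFrame e) (p h k : ℕ)
    {T : Tensor (p + h + k)} (hT : IsSymm T) :
    IsPlanarTraceless (e 0) (e 1) (contractUV (e 0) (e 1) p h k T) := by
  refine isPlanarTraceless_of_eq he (fun γ => (contractUV_eq he p h k hT γ).trans ?_)
    (z := kap p * umbral (toComplex T)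
      (lin (nullE e) ^ p * lin (cvec e 0) ^ h * lin (cvec e 1) ^ k))
    (z' := kap p * umbral (toComplex T)
      (lin (nullE' e) ^ p * lin (cvec e 0) ^ h * lin (cvec e 1) ^ k))
  ring

theorem umbral_contractUV {e : Fin 4 → Fin 4 → ℝ} (he : IsFrame e) (p h k : ℕ)
    {T : Tensor (p + h + k)} (hT : IsSymm T) :
    umbral (toComplex (contractUV (e 0) (e 1) p h k T)) (lin (nullE e) ^ p) =
      umbral (toComplex T) (lin (nullE e) ^ p * lin (cvec e 0) ^ h * lin (cvec e 1) ^ k) := by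
  refine umbral_nullE_pow he ?_ (isPlanarTraceless_contractUV he p h k hT).1
    (contractUV_eq he p h k hT)
  rintro rfl
  simp

theorem raise_raise {n : ℕ} (T : Tensor n) : raise (raise T) = T := by
  funext β
  simp only [raise]
  rw [← mul_assoc, ← Finset.prod_mul_distrib]
  simp [eta_mul_self]

theorem IsSymmTraceless.raise {n : ℕ} {T : Tensor n} (hT : IsSymmTraceless T) :
    IsSymmTraceless (raise T) := by
  refine ⟨fun σ β => ?_, fun i j hij β => ?_⟩
  · simp only [ExtendedThermo.raise, hT.1 σ β]
    rw [← Equiv.prod_comp σ fun i => eta (β i)]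
    rfl
  · have h := hT.2 i j hij β
    have hu : ∀ a, ∏ k, eta (Function.update (Function.update β i a) j a k) =
        ∏ k ∈ (Finset.univ.erase i).erase j, eta (β k) := by
      intro a
      rw [prod_update_update eta hij, eta_mul_self, one_mul]
    simp only [ExtendedThermo.raise, hu]
    rw [← mul_zero (∏ k ∈ (Finset.univ.erase i).erase j, eta (β k)), ← h, Finset.mul_sum]
    refine Finset.sum_congr rfl fun a _ => ?_
    ring

/-- The contractions of the unknowns with `E^p u^h v^k`. -/
noncomputable def amplitude (e : Fin 4 → Fin 4 → ℝ) {n : ℕ} (T : Tensor n) (p h k : ℕ) : ℂ :=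
  umbral (toComplex T) (lin (nullE e) ^ p * lin (cvec e 0) ^ h * lin (cvec e 1) ^ k)

theorem umbral_changeUnknowns {e : Fin 4 → Fin 4 → ℝ} (he : IsFrame e) {N : ℕ} {d : Unknowns N}
    (hd : Admissible d) (p : Fin (N + 1)) (i : Pairs N p) :
    umbral (toComplex (changeUnknowns (e 0) (e 1) d p i)) (lin (nullE e) ^ (p : ℕ)) =
      amplitude e (raise (d i.order)) p i.1.1 i.1.2 :=
  umbral_contractUV he p i.1.1 i.1.2 (T := raise (d i.order)) (hd i.order).raise.1

theorem isPlanarTraceless_changeUnknowns {e : Fin 4 → Fin 4 → ℝ} (he : IsFrame e) {N : ℕ}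
    {d : Unknowns N} (hd : Admissible d) (p : Fin (N + 1)) (i : Pairs N p) :
    IsPlanarTraceless (e 0) (e 1) (changeUnknowns (e 0) (e 1) d p i) :=
  isPlanarTraceless_contractUV he p i.1.1 i.1.2 (T := raise (d i.order)) (hd i.order).raise.1

/-- The pair `(h, k)` as an index. -/
def mkPair {N p h k : ℕ} (hn : p + h + k ≤ N) : Pairs N p :=
  ⟨(⟨h, by omega⟩, ⟨k, by omega⟩), hn⟩

/-- The change of unknowns is bijective: the trace-less tensors `δλ` and the families `X` are both
described by their amplitudes, which can be prescribed freely. -/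
theorem bijOn_changeUnknowns {e : Fin 4 → Fin 4 → ℝ} (he : IsFrame e) (N : ℕ) :
    Set.BijOn (changeUnknowns (e 0) (e 1)) {d : Unknowns N | Admissible d}
      {X : NewUnknowns N | NewAdmissible (e 0) (e 1) X} := by
  refine ⟨fun d hd p i => isPlanarTraceless_changeUnknowns he hd p i, fun d hd d' hd' hdd => ?_,
    fun X hX => ?_⟩
  · funext n
    rw [← raise_raise (d n), ← raise_raise (d' n)]
    congr 1
    refine ext_of_umbral he (hd n).raise (hd' n).raise fun p h k hn => ?_
    have hn' : p + h + k ≤ N := by have := n.2; omega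
    have h1 := umbral_changeUnknowns he hd ⟨p, by omega⟩ (mkPair hn')
    have h2 := umbral_changeUnknowns he hd' ⟨p, by omega⟩ (mkPair hn')
    rw [hdd, h2] at h1
    have h3 : (mkPair hn').order = n := Fin.ext hn
    rw [h3] at h1
    exact h1.symm
  · have hex : ∀ n : Fin (N + 1), ∃ T : Tensor n, IsSymmTraceless T ∧
        ∀ (p h k : ℕ) (hn : p + h + k ≤ N), p + h + k = n → amplitude e T p h k =
          umbral (toComplex (X ⟨p, by omega⟩ (mkPair hn))) (lin (nullE e) ^ p) := by
      intro n
      obtain ⟨T, hT, hT2⟩ := exists_traceless he n (fun p h k =>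
        if hn : p + h + k ≤ N then umbral (toComplex (X ⟨p, by omega⟩ (mkPair hn)))
            (lin (nullE e) ^ p) else 0) (fun h k => by
          split_ifs with hn
          · have := umbral_nullE' (hX ⟨0, by omega⟩ (mkPair hn)).1 e 0 0 0
            simpa using this.symm
          · simp)
      refine ⟨T, hT, fun p h k hN hn => ?_⟩
      rw [amplitude, hT2 p h k hn, dif_pos hN]
    choose T hT hT2 using hex
    have hd : Admissible fun n => raise (T n) := fun n => (hT n).raise
    refine ⟨fun n => raise (T n), hd, ?_⟩
    funext p i
    refine (isPlanarTraceless_changeUnknowns he hd p i).ext he (hX p i) ?_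
    have h1 := umbral_changeUnknowns he hd p i
    have h2 := hT2 i.order p i.1.1 i.1.2 i.2 rfl
    have h3 : mkPair i.2 = i := rfl
    rw [h3] at h2
    simp only [raise_raise] at h1
    exact h1.trans h2

/-! ### The invariant measure on the light cone -/

/-- Spatial momentum space. -/
abbrev Space := EuclideanSpace ℝ (Fin 3)

/-- The coefficients `(-|q|, q)` of a null vector in an orthonormal frame. -/
noncomputable def coneCoord (q : Space) : Fin 4 → ℝ := Fin.cons (-‖q‖) fun i => q i

/-- The null vector (with upper indices) `ε (-|q| u + q₁ v + q₂ e₂ + q₃ e₃)`. For the sign `ε` of `u₀`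
it is future-directed. -/
noncomputable def frameMomentum (e : Fin 4 → Fin 4 → ℝ) (ε : ℝ) (q : Space) (a : Fin 4) : ℝ :=
  eta a * (ε * ∑ c, coneCoord q c * e c a)

/-- The spatial part of `frameMomentum`. -/
noncomputable def boost (e : Fin 4 → Fin 4 → ℝ) (ε : ℝ) (q : Space) : Space :=
  WithLp.toLp 2 fun i => frameMomentum e ε q i.succ

theorem norm_sq_space (q : Space) : ‖q‖ ^ 2 = q 0 ^ 2 + q 1 ^ 2 + q 2 ^ 2 := by
  rw [EuclideanSpace.norm_sq_eq, Fin.sum_univ_three]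
  simp

theorem IsFrame.sum_mul_frameMomentum {e : Fin 4 → Fin 4 → ℝ} (he : IsFrame e) (ε : ℝ) (q : Space)
    (b : Fin 4) : ∑ a, e b a * frameMomentum e ε q a = ε * (eta b * coneCoord q b) := by
  have h : ∀ a, e b a * frameMomentum e ε q a =
      ∑ c, ε * coneCoord q c * (eta a * e b a * e c a) := by
    intro a
    rw [frameMomentum, Finset.mul_sum, Finset.mul_sum, Finset.mul_sum]
    exact Finset.sum_congr rfl fun c _ => by ring
  rw [Finset.sum_congr rfl fun a _ => h a, Finset.sum_comm]
  simp only [← Finset.mul_sum]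
  have h2 := fun c => he b c
  simp only [mdot] at h2
  simp only [h2, metric]
  simp
  ring

/-- Spatial combinations of a time-like covector's companions are dominated by its time component. -/
theorem IsFrame.abs_lt {e : Fin 4 → Fin 4 → ℝ} (he : IsFrame e) {q : Space} (hq : q ≠ 0) :
    |q 0 * e 1 0 + q 1 * e 2 0 + q 2 * e 3 0| < ‖q‖ * |e 0 0| := by
  have h := he.complete 0 0
  rw [Fin.sum_univ_four] at h
  simp [eta, metric] at h
  have hn := norm_sq_space q
  have hpos : 0 < ‖q‖ := norm_pos_iff.mpr hq
  rw [show ‖q‖ * |e 0 0| = |‖q‖ * e 0 0| by rw [abs_mul, abs_norm]]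
  apply sq_lt_sq.mp
  have h1 : (q 0 * e 1 0 + q 1 * e 2 0 + q 2 * e 3 0) ^ 2 ≤
      ‖q‖ ^ 2 * (e 1 0 ^ 2 + e 2 0 ^ 2 + e 3 0 ^ 2) := by
    rw [hn]
    nlinarith [sq_nonneg (q 0 * e 2 0 - q 1 * e 1 0), sq_nonneg (q 0 * e 3 0 - q 2 * e 1 0),
      sq_nonneg (q 1 * e 3 0 - q 2 * e 2 0)]
  have h2 : (‖q‖ * e 0 0) ^ 2 = ‖q‖ ^ 2 * (e 1 0 ^ 2 + e 2 0 ^ 2 + e 3 0 ^ 2) + ‖q‖ ^ 2 := by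
    linear_combination (-‖q‖ ^ 2) * h
  have := pow_pos hpos 2
  linarith

theorem IsFrame.frameMomentum_zero_pos {e : Fin 4 → Fin 4 → ℝ} (he : IsFrame e) {ε : ℝ}
    (hε : ε * e 0 0 = |e 0 0|) (hε2 : |ε| = 1) {q : Space} (hq : q ≠ 0) :
    0 < frameMomentum e ε q 0 := by
  have h := he.abs_lt hq
  have h2 : frameMomentum e ε q 0 = ‖q‖ * (ε * e 0 0) -
      ε * (q 0 * e 1 0 + q 1 * e 2 0 + q 2 * e 3 0) := by
    simp [frameMomentum, coneCoord, Fin.sum_univ_succ, eta]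
    ring
  have h3 : ε * (q 0 * e 1 0 + q 1 * e 2 0 + q 2 * e 3 0) ≤
      |q 0 * e 1 0 + q 1 * e 2 0 + q 2 * e 3 0| := by
    refine (le_abs_self _).trans ?_
    rw [abs_mul, hε2, one_mul]
  rw [h2, hε]
  linarith

theorem IsFrame.fourMomentum_boost {e : Fin 4 → Fin 4 → ℝ} (he : IsFrame e) {ε : ℝ}
    (hε : ε * e 0 0 = |e 0 0|) (hε2 : |ε| = 1) {q : Space} (hq : q ≠ 0) :
    fourMomentum (boost e ε q) = frameMomentum e ε q := by
  have hpos := he.frameMomentum_zero_pos hε hε2 hq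
  have hnull : ∑ a, eta a * frameMomentum e ε q a ^ 2 = 0 := by
    have h : ∀ a, eta a * frameMomentum e ε q a ^ 2 =
        ∑ c, ε * coneCoord q c * (e c a * frameMomentum e ε q a) := by
      intro a
      have : eta a * frameMomentum e ε q a = ε * ∑ c, coneCoord q c * e c a := by
        rw [frameMomentum, ← mul_assoc, eta_mul_self, one_mul]
      rw [sq, ← mul_assoc, this, Finset.mul_sum, Finset.sum_mul]
      exact Finset.sum_congr rfl fun c _ => by ring
    rw [Finset.sum_congr rfl fun a _ => h a, Finset.sum_comm]
    simp only [← Finset.mul_sum, he.sum_mul_frameMomentum]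
    have hn := norm_sq_space q
    simp [Fin.sum_univ_succ, coneCoord, eta]
    linear_combination (-ε ^ 2) * hn
  have hnorm : ‖boost e ε q‖ = frameMomentum e ε q 0 := by
    rw [← sq_eq_sq₀ (norm_nonneg _) hpos.le, norm_sq_space]
    simp only [Fin.sum_univ_four, eta] at hnull
    simp [boost] at hnull ⊢
    linear_combination hnull
  funext a
  refine Fin.cases ?_ (fun i => ?_) a
  · simp [fourMomentum, hnorm]
  · simp [fourMomentum, boost]

theorem IsFrame.injOn_boost {e : Fin 4 → Fin 4 → ℝ} (he : IsFrame e) {ε : ℝ}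
    (hε : ε * e 0 0 = |e 0 0|) (hε2 : |ε| = 1) : Set.InjOn (boost e ε) {0}ᶜ := by
  intro q hq q' hq' h
  have h1 : frameMomentum e ε q = frameMomentum e ε q' := by
    rw [← he.fourMomentum_boost hε hε2 hq, h, he.fourMomentum_boost hε hε2 hq']
  have hε0 : ε ≠ 0 := by
    rintro rfl
    simp at hε2
  ext i
  have h2 := he.sum_mul_frameMomentum ε q i.succ
  rw [h1, he.sum_mul_frameMomentum] at h2
  have h3 := mul_left_cancel₀ hε0 h2
  simpa [coneCoord, eta] using h3.symm

/-- Every null momentum has coordinates `(-|q|, q)` in the frame. -/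
theorem IsFrame.image_boost {e : Fin 4 → Fin 4 → ℝ} (he : IsFrame e) {ε : ℝ}
    (hε : ε * e 0 0 = |e 0 0|) (hε2 : |ε| = 1) : boost e ε '' {0}ᶜ = {0}ᶜ := by
  have hεε : ε * ε = 1 := by rw [← abs_mul_abs_self, hε2, one_mul]
  apply Set.Subset.antisymm
  · rintro _ ⟨q, hq, rfl⟩ h0
    have h := he.frameMomentum_zero_pos hε hε2 hq
    rw [← he.fourMomentum_boost hε hε2 hq, h0] at h
    simp [fourMomentum] at h
  · intro p hp
    set P := fourMomentum p with hP
    have hP0 : P 0 = ‖p‖ := by simp [hP, fourMomentum]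
    have hPs : ∀ i : Fin 3, P i.succ = p i := fun i => by simp [hP, fourMomentum]
    set s : Fin 4 → ℝ := fun c => ∑ a, e c a * P a with hs
    -- completeness of the frame, contracted with `P`
    have hc : ∀ a, ∑ c, eta c * s c * e c a = eta a * P a := by
      intro a
      have : ∀ c, eta c * s c * e c a = ∑ b, P b * (eta c * e c a * e c b) := by
        intro c
        simp only [hs, Finset.mul_sum, Finset.sum_mul]
        exact Finset.sum_congr rfl fun b _ => by ring
      rw [Finset.sum_congr rfl fun c _ => this c, Finset.sum_comm]
      simp only [← Finset.mul_sum, he.complete, metric]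
      simp [mul_comm]
    have hpn := norm_sq_space p
    have hnull : ∑ c, eta c * s c ^ 2 = 0 := by
      have : ∀ c, eta c * s c ^ 2 = ∑ a, (eta c * s c * e c a) * P a := by
        intro c
        simp only [mul_assoc, ← Finset.mul_sum]
        rw [sq]
      rw [Finset.sum_congr rfl fun c _ => this c, Finset.sum_comm]
      simp only [← Finset.sum_mul, hc, Fin.sum_univ_succ, hP0, hPs]
      simp [eta]
      linear_combination -hpn
    have hpos : 0 < ε * s 0 := by
      have h00 := he 0 0
      rw [mdot, Fin.sum_univ_four] at h00
      simp [eta, metric] at h00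
      have hppos : 0 < ‖p‖ := norm_pos_iff.mpr hp
      have hs0 : s 0 = e 0 0 * ‖p‖ + (e 0 1 * p 0 + e 0 2 * p 1 + e 0 3 * p 2) := by
        have h1 := hPs 0
        have h2 := hPs 1
        have h3 := hPs 2
        simp only [hs, Fin.sum_univ_four, hP0]
        rw [← h1, ← h2, ← h3]
        simp only [Fin.succ_zero_eq_one, Fin.succ_one_eq_two, Fin.reduceSucc]
        ring
      have h4 : |e 0 1 * p 0 + e 0 2 * p 1 + e 0 3 * p 2| < ‖p‖ * |e 0 0| := by
        rw [show ‖p‖ * |e 0 0| = |‖p‖ * e 0 0| by rw [abs_mul, abs_norm]]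
        apply sq_lt_sq.mp
        have h1 : (e 0 1 * p 0 + e 0 2 * p 1 + e 0 3 * p 2) ^ 2 ≤
            ‖p‖ ^ 2 * (e 0 1 ^ 2 + e 0 2 ^ 2 + e 0 3 ^ 2) := by
          rw [hpn]
          nlinarith [sq_nonneg (p 0 * e 0 2 - p 1 * e 0 1), sq_nonneg (p 0 * e 0 3 - p 2 * e 0 1),
            sq_nonneg (p 1 * e 0 3 - p 2 * e 0 2)]
        have h2 : (‖p‖ * e 0 0) ^ 2 = ‖p‖ ^ 2 * (e 0 1 ^ 2 + e 0 2 ^ 2 + e 0 3 ^ 2) + ‖p‖ ^ 2 := by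
          linear_combination (-‖p‖ ^ 2) * h00
        have := pow_pos hppos 2
        linarith
      have h5 : -(ε * (e 0 1 * p 0 + e 0 2 * p 1 + e 0 3 * p 2)) ≤
          |e 0 1 * p 0 + e 0 2 * p 1 + e 0 3 * p 2| := by
        refine (neg_le_abs _).trans ?_
        rw [abs_mul, hε2, one_mul]
      have h6 : ε * s 0 = ‖p‖ * (ε * e 0 0) +
          ε * (e 0 1 * p 0 + e 0 2 * p 1 + e 0 3 * p 2) := by
        rw [hs0]
        ring
      rw [h6, hε]
      linarith
    set q : Space := WithLp.toLp 2 fun i => ε * s i.succ with hq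
    have hqn : ‖q‖ = ε * s 0 := by
      rw [← sq_eq_sq₀ (norm_nonneg _) hpos.le, norm_sq_space]
      simp only [Fin.sum_univ_four, eta] at hnull
      simp [hq] at hnull ⊢
      linear_combination ε ^ 2 * hnull
    have hq0 : q ≠ 0 := by
      rw [← norm_pos_iff, hqn]
      exact hpos
    have hcoord : ∀ c, coneCoord q c = ε * (eta c * s c) := by
      intro c
      refine Fin.cases ?_ (fun i => ?_) c
      · simp [coneCoord, hqn, eta]
      · simp [coneCoord, hq, eta]
    have hfm : frameMomentum e ε q = P := by
      funext a
      simp only [frameMomentum, hcoord]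
      have : ∑ c, ε * (eta c * s c) * e c a = ε * (eta a * P a) := by
        rw [← hc, Finset.mul_sum]
        exact Finset.sum_congr rfl fun c _ => by ring
      rw [this, ← mul_assoc ε, hεε, one_mul, ← mul_assoc, eta_mul_self, one_mul]
    refine ⟨q, hq0, ?_⟩
    ext i
    rw [boost]
    simp only [hfm]
    exact hPs i

/-- The Jacobian matrix of `boost`. -/
noncomputable def boostMatrix (e : Fin 4 → Fin 4 → ℝ) (ε : ℝ) (q : Space) :
    Matrix (Fin 3) (Fin 3) ℝ :=
  Matrix.of fun i j => ε * (-(q j / ‖q‖) * e 0 i.succ + e j.succ i.succ)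

theorem hasFDerivAt_boost (e : Fin 4 → Fin 4 → ℝ) (ε : ℝ) {q : Space} (hq : q ≠ 0) :
    HasFDerivAt (boost e ε) (LinearMap.toContinuousLinearMap
      (Matrix.toEuclideanLin (boostMatrix e ε q))) q := by
  rw [← hasFDerivWithinAt_univ, hasFDerivWithinAt_euclidean]
  intro i
  rw [hasFDerivWithinAt_univ]
  have hn : HasFDerivAt (fun q : Space => ‖q‖) (‖q‖⁻¹ • innerSL ℝ q) q := by
    have h1 := (hasStrictFDerivAt_norm_sq q).hasFDerivAt.sqrt
      (by simpa using hq)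
    simp only [Real.sqrt_sq (norm_nonneg _)] at h1
    convert! h1 using 1
    ext x
    simp
    field_simp
  have hc : ∀ j : Fin 3, HasFDerivAt (fun q : Space => q j) (EuclideanSpace.proj j : Space →L[ℝ] ℝ) q :=
    fun j => (EuclideanSpace.proj j : Space →L[ℝ] ℝ).hasFDerivAt
  have h := ((hn.mul_const (e 0 i.succ)).neg.add (((hc 0).mul_const (e 1 i.succ)).add
    (((hc 1).mul_const (e 2 i.succ)).add ((hc 2).mul_const (e 3 i.succ))))).const_mul ε
  convert! h using 1
  · funext x
    simp [boost, frameMomentum, coneCoord, Fin.sum_univ_succ, eta]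
  · ext x
    simp [boostMatrix, Matrix.mulVec, dotProduct, Fin.sum_univ_succ, PiLp.inner_apply]
    ring

/-- The Jacobian of `boost` is the quotient of the energies before and after. -/
theorem abs_det_boostMatrix {e : Fin 4 → Fin 4 → ℝ} (he : IsFrame e) {ε : ℝ}
    (hε : ε * e 0 0 = |e 0 0|) (hε2 : |ε| = 1) {q : Space} (hq : q ≠ 0) :
    |(boostMatrix e ε q).det| = frameMomentum e ε q 0 / ‖q‖ := by
  have hpos := he.frameMomentum_zero_pos hε hε2 hq
  have hqpos : 0 < ‖q‖ := norm_pos_iff.mpr hq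
  have hεε : ε * ε = 1 := by rw [← abs_mul_abs_self, hε2, one_mul]
  set n : Fin 3 → ℝ := fun j => q j / ‖q‖ with hn
  have hn1 : n 0 ^ 2 + n 1 ^ 2 + n 2 ^ 2 = 1 := by
    simp only [hn, div_pow]
    rw [← add_div, ← add_div, ← norm_sq_space, div_self (pow_pos hqpos 2).ne']
  set τ : Fin 3 → ℝ := fun j => -n j * e 0 0 + e j.succ 0 with hτ
  -- the Gram matrix of the columns is `1 - n nᵀ + τ τᵀ`
  have hG : ∀ j k, ((boostMatrix e ε q).transpose * boostMatrix e ε q) j k =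
      (if j = k then 1 else 0) - n j * n k + τ j * τ k := by
    intro j k
    have h00 := he 0 0
    have h0k := he 0 k.succ
    have hj0 := he j.succ 0
    have hjk := he j.succ k.succ
    simp only [mdot, metric, Fin.sum_univ_four, Fin.succ_inj, Fin.succ_ne_zero,
      (Fin.succ_ne_zero _).symm, if_true, if_false, eta, neg_mul, one_mul, one_ne_zero,
      Fin.reduceEq] at h00 h0k hj0 hjk
    simp only [Matrix.mul_apply, Matrix.transpose_apply, boostMatrix, Matrix.of_apply,
      Fin.sum_univ_three, hτ, Fin.succ_zero_eq_one, Fin.succ_one_eq_two, Fin.reduceSucc]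
    change ε * (-n j * e 0 1 + e j.succ 1) * (ε * (-n k * e 0 1 + e k.succ 1)) +
      ε * (-n j * e 0 2 + e j.succ 2) * (ε * (-n k * e 0 2 + e k.succ 2)) +
      ε * (-n j * e 0 3 + e j.succ 3) * (ε * (-n k * e 0 3 + e k.succ 3)) = _
    linear_combination (n j * n k) * h00 - n j * h0k - n k * hj0 + hjk + (
      (-(n j) * e 0 1 + e j.succ 1) * (-(n k) * e 0 1 + e k.succ 1) +
      (-(n j) * e 0 2 + e j.succ 2) * (-(n k) * e 0 2 + e k.succ 2) +
      (-(n j) * e 0 3 + e j.succ 3) * (-(n k) * e 0 3 + e k.succ 3)) * hεε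
  have hdet : (boostMatrix e ε q).det ^ 2 = (n 0 * τ 0 + n 1 * τ 1 + n 2 * τ 2) ^ 2 := by
    have h1 : (boostMatrix e ε q).det ^ 2 =
        ((boostMatrix e ε q).transpose * boostMatrix e ε q).det := by
      rw [Matrix.det_mul, Matrix.det_transpose, sq]
    rw [h1, Matrix.det_fin_three]
    simp only [hG]
    simp
    linear_combination (-(1 + τ 0 ^ 2 + τ 1 ^ 2 + τ 2 ^ 2)) * hn1
  rw [sq_eq_sq_iff_abs_eq_abs] at hdet
  have hfm : frameMomentum e ε q 0 / ‖q‖ = -(ε * (n 0 * τ 0 + n 1 * τ 1 + n 2 * τ 2)) := by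
    rw [div_eq_iff hqpos.ne']
    have hq' : ∀ j, q j = n j * ‖q‖ := fun j => by simp only [hn]; field_simp
    have h1 : coneCoord q 1 = n 0 * ‖q‖ := hq' 0
    have h2 : coneCoord q 2 = n 1 * ‖q‖ := hq' 1
    have h3 : coneCoord q 3 = n 2 * ‖q‖ := hq' 2
    have h4 : coneCoord q 0 = -‖q‖ := rfl
    simp only [frameMomentum, Fin.sum_univ_four, hτ, eta, h1, h2, h3, h4, if_true,
      Fin.succ_zero_eq_one, Fin.succ_one_eq_two, Fin.reduceSucc]
    linear_combination (-ε * ‖q‖ * e 0 0) * hn1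
  rw [hdet, ← abs_of_pos (div_pos hpos hqpos), hfm, abs_neg, abs_mul, hε2, one_mul]

/-- The measure `d³q / p⁰` on the light cone is Lorentz invariant. No integrability is needed. -/
theorem integral_cone_eq {e : Fin 4 → Fin 4 → ℝ} (he : IsFrame e) {ε : ℝ}
    (hε : ε * e 0 0 = |e 0 0|) (hε2 : |ε| = 1) (G : (Fin 4 → ℝ) → ℂ) :
    ∫ q : Space, G (fourMomentum q) / (fourMomentum q 0 : ℂ) =
      ∫ q : Space, G (frameMomentum e ε q) / (‖q‖ : ℂ) := by
  have h0 : ∀ f : Space → ℂ, ∫ q, f q = ∫ q in ({0}ᶜ : Set Space), f q := fun f => by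
    rw [restrict_compl_singleton]
  rw [h0, h0]
  conv_lhs => rw [← he.image_boost hε hε2]
  rw [integral_image_eq_integral_abs_det_fderiv_smul volume (measurableSet_singleton _).compl
    (fun q hq => (hasFDerivAt_boost e ε hq).hasFDerivWithinAt) (he.injOn_boost hε hε2)]
  refine setIntegral_congr_fun (measurableSet_singleton _).compl fun q hq => ?_
  have hpos := he.frameMomentum_zero_pos hε hε2 hq
  have hqpos : 0 < ‖q‖ := norm_pos_iff.mpr hq
  have hdet : (LinearMap.toContinuousLinearMap
      (Matrix.toEuclideanLin (boostMatrix e ε q))).det = (boostMatrix e ε q).det := by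
    rw [ContinuousLinearMap.det, LinearMap.coe_toContinuousLinearMap,
      Matrix.toEuclideanLin_eq_toLin_orthonormal, LinearMap.det_toLin]
  simp only [hdet, abs_det_boostMatrix he hε hε2 hq, he.fourMomentum_boost hε hε2 hq]
  rw [Complex.real_smul]
  have h1 : (frameMomentum e ε q 0 : ℂ) ≠ 0 := Complex.ofReal_ne_zero.mpr hpos.ne'
  have h2 : (‖q‖ : ℂ) ≠ 0 := Complex.ofReal_ne_zero.mpr hqpos.ne'
  push_cast
  field_simp

/-! ### Integrals over the unit sphere -/

/-- The surface integral over the unit sphere. -/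
noncomputable def sphereInt (g : Space → ℂ) : ℂ :=
  ∫ ω : Metric.sphere (0 : Space) 1, g ω ∂(volume : Measure Space).toSphere

/-- Integration in polar coordinates; it needs no integrability, as both sides are products. -/
theorem integral_polar (f : ℝ → ℂ) (g : Space → ℂ) :
    ∫ q : Space, f ‖q‖ * g (‖q‖⁻¹ • q) =
      sphereInt g * ∫ ρ in Set.Ioi (0 : ℝ), (ρ : ℂ) ^ 2 * f ρ := by
  calc ∫ q : Space, f ‖q‖ * g (‖q‖⁻¹ • q)
      = ∫ q : ({(0)}ᶜ : Set Space), f ‖q.1‖ * g (‖q.1‖⁻¹ • q.1)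
          ∂((volume : Measure Space).comap (↑)) := by
        rw [integral_subtype_comap (measurableSet_singleton _).compl
          fun q : Space => f ‖q‖ * g (‖q‖⁻¹ • q), restrict_compl_singleton]
    _ = ∫ x, g x.1 * f x.2 ∂(volume : Measure Space).toSphere.prod
          (.volumeIoiPow (Module.finrank ℝ Space - 1)) := by
        rw [← (volume : Measure Space).measurePreserving_homeomorphUnitSphereProd.integral_comp
          (Homeomorph.measurableEmbedding _)]
        simp [mul_comm]
    _ = sphereInt g * ∫ ρ : Set.Ioi (0 : ℝ), f ρ ∂.volumeIoiPow (Module.finrank ℝ Space - 1) :=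
        integral_prod_mul (fun ω : Metric.sphere (0 : Space) 1 => g ω)
          (fun ρ : Set.Ioi (0 : ℝ) => f ρ)
    _ = _ := by
        congr 1
        simp only [Measure.volumeIoiPow, ENNReal.ofReal]
        rw [integral_withDensity_eq_integral_smul,
          integral_subtype_comap measurableSet_Ioi
            fun a => Real.toNNReal (a ^ (Module.finrank ℝ Space - 1)) • f a]
        · refine setIntegral_congr_fun measurableSet_Ioi fun x hx => ?_
          simp only [NNReal.smul_def]
          rw [Real.coe_toNNReal _ (pow_nonneg (le_of_lt hx) _), finrank_euclideanSpace_fin,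
            Complex.real_smul]
          push_cast
          rfl
        · exact (measurable_subtype_coe.pow_const _).real_toNNReal

/-- Integrals over space split along an axis and the plane orthogonal to it. -/
theorem integral_axis_plane (A : ℝ → ℂ) (B : ℂ → ℂ) :
    ∫ q : Space, A (q 0) * B (q 1 + q 2 * Complex.I) = (∫ x, A x) * ∫ w, B w := by
  rw [← (EuclideanSpace.volume_preserving_symm_measurableEquiv_toLp (Fin 3)).symm.integral_comp
    (MeasurableEquiv.measurableEmbedding _)]
  rw [← (volume_preserving_piFinSuccAbove (fun _ : Fin 3 => ℝ) 0).symm.integral_comp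
    (MeasurableEquiv.measurableEmbedding _)]
  rw [← Complex.volume_preserving_equiv_pi.symm.integral_comp
    (MeasurableEquiv.measurableEmbedding _) B]
  rw [← integral_prod_mul]
  refine integral_congr_ae (Filter.Eventually.of_forall fun x => ?_)
  simp [Complex.measurableEquivPi]
  exact Or.inl rfl

theorem integral_pow_mul_exp_even (m : ℕ) :
    ∫ x : ℝ, ((x : ℂ) ^ (2 * m) * Real.exp (-x ^ 2)) = (Real.Gamma (m + 1 / 2) : ℂ) := by
  have h1 := integral_rpow_mul_exp_neg_rpow (p := 2) (q := 2 * m) (by norm_num) (by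
    have : (0 : ℝ) ≤ m := m.cast_nonneg
    linarith)
  have h2 := integral_comp_abs (f := fun x : ℝ => x ^ (2 * m) * Real.exp (-x ^ 2))
  have h3 : ∀ x : ℝ, |x| ^ (2 * m) * Real.exp (-|x| ^ 2) = x ^ (2 * m) * Real.exp (-x ^ 2) := by
    intro x
    rw [pow_mul, sq_abs, ← pow_mul]
  simp only [h3] at h2
  have h4 : ∫ x in Set.Ioi (0 : ℝ), x ^ (2 * m) * Real.exp (-x ^ 2) =
      ∫ x in Set.Ioi (0 : ℝ), x ^ (2 * m : ℝ) * Real.exp (-x ^ (2 : ℝ)) := by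
    refine setIntegral_congr_fun measurableSet_Ioi fun x _ => ?_
    rw [Real.rpow_two, ← Real.rpow_natCast]
    push_cast
    rfl
  rw [h4, h1] at h2
  rw [show (m : ℝ) + 1 / 2 = (2 * m + 1) / 2 by ring]
  rw [show Real.Gamma ((2 * (m : ℝ) + 1) / 2) = 2 * (1 / 2 * Real.Gamma ((2 * m + 1) / 2)) by ring,
    ← h2, ← integral_complex_ofReal]
  push_cast
  rfl

theorem integral_pow_mul_exp_odd {a : ℕ} (ha : Odd a) :
    ∫ x : ℝ, ((x : ℂ) ^ a * Real.exp (-x ^ 2)) = 0 := by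
  have h := integral_neg_eq_self (fun x : ℝ => (x : ℂ) ^ a * Real.exp (-x ^ 2)) volume
  simp only [Complex.ofReal_neg, ha.neg_pow, even_two.neg_pow, neg_mul, integral_neg] at h
  exact self_eq_neg.mp h.symm

theorem integral_radial_exp (d : ℕ) :
    ∫ ρ in Set.Ioi (0 : ℝ), ((ρ : ℂ) ^ 2 * ((ρ : ℂ) ^ d * Real.exp (-ρ ^ 2))) =
      ((1 / 2 * Real.Gamma ((d + 3) / 2) : ℝ) : ℂ) := by
  have h1 := integral_rpow_mul_exp_neg_rpow (p := 2) (q := d + 2) (by norm_num) (by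
    have : (0 : ℝ) ≤ d := d.cast_nonneg
    linarith)
  rw [show ((d : ℝ) + 3) / 2 = (d + 2 + 1) / 2 by ring, ← h1, ← integral_complex_ofReal]
  refine setIntegral_congr_fun measurableSet_Ioi fun x _ => ?_
  rw [Real.rpow_two, show (d : ℝ) + 2 = ((d + 2 : ℕ) : ℝ) by push_cast; rfl, Real.rpow_natCast]
  push_cast
  ring

theorem integral_plane_exp (s : ℕ) :
    ∫ w : ℂ, w ^ s * (starRingEnd ℂ) w ^ s * Real.exp (-‖w‖ ^ 2) =
      ((Real.pi * s.factorial : ℝ) : ℂ) := by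
  have h1 := Complex.integral_rpow_mul_exp_neg_rpow (p := 2) (q := 2 * s) (by norm_num) (by
    have : (0 : ℝ) ≤ s := s.cast_nonneg
    linarith)
  rw [show (2 * (s : ℝ) + 2) / 2 = s + 1 by ring, Real.Gamma_nat_eq_factorial,
    show 2 * Real.pi / 2 = Real.pi by ring] at h1
  rw [← h1, ← integral_complex_ofReal]
  refine integral_congr_ae (Filter.Eventually.of_forall fun w => ?_)
  simp only
  rw [Real.rpow_two, show 2 * (s : ℝ) = ((2 * s : ℕ) : ℝ) by push_cast; rfl, Real.rpow_natCast,
    ← mul_pow, Complex.mul_conj, Complex.normSq_eq_norm_sq]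
  push_cast
  ring

/-- Rotating the plane shows that unbalanced moments vanish. -/
theorem integral_plane_exp_of_ne {s t : ℕ} (h : s ≠ t) :
    ∫ w : ℂ, w ^ s * (starRingEnd ℂ) w ^ t * Real.exp (-‖w‖ ^ 2) = 0 := by
  set θ : ℝ := Real.pi / ((s : ℝ) - t) with hθ
  have hst : (s : ℂ) - t ≠ 0 := sub_ne_zero.mpr (Nat.cast_injective.ne h)
  have hc : (Circle.exp θ : ℂ) ^ s * (starRingEnd ℂ) (Circle.exp θ : ℂ) ^ t = -1 := by
    rw [Circle.coe_exp, ← Complex.exp_conj, ← Complex.exp_nat_mul, ← Complex.exp_nat_mul,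
      ← Complex.exp_add, ← Complex.exp_pi_mul_I, map_mul, Complex.conj_I, Complex.conj_ofReal, hθ]
    congr 1
    push_cast
    field_simp
    ring
  have h1 := (rotation (Circle.exp θ)).measurePreserving.integral_comp
    (rotation (Circle.exp θ)).toHomeomorph.measurableEmbedding
    (fun w : ℂ => w ^ s * (starRingEnd ℂ) w ^ t * (Real.exp (-‖w‖ ^ 2) : ℂ))
  have h2 : ∀ w : ℂ, (rotation (Circle.exp θ) w) ^ s * (starRingEnd ℂ) (rotation (Circle.exp θ) w) ^ t *
      (Real.exp (-‖rotation (Circle.exp θ) w‖ ^ 2) : ℂ) =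
      -(w ^ s * (starRingEnd ℂ) w ^ t * (Real.exp (-‖w‖ ^ 2) : ℂ)) := by
    intro w
    rw [LinearIsometryEquiv.norm_map, rotation_apply, map_mul, mul_pow, mul_pow]
    linear_combination (w ^ s * (starRingEnd ℂ) w ^ t * (Real.exp (-‖w‖ ^ 2) : ℂ)) * hc
  simp only [h2, integral_neg] at h1
  exact self_eq_neg.mp h1.symm

/-- The moments of the unit sphere in axis and plane coordinates. -/
noncomputable def sphereMoment (a s t : ℕ) : ℂ :=
  sphereInt fun q => (q 0 : ℂ) ^ a * ((q 1 + q 2 * Complex.I) ^ s *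
    (starRingEnd ℂ) (q 1 + q 2 * Complex.I) ^ t)

/-- The Gaussian integral of `t^a w^s w̄^t`, computed in polar coordinates and by Fubini's theorem. -/
theorem sphereMoment_mul (a s t : ℕ) :
    sphereMoment a s t * ((1 / 2 * Real.Gamma (((a + s + t : ℕ) + 3) / 2) : ℝ) : ℂ) =
      (∫ x : ℝ, ((x : ℂ) ^ a * Real.exp (-x ^ 2))) *
        ∫ w : ℂ, w ^ s * (starRingEnd ℂ) w ^ t * Real.exp (-‖w‖ ^ 2) := by
  rw [← integral_radial_exp, sphereMoment,
    ← integral_polar (fun ρ => (ρ : ℂ) ^ (a + s + t) * Real.exp (-ρ ^ 2)), ← integral_axis_plane]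
  refine integral_congr_ae (Filter.Eventually.of_forall fun q => ?_)
  simp only
  have hn : ‖(q 1 + q 2 * Complex.I : ℂ)‖ ^ 2 = q 1 ^ 2 + q 2 ^ 2 := by
    rw [← Complex.normSq_eq_norm_sq, Complex.normSq_add_mul_I]
  rw [norm_sq_space, hn, show -(q 0 ^ 2 + q 1 ^ 2 + q 2 ^ 2) = -q 0 ^ 2 + -(q 1 ^ 2 + q 2 ^ 2) by ring,
    Real.exp_add]
  rcases eq_or_ne q 0 with rfl | hq
  · rcases Nat.eq_zero_or_pos a with ha | ha
    · rcases Nat.eq_zero_or_pos s with hs | hs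
      · rcases Nat.eq_zero_or_pos t with ht | ht
        · simp [ha, hs, ht]
        · simp [ha, hs, ht.ne']
      · simp [ha, hs.ne']
    · simp [ha.ne']
  have hq' : (‖q‖ : ℂ) ≠ 0 := by simpa using hq
  have h0 : ∀ i, ((‖q‖⁻¹ • q) i : ℂ) = (‖q‖ : ℂ)⁻¹ * q i := by
    intro i
    simp
  simp only [h0]
  rw [show (‖q‖ : ℂ)⁻¹ * q 1 + (‖q‖ : ℂ)⁻¹ * q 2 * Complex.I =
    (‖q‖ : ℂ)⁻¹ * (q 1 + q 2 * Complex.I) by ring, map_mul, map_inv₀, Complex.conj_ofReal, mul_pow,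
    mul_pow, mul_pow, pow_add, pow_add, inv_pow, inv_pow, inv_pow]
  push_cast
  field_simp

theorem sphereMoment_of_ne (a : ℕ) {s t : ℕ} (h : s ≠ t) : sphereMoment a s t = 0 := by
  have h1 := sphereMoment_mul a s t
  rw [integral_plane_exp_of_ne h, mul_zero] at h1
  refine (mul_eq_zero.mp h1).resolve_right ?_
  rw [← ne_eq, Complex.ofReal_ne_zero]
  have := Real.Gamma_pos_of_pos (s := ((a + s + t : ℕ) + 3) / 2) (by positivity)
  positivity

theorem sphereMoment_of_odd {a : ℕ} (ha : Odd a) (s t : ℕ) : sphereMoment a s t = 0 := by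
  have h1 := sphereMoment_mul a s t
  rw [integral_pow_mul_exp_odd ha, zero_mul] at h1
  refine (mul_eq_zero.mp h1).resolve_right ?_
  rw [← ne_eq, Complex.ofReal_ne_zero]
  have := Real.Gamma_pos_of_pos (s := ((a + s + t : ℕ) + 3) / 2) (by positivity)
  positivity

theorem Gamma_nat_add_half_eq (m : ℕ) :
    Real.Gamma (m + 1 / 2) = (2 * m).factorial * √Real.pi / (4 ^ m * m.factorial) := by
  induction m with
  | zero => simpa using Real.Gamma_one_half_eq
  | succ m ih =>
    rw [show ((m + 1 : ℕ) : ℝ) + 1 / 2 = (m + 1 / 2) + 1 by push_cast; ring,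
      Real.Gamma_add_one (by positivity), ih, show 2 * (m + 1) = 2 * m + 1 + 1 by ring,
      Nat.factorial_succ, Nat.factorial_succ, Nat.factorial_succ]
    push_cast
    have := (Nat.cast_ne_zero (R := ℝ)).mpr m.factorial_ne_zero
    field_simp
    ring

theorem sphereMoment_even (m s : ℕ) : sphereMoment (2 * m) s s =
    ((4 * Real.pi / (2 * (m + s : ℕ) + 1) * ((m + s).factorial * (2 * m).factorial * s.factorial *
      4 ^ s) / ((2 * (m + s)).factorial * m.factorial) : ℝ) : ℂ) := by
  have h1 := sphereMoment_mul (2 * m) s s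
  rw [integral_pow_mul_exp_even, integral_plane_exp] at h1
  have h2 : (((2 * m + s + s : ℕ) : ℝ) + 3) / 2 = ((m + s : ℕ) + 1 / 2) + 1 := by
    push_cast
    ring
  have hpos : (0 : ℝ) < (m + s : ℕ) + 1 / 2 := by positivity
  rw [h2, Real.Gamma_add_one hpos.ne', Gamma_nat_add_half_eq, Gamma_nat_add_half_eq] at h1
  have h3 := (Nat.cast_ne_zero (R := ℝ)).mpr m.factorial_ne_zero
  have h4 := (Nat.cast_ne_zero (R := ℝ)).mpr (m + s).factorial_ne_zero
  have h5 := (Nat.cast_ne_zero (R := ℝ)).mpr (2 * (m + s)).factorial_ne_zero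
  have h6 : √Real.pi ≠ 0 := (Real.sqrt_pos.mpr Real.pi_pos).ne'
  set Y : ℝ := 1 / 2 * (((m + s : ℕ) + 1 / 2) * ((2 * (m + s)).factorial * √Real.pi /
    (4 ^ (m + s) * (m + s).factorial))) with hY
  have hY0 : Y ≠ 0 := by positivity
  rw [← mul_left_inj' (Complex.ofReal_ne_zero.mpr hY0), h1, ← Complex.ofReal_mul,
    ← Complex.ofReal_mul, Complex.ofReal_inj, hY]
  field_simp
  ring

/-! ### The angular integrals -/

theorem continuous_sphere_apply (i : Fin 3) :
    Continuous fun ω : Metric.sphere (0 : Space) 1 => ((ω : Space) i : ℂ) :=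
  Complex.continuous_ofReal.comp
    ((EuclideanSpace.proj i : Space →L[ℝ] ℝ).continuous.comp continuous_subtype_val)

theorem integrable_sphereMoment (a s t : ℕ) : Integrable
    (fun ω : Metric.sphere (0 : Space) 1 => ((ω : Space) 0 : ℂ) ^ a *
      (((ω : Space) 1 + (ω : Space) 2 * Complex.I) ^ s *
        (starRingEnd ℂ) ((ω : Space) 1 + (ω : Space) 2 * Complex.I) ^ t))
    (volume : Measure Space).toSphere := by
  have h0 := continuous_sphere_apply 0
  have h1 := continuous_sphere_apply 1
  have h2 := continuous_sphere_apply 2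
  have hw := h1.add (h2.mul (continuous_const (y := Complex.I)))
  exact ((h0.pow a).mul ((hw.pow s).mul ((Complex.continuous_conj.comp hw).pow t))).integrable_of_hasCompactSupport
    (HasCompactSupport.of_compactSpace _)

theorem mul_functional (Φ : MvPolynomial (Fin 4) ℂ →ₗ[ℂ] ℂ) (a : ℂ) (P : MvPolynomial (Fin 4) ℂ) :
    a * Φ P = Φ (C a * P) := by
  rw [← smul_eq_C_mul, map_smul, smul_eq_mul]

/-- Trading `(E E')^j` for `(U² - V²)^j`, expanded by the binomial theorem. -/
theorem reduce_pow (Φ : MvPolynomial (Fin 4) ℂ →ₗ[ℂ] ℂ) {U V E E' : MvPolynomial (Fin 4) ℂ}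
    (hΦ : ∀ P, Φ (E * E' * P) = Φ ((U ^ 2 - V ^ 2) * P)) (h k p j : ℕ) :
    Φ (U ^ h * V ^ k * E ^ (p + j) * E' ^ j) = ∑ T ∈ Finset.range (j + 1),
      (j.choose T : ℂ) * (-1) ^ T * Φ (E ^ p * U ^ (h + 2 * (j - T)) * V ^ (k + 2 * T)) := by
  have h1 : ∀ (j : ℕ) P, Φ ((E * E') ^ j * P) = Φ ((U ^ 2 - V ^ 2) ^ j * P) := by
    intro j
    induction j with
    | zero => simp
    | succ j ih =>
      intro P
      rw [pow_succ, mul_assoc, ih, mul_left_comm, hΦ, pow_succ']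
      congr 1
      ring
  rw [show U ^ h * V ^ k * E ^ (p + j) * E' ^ j = (E * E') ^ j * (U ^ h * V ^ k * E ^ p) by
    rw [mul_pow, pow_add]; ring, h1, show U ^ 2 - V ^ 2 = -V ^ 2 + U ^ 2 by ring, add_pow,
    Finset.sum_mul, map_sum]
  refine Finset.sum_congr rfl fun T _ => ?_
  rw [mul_functional]
  congr 1
  rw [neg_pow, ← pow_mul, ← pow_mul, pow_add, pow_add]
  simp only [map_mul, map_pow, map_neg, map_one, map_natCast]
  ring

/-- The coefficient attached to `r`, `s` in the angular integral. -/
noncomputable def angularCoeff (p b n r s : ℕ) : ℝ :=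
  4 * Real.pi / (2 * r + 1) * ((p + b + n).choose (2 * r) : ℝ) * (-1) ^ (p + b + n) *
    (r.choose s : ℝ) * ((2 * r - 2 * s).factorial / (2 * r - 2 * s - b).factorial : ℝ) *
    (n.factorial / (p + b + n).factorial : ℝ) *
    ((2 * s).doubleFactorial / (2 * s - 2 * p).doubleFactorial : ℝ)

/-- A multinomial coefficient times a moment of the sphere. -/
theorem multinomial_mul_sphereMoment {h k j m p b : ℕ} (hm : b + k = 2 * m) :
    ((h + k + (p + j) + j).factorial : ℂ) / (h.factorial * k.factorial * (p + j).factorial *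
      j.factorial) * (-1) ^ h * (1 / 2) ^ (p + j) * (1 / 2) ^ j *
        sphereMoment (b + k) (p + j) (p + j) =
      angularCoeff p b (h + k + (p + j) + j) (m + (p + j)) (p + j) := by
  rw [hm, sphereMoment_even, angularCoeff]
  have e1 : p + b + (h + k + (p + j) + j) = h + 2 * (m + (p + j)) := by omega
  have e2 : 2 * (m + (p + j)) - 2 * (p + j) = 2 * m := by omega
  have e3 : 2 * m - b = k := by omega
  have e4 : 2 * (p + j) - 2 * p = 2 * j := by omega
  rw [e1, e2, e3, e4, Nat.doubleFactorial_two_mul, Nat.doubleFactorial_two_mul,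
    Nat.cast_choose ℝ (show 2 * (m + (p + j)) ≤ h + 2 * (m + (p + j)) by omega),
    Nat.cast_choose ℝ (show p + j ≤ m + (p + j) by omega), Nat.add_sub_cancel, Nat.add_sub_cancel]
  have f1 := (Nat.cast_ne_zero (R := ℂ)).mpr (h + 2 * (m + (p + j))).factorial_ne_zero
  have f2 := (Nat.cast_ne_zero (R := ℂ)).mpr h.factorial_ne_zero
  have f3 := (Nat.cast_ne_zero (R := ℂ)).mpr k.factorial_ne_zero
  have f4 := (Nat.cast_ne_zero (R := ℂ)).mpr (p + j).factorial_ne_zero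
  have f5 := (Nat.cast_ne_zero (R := ℂ)).mpr j.factorial_ne_zero
  have f6 := (Nat.cast_ne_zero (R := ℂ)).mpr m.factorial_ne_zero
  have f7 := (Nat.cast_ne_zero (R := ℂ)).mpr (2 * (m + (p + j))).factorial_ne_zero
  have hs : (-1 : ℂ) ^ (h + 2 * (m + (p + j))) = (-1) ^ h := by
    rw [pow_add, pow_mul]
    simp
  have h4 : (4 : ℂ) ^ (p + j) = 2 ^ (p + j) * 2 ^ (p + j) := by
    rw [← mul_pow]
    norm_num
  push_cast
  rw [hs, h4, one_div, inv_pow, inv_pow]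
  field_simp

/-- The multinomial expansion of `Φ((-U + t V + (w' E + w E') / 2)^n)`. -/
theorem functional_pow_eq_sum (Φ : MvPolynomial (Fin 4) ℂ →ₗ[ℂ] ℂ)
    (U V E E' : MvPolynomial (Fin 4) ℂ) (n : ℕ) (t w w' : ℂ) :
    Φ ((-U + C t * V + C (w' / 2) * E + C (w / 2) * E') ^ n) =
      ∑ κ ∈ Finset.piAntidiag (Finset.univ : Finset (Fin 4)) n,
        (Nat.multinomial Finset.univ κ : ℂ) * (-1) ^ κ 0 * t ^ κ 1 * (w' / 2) ^ κ 2 * (w / 2) ^ κ 3 *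
          Φ (U ^ κ 0 * V ^ κ 1 * E ^ κ 2 * E' ^ κ 3) := by
  have h1 := Finset.sum_pow_eq_sum_piAntidiag (Finset.univ : Finset (Fin 4))
    ![-U, C t * V, C (w' / 2) * E, C (w / 2) * E'] n
  rw [Fin.sum_univ_four] at h1
  simp only [Matrix.cons_val_zero, Matrix.cons_val_one, Matrix.cons_val] at h1
  rw [h1, map_sum]
  refine Finset.sum_congr rfl fun κ _ => ?_
  rw [mul_functional]
  congr 1
  rw [Fin.prod_univ_four]
  simp only [Matrix.cons_val_zero, Matrix.cons_val_one, Matrix.cons_val, map_mul, map_pow, map_neg,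
    map_one, map_natCast, mul_pow, neg_pow U]
  ring

/-- The function `w^p t^b Φ((-U + t V + (w̄ E + w E') / 2)^n)`, where `t` is the coordinate of `q` along
the axis and `w` its complex coordinate in the plane. -/
noncomputable def angular (Φ : MvPolynomial (Fin 4) ℂ →ₗ[ℂ] ℂ) (U V E E' : MvPolynomial (Fin 4) ℂ)
    (p b n : ℕ) (q : Space) : ℂ :=
  (q 1 + q 2 * Complex.I) ^ p * (q 0 : ℂ) ^ b *
    Φ ((-U + C (q 0 : ℂ) * V + C ((starRingEnd ℂ) (q 1 + q 2 * Complex.I) / 2) * E +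
      C ((q 1 + q 2 * Complex.I) / 2) * E') ^ n)

theorem angular_eq_sum (Φ : MvPolynomial (Fin 4) ℂ →ₗ[ℂ] ℂ) (U V E E' : MvPolynomial (Fin 4) ℂ)
    (p b n : ℕ) (q : Space) : angular Φ U V E E' p b n q =
    ∑ κ ∈ Finset.piAntidiag (Finset.univ : Finset (Fin 4)) n,
      (Nat.multinomial Finset.univ κ : ℂ) * (-1) ^ κ 0 * (1 / 2) ^ κ 2 * (1 / 2) ^ κ 3 *
        ((q 0 : ℂ) ^ (b + κ 1) * ((q 1 + q 2 * Complex.I) ^ (p + κ 3) *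
          (starRingEnd ℂ) (q 1 + q 2 * Complex.I) ^ κ 2)) *
            Φ (U ^ κ 0 * V ^ κ 1 * E ^ κ 2 * E' ^ κ 3) := by
  rw [angular, functional_pow_eq_sum, Finset.mul_sum]
  refine Finset.sum_congr rfl fun κ _ => ?_
  simp only [div_eq_mul_inv, mul_pow, pow_add, one_mul]
  ring

theorem integrable_angular (Φ : MvPolynomial (Fin 4) ℂ →ₗ[ℂ] ℂ) (U V E E' : MvPolynomial (Fin 4) ℂ)
    (p b n : ℕ) : Integrable (fun ω : Metric.sphere (0 : Space) 1 => angular Φ U V E E' p b n ω)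
      (volume : Measure Space).toSphere := by
  simp only [angular_eq_sum]
  exact integrable_finsetSum _ fun κ _ => ((integrable_sphereMoment _ _ _).const_mul _).mul_const _

theorem sphereInt_eq_sum (Φ : MvPolynomial (Fin 4) ℂ →ₗ[ℂ] ℂ) (U V E E' : MvPolynomial (Fin 4) ℂ)
    (p b n : ℕ) : sphereInt (angular Φ U V E E' p b n) =
    ∑ κ ∈ Finset.piAntidiag (Finset.univ : Finset (Fin 4)) n,
      (Nat.multinomial Finset.univ κ : ℂ) * (-1) ^ κ 0 * (1 / 2) ^ κ 2 * (1 / 2) ^ κ 3 *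
        sphereMoment (b + κ 1) (p + κ 3) (κ 2) * Φ (U ^ κ 0 * V ^ κ 1 * E ^ κ 2 * E' ^ κ 3) := by
  simp only [sphereInt, angular_eq_sum]
  rw [integral_finsetSum _ fun κ _ =>
    ((integrable_sphereMoment _ _ _).const_mul _).mul_const _]
  refine Finset.sum_congr rfl fun κ _ => ?_
  rw [sphereMoment, sphereInt, ← integral_const_mul, ← integral_mul_const]

/-- Too few factors `w̄` are available to balance `w^p` if `n < p`. -/
theorem sphereInt_eq_zero (Φ : MvPolynomial (Fin 4) ℂ →ₗ[ℂ] ℂ) (U V E E' : MvPolynomial (Fin 4) ℂ)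
    {p n : ℕ} (hpn : n < p) (b : ℕ) :
    sphereInt (angular Φ U V E E' p b n) = 0 := by
  rw [sphereInt_eq_sum]
  refine Finset.sum_eq_zero fun κ hκ => ?_
  rw [Finset.mem_piAntidiag, Fin.sum_univ_four] at hκ
  rw [sphereMoment_of_ne _ (by omega)]
  ring

/-- The sum over `k` with the coefficients `C_{p,b,n,k}`, ordered by `r`, `s` and `T`. -/
theorem sum_coeffTime_mul (p b n : ℕ) (hpn : p ≤ n) (A : ℕ → ℕ → ℂ) :
    ∑ k ∈ Finset.range (n - p + 1), (coeffTime p b n k : ℂ) * A (n - p - k) k =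
      ∑ r ∈ Finset.Icc ((2 * p + b + 1) / 2) ((p + b + n) / 2),
        ∑ s ∈ Finset.Icc p ((2 * r - b) / 2), (angularCoeff p b n r s : ℂ) *
          ∑ T ∈ Finset.range (s - p + 1), ((s - p).choose T : ℂ) * (-1) ^ T *
            A (p + b + n - 2 * r + 2 * (s - p - T)) (2 * r - 2 * s - b + 2 * T) := by
  simp only [coeffTime, Complex.ofReal_sum, Finset.sum_mul]
  rw [Finset.sum_comm]
  refine Finset.sum_congr rfl fun r hr => ?_
  rw [Finset.sum_comm]
  refine Finset.sum_congr rfl fun s hs => ?_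
  rw [Finset.sum_comm, Finset.mul_sum]
  refine Finset.sum_congr rfl fun T hT => ?_
  rw [Finset.mem_Icc] at hr hs
  rw [Finset.mem_range] at hT
  rw [Finset.sum_eq_single (2 * r - 2 * s - b + 2 * T)]
  · rw [if_pos (by omega), show n - p - (2 * r - 2 * s - b + 2 * T) =
      p + b + n - 2 * r + 2 * (s - p - T) by omega, angularCoeff]
    push_cast
    ring
  · intro k _ hk
    rw [if_neg (by omega)]
    simp
  · intro hk
    rw [Finset.mem_range] at hk
    omega

/-- The angular integral in terms of the coefficients `C_{p,b,n,k}`. -/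
theorem sphereInt_eq_coeffTime (Φ : MvPolynomial (Fin 4) ℂ →ₗ[ℂ] ℂ) {U V E E' : MvPolynomial (Fin 4) ℂ}
    (hΦ : ∀ P, Φ (E * E' * P) = Φ ((U ^ 2 - V ^ 2) * P)) {p n : ℕ} (hpn : p ≤ n) (b : ℕ) :
    sphereInt (angular Φ U V E E' p b n) =
    ∑ k ∈ Finset.range (n - p + 1), (coeffTime p b n k : ℂ) *
      Φ (E ^ p * U ^ (n - p - k) * V ^ k) := by
  rw [sphereInt_eq_sum, sum_coeffTime_mul p b n hpn fun h k => Φ (E ^ p * U ^ h * V ^ k),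
    Finset.sum_sigma']
  -- only the terms with balanced plane moment and even axis moment survive
  rw [← Finset.sum_filter_of_ne (p := fun κ : Fin 4 → ℕ => κ 2 = p + κ 3 ∧ Even (b + κ 1))]
  swap
  · intro κ _ hne
    by_contra hcon
    rw [not_and_or] at hcon
    refine hne ?_
    rcases hcon with h1 | h1
    · rw [sphereMoment_of_ne _ (Ne.symm h1)]
      ring
    · rw [sphereMoment_of_odd (Nat.not_even_iff_odd.mp h1)]
      ring
  -- `2 r` and `2 s` count the spatial factors and those in the plane
  refine Finset.sum_nbij' (fun κ => (⟨(b + κ 1) / 2 + κ 2, κ 2⟩ : Σ _ : ℕ, ℕ))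
    (fun x => ![p + b + n - 2 * x.1, 2 * x.1 - 2 * x.2 - b, x.2, x.2 - p]) ?_ ?_ ?_ ?_ ?_
  · intro κ hκ
    simp only [Finset.mem_filter, Finset.mem_piAntidiag, Fin.sum_univ_four] at hκ
    obtain ⟨⟨hκ, -⟩, h2, m, hm⟩ := hκ
    simp only [Finset.mem_sigma, Finset.mem_Icc]
    omega
  · intro x hx
    simp only [Finset.mem_sigma, Finset.mem_Icc] at hx
    simp only [Finset.mem_filter, Finset.mem_piAntidiag, Fin.sum_univ_four, Matrix.cons_val_zero,
      Matrix.cons_val_one, Matrix.cons_val, Finset.mem_univ, implies_true, and_true]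
    refine ⟨by omega, by omega, x.1 - x.2, by omega⟩
  · intro κ hκ
    simp only [Finset.mem_filter, Finset.mem_piAntidiag, Fin.sum_univ_four] at hκ
    obtain ⟨⟨hκ, -⟩, h2, m, hm⟩ := hκ
    funext i
    fin_cases i <;> simp <;> omega
  · intro x hx
    simp only [Finset.mem_sigma, Finset.mem_Icc] at hx
    have h1 : (b + (2 * x.1 - 2 * x.2 - b)) / 2 + x.2 = x.1 := by omega
    simp [h1]
  · intro κ hκ
    simp only [Finset.mem_filter, Finset.mem_piAntidiag, Fin.sum_univ_four] at hκ
    obtain ⟨⟨hκ, -⟩, h2, m, hm⟩ := hκ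
    have hm2 : b + κ 1 = 2 * m := by omega
    have hmul : (Nat.multinomial Finset.univ κ : ℂ) = ((κ 0 + κ 1 + (p + κ 3) + κ 3).factorial : ℂ) /
        ((κ 0).factorial * (κ 1).factorial * (p + κ 3).factorial * (κ 3).factorial) := by
      have h3 := Nat.multinomial_spec Finset.univ κ
      rw [Fin.prod_univ_four, Fin.sum_univ_four, h2] at h3
      rw [← h3, eq_div_iff]
      · push_cast
        ring
      · have := fun j => (Nat.cast_ne_zero (R := ℂ)).mpr (Nat.factorial_ne_zero j)
        exact mul_ne_zero (mul_ne_zero (mul_ne_zero (this _) (this _)) (this _)) (this _)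
    have hcoef := multinomial_mul_sphereMoment (h := κ 0) (k := κ 1) (j := κ 3) (m := m) (p := p)
      (b := b) hm2
    have hn : κ 0 + κ 1 + (p + κ 3) + κ 3 = n := by omega
    have hr : (b + κ 1) / 2 + κ 2 = m + (p + κ 3) := by omega
    rw [hmul, hr, h2, hcoef, reduce_pow Φ hΦ, hn, Nat.add_sub_cancel_left,
      show p + b + n - 2 * (m + (p + κ 3)) = κ 0 by omega,
      show 2 * (m + (p + κ 3)) - 2 * (p + κ 3) - b = κ 1 by omega]

/-- A further factor `t` in the angular integral turns `C_{p,b,n,k}` into `D_{p,b,n,k}`. -/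
theorem coeffTime_succ (p b n k : ℕ) : coeffTime p (b + 1) n k = coeffSpace p b n k := by
  rw [coeffTime, coeffSpace]
  simp only [show p + (b + 1) + n = p + b + n + 1 by omega, show ∀ x : ℕ, x - (b + 1) = x - b - 1
    from fun x => rfl, show 2 * p + (b + 1) + 1 = 2 * p + b + 2 by omega,
    show k + (b + 1) = k + 1 + b by omega]

/-! ### The characteristic system at equilibrium -/

theorem fourMomentum_null (q : Space) : ∑ a, eta a * (fourMomentum q a * fourMomentum q a) = 0 := by
  have h := norm_sq_space q
  have h0 : fourMomentum q 0 = ‖q‖ := rfl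
  have h1 : fourMomentum q 1 = q 0 := rfl
  have h2 : fourMomentum q 2 = q 1 := rfl
  have h3 : fourMomentum q 3 = q 2 := rfl
  simp only [Fin.sum_univ_four, h0, h1, h2, h3]
  simp [eta]
  linear_combination -h

/-- The equations of the characteristic system are trace-less, since the four-momentum is null. -/
theorem isSymmTraceless_charLHS {N : ℕ} (F : (Fin (N + 1) → ℝ) → ℝ) (lam : (n : ℕ) → Tensor n)
    (hA : CoeffsConverge F lam) (φ : Fin 4 → ℝ) (d : Unknowns N) (m : Fin (N + 1)) :
    IsSymmTraceless (charLHS F lam φ d m) := by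
  refine ⟨fun σ μ => ?_, fun i j hij μ => ?_⟩
  · have h : ∀ (n : Fin (N + 1)) α β, coeffA F lam m n α (μ ∘ σ) β = coeffA F lam m n α μ β := by
      intro n α β
      simp only [coeffA, coeffIntegrand, Function.comp]
      refine integral_congr_ae (Filter.Eventually.of_forall fun q => ?_)
      simp only
      rw [Equiv.prod_comp σ fun i => fourMomentum q (μ i)]
    simp only [charLHS, h]
  · have h : ∀ (n : Fin (N + 1)) α β, ∑ a, eta a *
        coeffA F lam m n α (Function.update (Function.update μ i a) j a) β = 0 := by
      intro n α β
      simp only [coeffA, ← integral_const_mul]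
      rw [← integral_finsetSum _ fun a _ => (hA m n α _ β).const_mul _]
      refine integral_eq_zero_of_ae (Filter.Eventually.of_forall fun q => ?_)
      simp only [coeffIntegrand, prod_update_update (fourMomentum q) hij]
      have h1 : ∀ a, eta a * (secondPartial F m n (args N lam q) * fourMomentum q α *
          (fourMomentum q a * fourMomentum q a *
            ∏ k ∈ (Finset.univ.erase i).erase j, fourMomentum q (μ k)) *
          (∏ i, fourMomentum q (β i)) / fourMomentum q 0) =
          (eta a * (fourMomentum q a * fourMomentum q a)) *
          (secondPartial F m n (args N lam q) * fourMomentum q α *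
            (∏ k ∈ (Finset.univ.erase i).erase j, fourMomentum q (μ k)) *
          (∏ i, fourMomentum q (β i)) / fourMomentum q 0) := by
        intro a
        ring
      simp only [h1, ← Finset.sum_mul, fourMomentum_null, zero_mul]
      rfl
    have h2 : ∀ (n : Fin (N + 1)) α (β : Fin n → Fin 4), ∑ a, eta a * (φ α *
        coeffA F lam m n α (Function.update (Function.update μ i a) j a) β * d n β) = 0 := by
      intro n α β
      have h1 := congrArg (fun x => x * (φ α * d n β)) (h n α β)
      simp only [Finset.sum_mul, zero_mul] at h1
      rw [← h1]
      refine Finset.sum_congr rfl fun a _ => ?_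
      ring
    simp only [charLHS, Finset.mul_sum]
    rw [Finset.sum_comm]
    refine Finset.sum_eq_zero fun n _ => ?_
    rw [Finset.sum_comm]
    refine Finset.sum_eq_zero fun α _ => ?_
    rw [Finset.sum_comm]
    exact Finset.sum_eq_zero fun β _ => h2 n α β

/-- The contraction of the left-hand side of the `m`-th equation with covectors `x₁, …, x_m`. -/
theorem sum_charLHS_mul {N : ℕ} (F : (Fin (N + 1) → ℝ) → ℝ) (lam : (n : ℕ) → Tensor n)
    (hA : CoeffsConverge F lam) (φ : Fin 4 → ℝ) (d : Unknowns N) (m : Fin (N + 1))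
    (x : Fin m → Fin 4 → ℂ) :
    ∑ μ, (charLHS F lam φ d m μ : ℂ) * ∏ i, x i (μ i) =
      ∑ n : Fin (N + 1), ∫ q : Space, (secondPartial F m n (args N lam q) : ℂ) *
        (∑ a, (φ a : ℂ) * fourMomentum q a) * (∏ i, ∑ a, x i a * (fourMomentum q a : ℂ)) *
        (∑ β, (d n β : ℂ) * ∏ i, (fourMomentum q (β i) : ℂ)) / (fourMomentum q 0 : ℂ) := by
  simp only [charLHS, Complex.ofReal_sum, Finset.sum_mul]
  rw [Finset.sum_comm]
  refine Finset.sum_congr rfl fun n _ => ?_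
  have hint : ∀ (μ : Fin m → Fin 4) (α : Fin 4) (β : Fin n → Fin 4), Integrable fun q : Space =>
      ((φ α : ℂ) * d n β * ∏ i, x i (μ i)) * (coeffIntegrand F lam m n α μ β q : ℂ) :=
    fun μ α β => ((hA m n α μ β).ofReal).const_mul _
  have h1 : ∀ q : Space, (secondPartial F m n (args N lam q) : ℂ) *
        (∑ a, (φ a : ℂ) * fourMomentum q a) * (∏ i, ∑ a, x i a * (fourMomentum q a : ℂ)) *
        (∑ β, (d n β : ℂ) * ∏ i, (fourMomentum q (β i) : ℂ)) / (fourMomentum q 0 : ℂ) =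
      ∑ μ : Fin m → Fin 4, ∑ α : Fin 4, ∑ β : Fin n → Fin 4,
        ((φ α : ℂ) * d n β * ∏ i, x i (μ i)) * (coeffIntegrand F lam m n α μ β q : ℂ) := by
    intro q
    have h2 : ∀ (μ : Fin m → Fin 4) (α : Fin 4) (β : Fin n → Fin 4),
        ((φ α : ℂ) * d n β * ∏ i, x i (μ i)) * (coeffIntegrand F lam m n α μ β q : ℂ) =
        ((secondPartial F m n (args N lam q) : ℂ) / (fourMomentum q 0 : ℂ)) *
          ((∏ i, x i (μ i) * (fourMomentum q (μ i) : ℂ)) * (((φ α : ℂ) * fourMomentum q α) *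
            ((d n β : ℂ) * ∏ i, (fourMomentum q (β i) : ℂ)))) := by
      intro μ α β
      rw [coeffIntegrand, Finset.prod_mul_distrib]
      push_cast
      ring
    simp only [h2, ← Finset.mul_sum, ← Finset.sum_mul]
    rw [Finset.prod_univ_sum, Fintype.piFinset_univ]
    ring
  simp only [h1]
  rw [integral_finsetSum _ fun μ _ => integrable_finsetSum _ fun α _ => integrable_finsetSum _
    fun β _ => hint μ α β]
  refine Finset.sum_congr rfl fun μ _ => ?_
  rw [integral_finsetSum _ fun α _ => integrable_finsetSum _ fun β _ => hint μ α β]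
  refine Finset.sum_congr rfl fun α _ => ?_
  rw [integral_finsetSum _ fun β _ => hint μ α β]
  refine Finset.sum_congr rfl fun β _ => ?_
  rw [integral_const_mul, integral_complex_ofReal]
  simp only [coeffA, Complex.ofReal_mul]
  ring

theorem exists_covectors (e : Fin 4 → Fin 4 → ℝ) {m p a b : ℕ} (hm : p + a + b = m) :
    ∃ x : Fin m → Fin 4 → ℂ,
      ∏ i, lin (x i) = lin (nullE e) ^ p * lin (cvec e 0) ^ a * lin (cvec e 1) ^ b := by
  subst hm
  refine ⟨Fin.append (Fin.append (fun _ : Fin p => nullE e) (fun _ : Fin a => cvec e 0))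
    (fun _ : Fin b => cvec e 1), ?_⟩
  rw [Fin.prod_univ_add, Fin.prod_univ_add]
  simp

theorem aeval_lin (P x : Fin 4 → ℂ) : aeval P (lin x) = ∑ a, x a * P a := by
  simp [lin]

/-- The components of `E^p u^a v^b` of the `m`-th equation, as integrals over the light cone. -/
theorem amplitude_charLHS {N : ℕ} (F : (Fin (N + 1) → ℝ) → ℝ) (lam : (n : ℕ) → Tensor n)
    (hA : CoeffsConverge F lam) (φ : Fin 4 → ℝ) (d : Unknowns N) (m : Fin (N + 1))
    (e : Fin 4 → Fin 4 → ℝ) {p a b : ℕ} (hm : p + a + b = m) :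
    amplitude e (charLHS F lam φ d m) p a b =
      ∑ n : Fin (N + 1), ∫ q : Space, (secondPartial F m n (args N lam q) : ℂ) *
        (∑ a, (φ a : ℂ) * fourMomentum q a) *
        ((∑ c, nullE e c * (fourMomentum q c : ℂ)) ^ p *
          (∑ c, cvec e 0 c * (fourMomentum q c : ℂ)) ^ a *
          (∑ c, cvec e 1 c * (fourMomentum q c : ℂ)) ^ b) *
        (∑ β, (d n β : ℂ) * ∏ i, (fourMomentum q (β i) : ℂ)) / (fourMomentum q 0 : ℂ) := by
  obtain ⟨x, hx⟩ := exists_covectors e hm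
  have hs := (isSymmTraceless_charLHS F lam hA φ d m).1
  rw [amplitude, ← hx, umbral_prod_lin hs.toComplex]
  refine (sum_charLHS_mul F lam hA φ d m x).trans ?_
  refine Finset.sum_congr rfl fun n _ => ?_
  refine integral_congr_ae (Filter.Eventually.of_forall fun q => ?_)
  have h := congrArg (aeval (R := ℂ) fun a => (fourMomentum q a : ℂ)) hx
  simp only [map_prod, map_mul, map_pow, aeval_lin] at h
  simp only [h]

theorem args_equilibrium (N : ℕ) (l0 : ℝ) (l : Fin 4 → ℝ) (q : Space) :
    args N (equilibrium l0 l) q = fun i : Fin (N + 1) => if (i : ℕ) = 0 then l0 else if (i : ℕ) = 1 then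
      ∑ a, l a * fourMomentum q a else 0 := by
  funext ⟨i, hi⟩
  rcases i with _ | _ | i
  · simp [args, equilibrium]
  · simp only [args, equilibrium, zero_add, one_ne_zero, if_true, if_false]
    rw [← (Equiv.funUnique (Fin 1) (Fin 4)).symm.sum_comp]
    simp
  · simp [args, equilibrium]

/-- The null covector `p_α` in null coordinates. -/
theorem lin_frameMomentum (e : Fin 4 → Fin 4 → ℝ) (ε : ℝ) {q : Space}
    (hq : q ≠ 0) : lin (fun a => (eta a : ℂ) * frameMomentum e ε q a) = C ((ε : ℂ) * ‖q‖) *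
      (-lin (cvec e 0) + C ((‖q‖⁻¹ • q) 0 : ℂ) * lin (cvec e 1) +
      C ((starRingEnd ℂ) ((‖q‖⁻¹ • q) 1 + (‖q‖⁻¹ • q) 2 * Complex.I) / 2) * lin (nullE e) +
      C (((‖q‖⁻¹ • q) 1 + (‖q‖⁻¹ • q) 2 * Complex.I) / 2) * lin (nullE' e)) := by
  have hq' : (‖q‖ : ℂ) ≠ 0 := by simpa using hq
  have h0 : ∀ i, ((‖q‖⁻¹ • q) i : ℂ) = (‖q‖ : ℂ)⁻¹ * q i := by
    intro i
    simp
  simp only [lin, mul_add, Finset.mul_sum, ← Finset.sum_add_distrib, mul_neg,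
    ← Finset.sum_neg_distrib]
  refine Finset.sum_congr rfl fun a _ => ?_
  simp only [← mul_assoc, ← C_mul, ← neg_mul, ← C_neg, ← add_mul, ← C_add]
  congr 2
  have hfm : (eta a : ℂ) * frameMomentum e ε q a = ε * (-‖q‖ * e 0 a + q 0 * e 1 a + q 1 * e 2 a +
      q 2 * e 3 a) := by
    have h1 : coneCoord q 1 = q 0 := rfl
    have h2 : coneCoord q 2 = q 1 := rfl
    have h3 : coneCoord q 3 = q 2 := rfl
    have h4 : coneCoord q 0 = -‖q‖ := rfl
    rw [frameMomentum, Fin.sum_univ_four, h1, h2, h3, h4]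
    push_cast
    rw [← mul_assoc, eta_mul_self_complex, one_mul]
  rw [hfm]
  simp only [h0, cvec, nullE, nullE', map_add, map_mul, Complex.conj_I, map_inv₀,
    Complex.conj_ofReal]
  have hI := Complex.I_sq
  field_simp
  linear_combination (2 * (ε : ℂ) * q 2 * e 3 a) * hI

theorem sum_mul_lower {n : ℕ} {T : Tensor n} (hT : IsSymm (raise T)) (P : Fin 4 → ℝ) :
    ∑ β, (T β : ℂ) * ∏ i, (P (β i) : ℂ) =
      umbral (toComplex (raise T)) (lin (fun a => (eta a : ℂ) * P a) ^ n) := by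
  rw [umbral_lin_pow hT.toComplex]
  refine Finset.sum_congr rfl fun β _ => ?_
  simp only [toComplex, raise, Finset.prod_mul_distrib]
  push_cast
  have h : (∏ i, (eta (β i) : ℂ)) * ∏ i, (eta (β i) : ℂ) = 1 := by
    rw [← Finset.prod_mul_distrib]
    simp [eta_mul_self_complex]
  linear_combination (-(T β : ℂ) * ∏ i, (P (β i) : ℂ)) * h

/-- Collecting the powers of `ε r` in the integrand over the light cone. -/
theorem factor_homogeneous (f A B w z y ε r : ℂ) (hr : r ≠ 0) {p a b m n : ℕ} (hm : p + a + b = m) :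
    f * ((ε * r) * (A + B * w)) * (((ε * r) * z) ^ p * (ε * r) ^ a * ((ε * r) * w) ^ b) *
      ((ε * r) ^ n * y) / r =
    (f * (ε ^ (m + n + 1) * r ^ (m + n))) * (A * (z ^ p * w ^ b * y) +
      B * (z ^ p * w ^ (b + 1) * y)) := by
  subst hm
  simp only [mul_pow, pow_add, pow_one]
  rw [div_eq_iff hr]
  ring

/-- The integrals over the light cone factor into a radial and an angular part. -/
theorem integral_factor {e : Fin 4 → Fin 4 → ℝ} (he : IsFrame e) {N : ℕ}
    (F : (Fin (N + 1) → ℝ) → ℝ) (l0 : ℝ) (l : Fin 4 → ℝ) (hg : gam l ≠ 0) (hu : e 0 = vel l)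
    (hε : Real.sign (l 0) * e 0 0 = |e 0 0|) (hε2 : |Real.sign (l 0)| = 1) (φ : Fin 4 → ℝ) (A B : ℝ)
    (hφ : ∀ a, φ a = A * e 0 a + B * e 1 a) (m n : Fin (N + 1)) {p a b : ℕ} (hm : p + a + b = m)
    {T : Tensor n} (hT : IsSymmTraceless T) :
    ∫ q : Space, (secondPartial F m n (args N (equilibrium l0 l) q) : ℂ) *
        (∑ a, (φ a : ℂ) * fourMomentum q a) *
        ((∑ c, nullE e c * (fourMomentum q c : ℂ)) ^ p *
          (∑ c, cvec e 0 c * (fourMomentum q c : ℂ)) ^ a *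
          (∑ c, cvec e 1 c * (fourMomentum q c : ℂ)) ^ b) *
        (∑ β, (T β : ℂ) * ∏ i, (fourMomentum q (β i) : ℂ)) / (fourMomentum q 0 : ℂ) =
      (radialG F l0 l m n : ℂ) * (A * sphereInt (angular (umbral (toComplex (raise T)))
          (lin (cvec e 0)) (lin (cvec e 1)) (lin (nullE e)) (lin (nullE' e)) p b n) +
        B * sphereInt (angular (umbral (toComplex (raise T)))
          (lin (cvec e 0)) (lin (cvec e 1)) (lin (nullE e)) (lin (nullE' e)) p (b + 1) n)) := by
  set ε := Real.sign (l 0) with hεdef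
  set Φ := umbral (toComplex (raise T)) with hΦ
  set Ω : ℕ → Space → ℂ := fun b => angular Φ (lin (cvec e 0)) (lin (cvec e 1)) (lin (nullE e))
    (lin (nullE' e)) p b n with hΩ
  set f : ℝ → ℂ := fun y => (secondPartial F m n (fun i => if (i : ℕ) = 0 then l0 else
    if (i : ℕ) = 1 then y else 0) : ℂ) with hf
  simp only [args_equilibrium, sum_mul_lower hT.raise.1]
  refine (integral_cone_eq he hε hε2 (fun P => f (∑ a, l a * P a) *
        (∑ a, (φ a : ℂ) * P a) *
        ((∑ c, nullE e c * (P c : ℂ)) ^ p *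
          (∑ c, cvec e 0 c * (P c : ℂ)) ^ a *
          (∑ c, cvec e 1 c * (P c : ℂ)) ^ b) *
        Φ (lin (fun a => (eta a : ℂ) * P a) ^ (n : ℕ)))).trans ?_
  have hl : ∀ a, l a = gam l * e 0 a := by
    intro a
    rw [hu, vel]
    simp [hg]
  -- the integrand in polar coordinates
  have key : ∀ q : Space, q ≠ 0 →
      f (∑ a, l a * frameMomentum e ε q a) *
        (∑ a, (φ a : ℂ) * frameMomentum e ε q a) *
        ((∑ c, nullE e c * (frameMomentum e ε q c : ℂ)) ^ p *
          (∑ c, cvec e 0 c * (frameMomentum e ε q c : ℂ)) ^ a *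
          (∑ c, cvec e 1 c * (frameMomentum e ε q c : ℂ)) ^ b) *
        Φ (lin (fun a => (eta a : ℂ) * frameMomentum e ε q a) ^ (n : ℕ)) / (‖q‖ : ℂ) =
      (f (ε * (‖q‖ * gam l)) * ((ε : ℂ) ^ ((m : ℕ) + n + 1) * (‖q‖ : ℂ) ^ ((m : ℕ) + n))) *
        (A * Ω b (‖q‖⁻¹ • q) + B * Ω (b + 1) (‖q‖⁻¹ • q)) := by
    intro q hq
    have hq' : (‖q‖ : ℂ) ≠ 0 := by simpa using hq
    set w := ‖q‖⁻¹ • q with hw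
    have hqw : ∀ i, (q i : ℂ) = ‖q‖ * w i := by
      intro i
      simp only [hw, PiLp.smul_apply, smul_eq_mul]
      push_cast
      field_simp
    have hs := fun b => he.sum_mul_frameMomentum ε q b
    have c1 : coneCoord q 1 = q 0 := rfl
    have c2 : coneCoord q 2 = q 1 := rfl
    have c3 : coneCoord q 3 = q 2 := rfl
    have c4 : coneCoord q 0 = -‖q‖ := rfl
    have s0 : ∑ a, e 0 a * frameMomentum e ε q a = ε * ‖q‖ := by
      rw [hs, c4]
      simp [eta]
    have hsC : ∀ b, ∑ a, (e b a : ℂ) * frameMomentum e ε q a = ε * (eta b * coneCoord q b) := by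
      intro b
      exact_mod_cast congrArg (fun x : ℝ => (x : ℂ)) (hs b)
    have t0 : ∑ c, cvec e 0 c * (frameMomentum e ε q c : ℂ) = ε * ‖q‖ := by
      simp only [cvec]
      exact_mod_cast congrArg (fun x : ℝ => (x : ℂ)) s0
    have t1 : ∑ c, cvec e 1 c * (frameMomentum e ε q c : ℂ) = (ε * ‖q‖) * w 0 := by
      simp only [cvec]
      rw [hsC, c1, hqw]
      simp [eta, mul_assoc]
    have tE : ∑ c, nullE e c * (frameMomentum e ε q c : ℂ) =
        (ε * ‖q‖) * (w 1 + w 2 * Complex.I) := by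
      simp only [nullE, add_mul, Finset.sum_add_distrib, mul_assoc, ← Finset.mul_sum]
      rw [hsC, hsC, c2, c3, hqw, hqw]
      simp [eta]
      ring
    have tl : ∑ a, l a * frameMomentum e ε q a = ε * (‖q‖ * gam l) := by
      simp only [hl, mul_assoc, ← Finset.mul_sum]
      rw [s0]
      ring
    have tφ : ∑ a, (φ a : ℂ) * frameMomentum e ε q a = (ε * ‖q‖) * (A + B * w 0) := by
      simp only [hφ]
      push_cast
      simp only [add_mul, Finset.sum_add_distrib, mul_assoc, ← Finset.mul_sum]
      simp only [cvec] at t0 t1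
      rw [t0, t1]
      ring
    rw [tl, tφ, tE, t0, t1, lin_frameMomentum e ε hq, mul_pow (C _), ← map_pow,
      ← mul_functional]
    simp only [hΩ, angular, ← hw]
    exact factor_homogeneous _ _ _ _ _ _ _ _ hq' hm
  have h1 : ∫ q : Space, f (∑ a, l a * frameMomentum e ε q a) *
        (∑ a, (φ a : ℂ) * frameMomentum e ε q a) *
        ((∑ c, nullE e c * (frameMomentum e ε q c : ℂ)) ^ p *
          (∑ c, cvec e 0 c * (frameMomentum e ε q c : ℂ)) ^ a *
          (∑ c, cvec e 1 c * (frameMomentum e ε q c : ℂ)) ^ b) *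
        Φ (lin (fun a => (eta a : ℂ) * frameMomentum e ε q a) ^ (n : ℕ)) / (‖q‖ : ℂ) =
      ∫ q : Space, (f (ε * (‖q‖ * gam l)) *
        ((ε : ℂ) ^ ((m : ℕ) + n + 1) * (‖q‖ : ℂ) ^ ((m : ℕ) + n))) *
        (A * Ω b (‖q‖⁻¹ • q) + B * Ω (b + 1) (‖q‖⁻¹ • q)) := by
    refine integral_congr_ae ?_
    have : ∀ᵐ q : Space, q ≠ 0 := Measure.ae_ne volume 0
    filter_upwards [this] with q hq using key q hq
  rw [h1, integral_polar (fun ρ => f (ε * (ρ * gam l)) *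
    ((ε : ℂ) ^ ((m : ℕ) + n + 1) * (ρ : ℂ) ^ ((m : ℕ) + n))) (fun w => A * Ω b w + B * Ω (b + 1) w),
    mul_comm]
  congr 1
  · rw [radialG]
    push_cast
    rw [← integral_complex_ofReal, ← integral_const_mul]
    refine setIntegral_congr_fun measurableSet_Ioi fun ρ _ => ?_
    simp only [hf, ← hεdef]
    push_cast
    ring
  · simp only [sphereInt]
    rw [integral_add ((integrable_angular _ _ _ _ _ _ _ _).const_mul _)
      ((integrable_angular _ _ _ _ _ _ _ _).const_mul _), integral_const_mul, integral_const_mul]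

/-! ### Existence of orthonormal frames -/

theorem mdot_comm (x y : Fin 4 → ℝ) : mdot x y = mdot y x :=
  Finset.sum_congr rfl fun a _ => by ring

theorem mdot_smul_left (c : ℝ) (x y : Fin 4 → ℝ) : mdot (c • x) y = c * mdot x y := by
  simp only [mdot, Finset.mul_sum, Pi.smul_apply, smul_eq_mul]
  exact Finset.sum_congr rfl fun a _ => by ring

theorem mdot_smul_right (c : ℝ) (x y : Fin 4 → ℝ) : mdot x (c • y) = c * mdot x y := by
  rw [mdot_comm, mdot_smul_left, mdot_comm]

theorem mdot_eq (x y : Fin 4 → ℝ) :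
    mdot x y = -(x 0 * y 0) + x 1 * y 1 + x 2 * y 2 + x 3 * y 3 := by
  simp [mdot, Fin.sum_univ_four, eta]

/-- A nonzero covector orthogonal to a time-like one is space-like. -/
theorem mdot_self_pos {u w : Fin 4 → ℝ} (hu : mdot u u = -1) (huw : mdot u w = 0) (hw : w ≠ 0) :
    0 < mdot w w := by
  by_contra hneg
  rw [mdot_eq] at hu huw hneg
  have h1 : (u 1 * w 1 + u 2 * w 2 + u 3 * w 3) ^ 2 ≤
      (u 1 ^ 2 + u 2 ^ 2 + u 3 ^ 2) * (w 1 ^ 2 + w 2 ^ 2 + w 3 ^ 2) := by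
    nlinarith [sq_nonneg (u 1 * w 2 - u 2 * w 1), sq_nonneg (u 1 * w 3 - u 3 * w 1),
      sq_nonneg (u 2 * w 3 - u 3 * w 2)]
  have h2 : u 1 * w 1 + u 2 * w 2 + u 3 * w 3 = u 0 * w 0 := by linarith
  have h3 : u 0 ^ 2 = 1 + (u 1 ^ 2 + u 2 ^ 2 + u 3 ^ 2) := by linarith
  have h4 : w 1 ^ 2 + w 2 ^ 2 + w 3 ^ 2 ≤ w 0 ^ 2 := by linarith
  rw [h2, mul_pow, h3] at h1
  have h5 : (u 1 ^ 2 + u 2 ^ 2 + u 3 ^ 2) * (w 1 ^ 2 + w 2 ^ 2 + w 3 ^ 2) ≤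
      (u 1 ^ 2 + u 2 ^ 2 + u 3 ^ 2) * w 0 ^ 2 := by gcongr
  have h0 : w 0 ^ 2 = 0 := le_antisymm (by linarith) (sq_nonneg _)
  apply hw
  funext a
  have e1 := sq_nonneg (w 1)
  have e2 := sq_nonneg (w 2)
  have e3 := sq_nonneg (w 3)
  fin_cases a
  · exact pow_eq_zero_iff two_ne_zero |>.mp h0
  · exact pow_eq_zero_iff two_ne_zero |>.mp (by linarith : w 1 ^ 2 = 0)
  · exact pow_eq_zero_iff two_ne_zero |>.mp (by linarith : w 2 ^ 2 = 0)
  · exact pow_eq_zero_iff two_ne_zero |>.mp (by linarith : w 3 ^ 2 = 0)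

/-- Three covectors, one of them time-like, have a common space-like unit normal. -/
theorem exists_unit_normal {u : Fin 4 → ℝ} (hu : mdot u u = -1) (x y : Fin 4 → ℝ) :
    ∃ w, mdot w w = 1 ∧ mdot u w = 0 ∧ mdot x w = 0 ∧ mdot y w = 0 := by
  set A : Matrix (Fin 3) (Fin 4) ℝ := Matrix.of fun i a => eta a * (![u, x, y] i) a with hA
  have hker : LinearMap.ker A.mulVecLin ≠ ⊥ :=
    LinearMap.ker_ne_bot_of_finrank_lt (by simp)
  obtain ⟨w, hw, hw0⟩ := (Submodule.ne_bot_iff _).mp hker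
  have hz : ∀ i, mdot (![u, x, y] i) w = 0 := fun i => congrFun hw i
  have h0 : mdot u w = 0 := hz 0
  have h1 : mdot x w = 0 := hz 1
  have h2 : mdot y w = 0 := hz 2
  have hpos := mdot_self_pos hu h0 hw0
  refine ⟨(√(mdot w w))⁻¹ • w, ?_, ?_, ?_, ?_⟩
  · rw [mdot_smul_left, mdot_smul_right, ← mul_assoc, ← mul_inv, Real.mul_self_sqrt hpos.le,
      inv_mul_cancel₀ hpos.ne']
  all_goals simp [mdot_smul_right, h0, h1, h2]

theorem exists_frame {u v : Fin 4 → ℝ} (hu : mdot u u = -1) (hv : mdot v v = 1)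
    (huv : mdot u v = 0) : ∃ e, IsFrame e ∧ e 0 = u ∧ e 1 = v := by
  obtain ⟨x, hx, hux, hvx, -⟩ := exists_unit_normal hu v v
  obtain ⟨y, hy, huy, hvy, hxy⟩ := exists_unit_normal hu v x
  refine ⟨![u, v, x, y], fun a b => ?_, rfl, rfl⟩
  fin_cases a <;> fin_cases b <;>
    simp [metric, eta, hu, hv, huv, hx, hux, hvx, hy, huy, hvy, hxy, mdot_comm v u, mdot_comm x u,
      mdot_comm x v, mdot_comm y u, mdot_comm y v, mdot_comm y x]

/-- The part of `φ` orthogonal to `u`. -/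
theorem sum_hLow (u φ : Fin 4 → ℝ) (a : Fin 4) :
    ∑ b, hLow u a b * eta b * φ b = φ a + mdot φ u * u a := by
  have h : ∀ b, hLow u a b * eta b * φ b =
      (if a = b then φ b else 0) + eta b * φ b * u b * u a := by
    intro b
    rw [hLow, metric]
    split_ifs with hab
    · subst hab
      rw [add_mul, eta_mul_self]
      ring
    · ring
  rw [Finset.sum_congr rfl fun b _ => h b, Finset.sum_add_distrib, mdot, Finset.sum_mul]
  simp

theorem spatialNorm_eq {u : Fin 4 → ℝ} (hu : mdot u u = -1) (φ : Fin 4 → ℝ) :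
    spatialNorm u φ = √(mdot (fun a => φ a + mdot φ u * u a) fun a => φ a + mdot φ u * u a) := by
  rw [spatialNorm]
  congr 1
  have h1 : ∀ a, ∑ b, eta a * eta b * hLow u a b * φ a * φ b =
      eta a * φ a * φ a + mdot φ u * (eta a * φ a * u a) := by
    intro a
    have h2 : ∀ b, eta a * eta b * hLow u a b * φ a * φ b =
        eta a * φ a * (hLow u a b * eta b * φ b) := fun b => by ring
    rw [Finset.sum_congr rfl fun b _ => h2 b, ← Finset.mul_sum, sum_hLow]
    ring
  have h3 : ∀ t, mdot (fun a => φ a + t * u a) (fun a => φ a + t * u a) =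
      mdot φ φ + 2 * t * mdot φ u + t ^ 2 * mdot u u := by
    intro t
    simp only [mdot, Fin.sum_univ_four]
    ring
  rw [Finset.sum_congr rfl fun a _ => h1 a, h3, hu, Finset.sum_add_distrib, ← Finset.mul_sum]
  change mdot φ φ + mdot φ u * mdot φ u = _
  ring

/-- The spatial direction of `φ`; if `φ` is parallel to `u`, any unit normal of `u` serves. -/
theorem exists_direction {u : Fin 4 → ℝ} (hu : mdot u u = -1) (φ : Fin 4 → ℝ) :
    ∃ v, mdot v v = 1 ∧ mdot u v = 0 ∧
      ∀ a, ∑ b, hLow u a b * eta b * φ b = spatialNorm u φ * v a := by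
  simp only [sum_hLow, spatialNorm_eq hu]
  set y : Fin 4 → ℝ := fun a => φ a + mdot φ u * u a with hy
  have huy : mdot u y = 0 := by
    have h : ∀ t, mdot u (fun a => φ a + t * u a) = mdot φ u + t * mdot u u := by
      intro t
      simp only [mdot, Fin.sum_univ_four]
      ring
    rw [hy, h, hu]
    ring
  by_cases h0 : y = 0
  · obtain ⟨v, hv, huv, -⟩ := exists_unit_normal hu u u
    refine ⟨v, hv, huv, fun a => ?_⟩
    have : φ a + mdot φ u * u a = 0 := congrFun h0 a
    rw [this, h0]
    simp [mdot]
  · have hpos := mdot_self_pos hu huy h0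
    have hs : √(mdot y y) ≠ 0 := (Real.sqrt_pos.mpr hpos).ne'
    refine ⟨(√(mdot y y))⁻¹ • y, ?_, ?_, fun a => ?_⟩
    · rw [mdot_smul_left, mdot_smul_right, ← mul_assoc, ← mul_inv, Real.mul_self_sqrt hpos.le,
        inv_mul_cancel₀ hpos.ne']
    · rw [mdot_smul_right, huy, mul_zero]
    · rw [Pi.smul_apply, smul_eq_mul, mul_inv_cancel_left₀ hs]

/-! ### The rest frame of the equilibrium state -/

theorem gam_ne_zero {l : Fin 4 → ℝ} (hl : mdot l l < 0) : gam l ≠ 0 :=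
  (Real.sqrt_pos.mpr (by linarith)).ne'

theorem mdot_vel {l : Fin 4 → ℝ} (hl : mdot l l < 0) : mdot (vel l) (vel l) = -1 := by
  have h := Real.mul_self_sqrt (show 0 ≤ -mdot l l by linarith)
  have h2 : gam l * gam l = -mdot l l := h
  have h3 := gam_ne_zero hl
  rw [vel, mdot_smul_left, mdot_smul_right, show mdot l l = -(gam l * gam l) by linarith]
  field_simp

theorem sign_mul_vel {l : Fin 4 → ℝ} (hl : mdot l l < 0) :
    Real.sign (l 0) * vel l 0 = |vel l 0| ∧ |Real.sign (l 0)| = 1 := by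
  have h0 : l 0 ≠ 0 := by
    intro h0
    rw [mdot_eq, h0] at hl
    nlinarith [sq_nonneg (l 1), sq_nonneg (l 2), sq_nonneg (l 3)]
  have hg : 0 < (gam l)⁻¹ := inv_pos.mpr (Real.sqrt_pos.mpr (by linarith))
  simp only [vel, Pi.smul_apply, smul_eq_mul, abs_mul, abs_of_pos hg]
  rcases lt_or_gt_of_ne h0 with h | h
  · rw [Real.sign_of_neg h, abs_of_neg h]
    simp
  · rw [Real.sign_of_pos h, abs_of_pos h]
    simp

/-! ### The subsystems -/

/-- An orthonormal frame whose first covectors are the four-velocity `u` of the equilibrium state and a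
direction `v` such that `φ` lies in the plane of `u` and `v`, with the spatial norm of `φ` as its
component along `v`. -/
structure AdaptedFrame (l φ : Fin 4 → ℝ) (e : Fin 4 → Fin 4 → ℝ) : Prop where
  isFrame : IsFrame e
  vel_eq : e 0 = vel l
  decomp : ∀ a, φ a = -mdot φ (vel l) * e 0 a + spatialNorm (vel l) φ * e 1 a

variable {N : ℕ} {F : (Fin (N + 1) → ℝ) → ℝ} {l0 : ℝ} {l φ : Fin 4 → ℝ} {e : Fin 4 → Fin 4 → ℝ}

/-- The amplitude of a projected equation is a combination of the amplitudes of the unknowns of the same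
order, with the entries of the subsystem matrix as coefficients. -/
theorem AdaptedFrame.amplitude_charLHS (he : AdaptedFrame l φ e) (hl : mdot l l < 0)
    (hA : CoeffsConverge F (equilibrium l0 l)) {d : Unknowns N} (hd : Admissible d)
    (p : Fin (N + 1)) (i : Pairs N p) :
    amplitude e (charLHS F (equilibrium l0 l) φ d i.order) p i.1.1 i.1.2 =
      ∑ j, (subMatrix F l0 l φ p i j : ℂ) * amplitude e (raise (d j.order)) p j.1.1 j.1.2 := by
  have hε := sign_mul_vel hl
  rw [← he.vel_eq] at hε
  rw [ExtendedThermo.amplitude_charLHS F _ hA φ d i.order e rfl,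
    ← Finset.sum_fiberwise Finset.univ fun j : Pairs N p => j.order]
  refine Finset.sum_congr rfl fun n _ => ?_
  rw [integral_factor he.isFrame F l0 l (gam_ne_zero hl) he.vel_eq hε.1 hε.2 φ _ _ he.decomp i.order n
    rfl (hd n)]
  rcases lt_or_ge (n : ℕ) p with hn | hn
  · rw [sphereInt_eq_zero _ _ _ _ _ hn, sphereInt_eq_zero _ _ _ _ _ hn, Finset.sum_eq_zero]
    · simp
    · intro j hj
      have h1 : (j.order : ℕ) = n := congrArg Fin.val (Finset.mem_filter.mp hj).2
      simp only [Pairs.order] at h1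
      omega
  · have hΦ := umbral_E_E' he.isFrame (hd n).raise
    rw [sphereInt_eq_coeffTime _ hΦ hn, sphereInt_eq_coeffTime _ hΦ hn, Finset.mul_sum,
      Finset.mul_sum, ← Finset.sum_add_distrib, Finset.mul_sum]
    symm
    refine Finset.sum_bij (fun j _ => (j.1.2 : ℕ)) ?_ ?_ ?_ ?_
    · intro j hj
      have h1 : (j.order : ℕ) = n := congrArg Fin.val (Finset.mem_filter.mp hj).2
      simp only [Pairs.order] at h1
      rw [Finset.mem_range]
      omega
    · intro j hj j' hj' hjj
      have h1 : (j.order : ℕ) = n := congrArg Fin.val (Finset.mem_filter.mp hj).2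
      have h2 : (j'.order : ℕ) = n := congrArg Fin.val (Finset.mem_filter.mp hj').2
      simp only [Pairs.order] at h1 h2
      exact Subtype.ext (Prod.ext (Fin.ext (by omega)) (Fin.ext hjj))
    · intro k hk
      rw [Finset.mem_range] at hk
      have hN := n.2
      have hs : (p : ℕ) + (n - p - k) + k ≤ N := by omega
      refine ⟨mkPair hs, ?_, rfl⟩
      rw [Finset.mem_filter]
      refine ⟨Finset.mem_univ _, Fin.ext ?_⟩
      change (p : ℕ) + (n - p - k) + k = n
      omega
    · intro j hj
      obtain rfl := (Finset.mem_filter.mp hj).2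
      have h1 : (j.order : ℕ) - p - j.1.2 = j.1.1 := by
        simp only [Pairs.order]
        omega
      rw [h1, coeffTime_succ, subMatrix, Matrix.of_apply, amplitude]
      push_cast
      ring

/-- The components of a projection in terms of the amplitude. -/
theorem contractUV_order (he : IsFrame e) {p : Fin (N + 1)} (i : Pairs N p) {T : Tensor i.order}
    (hT : IsSymm T) (γ : Fin p → Fin 4) :
    (contractUV (e 0) (e 1) p i.1.1 i.1.2 T γ : ℂ) = kap p *
      (tpow p (up (nullE' e)) γ * amplitude e T p i.1.1 i.1.2 +
        tpow p (up (nullE e)) γ * (starRingEnd ℂ) (amplitude e T p i.1.1 i.1.2)) := by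
  have h := contractUV_eq he p i.1.1 i.1.2 (T := T) hT γ
  have h2 := umbral_nullE' hT e p i.1.1 i.1.2
  exact h.trans (congrArg (fun x => kap p * (tpow p (up (nullE' e)) γ *
    amplitude e T p i.1.1 i.1.2 + tpow p (up (nullE e)) γ * x)) h2)

theorem contractUV_zero (u v : Fin 4 → ℝ) (p h k : ℕ) : contractUV u v p h k 0 = 0 := by
  funext γ
  simp [contractUV]

/-- Each projected equation involves only unknowns of one order `p`. Both of its components, along `E'^p`
and `E^p`, carry the same coefficients because these are real. -/
theorem AdaptedFrame.projectedLHS_eq (he : AdaptedFrame l φ e) (hl : mdot l l < 0)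
    (hA : CoeffsConverge F (equilibrium l0 l)) {d : Unknowns N} (hd : Admissible d)
    (p : Fin (N + 1)) (i : Pairs N p) :
    projectedLHS F (equilibrium l0 l) φ (e 0) (e 1) d p i =
      ∑ j, subMatrix F l0 l φ p i j • changeUnknowns (e 0) (e 1) d p j := by
  have hs := (isSymmTraceless_charLHS F _ hA φ d i.order).1
  have hamp := he.amplitude_charLHS hl hA hd p i
  funext γ
  rw [← Complex.ofReal_inj, Finset.sum_apply, Complex.ofReal_sum]
  refine (contractUV_order he.isFrame i hs γ).trans ?_
  have h1 : ∀ j, ((subMatrix F l0 l φ p i j • changeUnknowns (e 0) (e 1) d p j) γ : ℂ) =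
      kap p * tpow p (up (nullE' e)) γ * ((subMatrix F l0 l φ p i j : ℂ) *
        amplitude e (raise (d j.order)) p j.1.1 j.1.2) +
      kap p * tpow p (up (nullE e)) γ * (starRingEnd ℂ) ((subMatrix F l0 l φ p i j : ℂ) *
        amplitude e (raise (d j.order)) p j.1.1 j.1.2) := by
    intro j
    rw [Pi.smul_apply, smul_eq_mul, Complex.ofReal_mul]
    refine (congrArg _ (contractUV_order he.isFrame j (hd j.order).raise.1 γ)).trans ?_
    rw [map_mul, Complex.conj_ofReal]
    ring
  rw [Finset.sum_congr rfl fun j _ => h1 j, Finset.sum_add_distrib, ← Finset.mul_sum,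
    ← Finset.mul_sum, ← map_sum, ← hamp]
  ring

/-- The characteristic system is equivalent to the subsystems: its left-hand sides are symmetric
trace-less tensors, so they vanish as soon as all their projections do. -/
theorem AdaptedFrame.solves_iff (he : AdaptedFrame l φ e) (hl : mdot l l < 0)
    (hA : CoeffsConverge F (equilibrium l0 l)) {d : Unknowns N} (hd : Admissible d) :
    SolvesCharSystem F (equilibrium l0 l) φ d ↔ ∀ p : Fin (N + 1),
      SolvesSubsystem (subMatrix F l0 l φ p) (changeUnknowns (e 0) (e 1) d p) := by
  refine ⟨fun h p i => ?_, fun h m => ?_⟩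
  · rw [← he.projectedLHS_eq hl hA hd p i]
    rw [projectedLHS, h]
    exact contractUV_zero ..
  · refine eq_zero_of_umbral he.isFrame (isSymmTraceless_charLHS F _ hA φ d m) fun p a b hm => ?_
    have hm' : p + a + b ≤ N := by have := m.2; omega
    obtain rfl : (mkPair hm').order = m := Fin.ext hm
    have hs := (isSymmTraceless_charLHS F _ hA φ d (mkPair hm').order).1
    have h1 := umbral_contractUV he.isFrame p a b hs
    have h2 : contractUV (e 0) (e 1) p a b
        (charLHS F (equilibrium l0 l) φ d (mkPair hm').order) = 0 :=
      (he.projectedLHS_eq hl hA hd ⟨p, by omega⟩ (mkPair hm')).trans (h _ _)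
    rw [h2] at h1
    refine h1.symm.trans ?_
    rw [umbral_lin_pow (T := toComplex (0 : Tensor p)) fun σ β => rfl]
    simp [toComplex]

theorem AdaptedFrame.bijOn_solutions (he : AdaptedFrame l φ e) (hl : mdot l l < 0)
    (hA : CoeffsConverge F (equilibrium l0 l)) :
    Set.BijOn (changeUnknowns (e 0) (e 1))
      {d : Unknowns N | Admissible d ∧ SolvesCharSystem F (equilibrium l0 l) φ d}
      {X : NewUnknowns N | ∀ p : Fin (N + 1), (∀ i, IsPlanarTraceless (e 0) (e 1) (X p i)) ∧
        SolvesSubsystem (subMatrix F l0 l φ p) (X p)} := by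
  have hb := bijOn_changeUnknowns he.isFrame N
  refine ⟨fun d hd p => ⟨hb.mapsTo hd.1 p, (he.solves_iff hl hA hd.1).mp hd.2 p⟩,
    hb.injOn.mono fun d hd => hd.1, fun X hX => ?_⟩
  obtain ⟨d, hd, rfl⟩ := hb.surjOn (fun p => (hX p).1 : NewAdmissible (e 0) (e 1) X)
  exact ⟨d, ⟨hd, (he.solves_iff hl hA hd).mpr fun p => (hX p).2⟩, rfl⟩

/-! ### Wave speeds -/

theorem changeUnknowns_zero (u v : Fin 4 → ℝ) : changeUnknowns u v (0 : Unknowns N) = 0 := by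
  funext p i
  have h : raise ((0 : Unknowns N) i.order) = 0 := by
    funext β
    exact mul_zero _
  exact (congrArg (contractUV u v p i.1.1 i.1.2) h).trans (contractUV_zero ..)

theorem admissible_zero : Admissible (0 : Unknowns N) := fun n =>
  ⟨fun _ _ => rfl, fun _ _ _ _ => by simp⟩

theorem IsPlanarTraceless.smul {u v : Fin 4 → ℝ} {p : ℕ} {Y : Tensor p}
    (hY : IsPlanarTraceless u v Y) (c : ℝ) : IsPlanarTraceless u v (c • Y) := by
  refine ⟨fun σ γ => ?_, fun i γ => ?_, fun i γ => ?_, fun i j hij γ => ?_⟩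
  · rw [Pi.smul_apply, hY.1 σ γ, Pi.smul_apply]
  · simp only [Pi.smul_apply, smul_eq_mul, mul_left_comm _ c, ← Finset.mul_sum, hY.2.1 i γ, mul_zero]
  · simp only [Pi.smul_apply, smul_eq_mul, mul_left_comm _ c, ← Finset.mul_sum, hY.2.2.1 i γ,
      mul_zero]
  · simp only [Pi.smul_apply, smul_eq_mul, mul_left_comm _ c, ← Finset.mul_sum,
      hY.2.2.2 i j hij γ, mul_zero]

/-- In every order there is a nonzero planar trace-less tensor. -/
theorem exists_isPlanarTraceless_ne_zero (he : IsFrame e) (p : ℕ) :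
    ∃ Y : Tensor p, IsPlanarTraceless (e 0) (e 1) Y ∧ Y ≠ 0 := by
  obtain ⟨T, hT, hT1⟩ := exists_traceless he (p + 0 + 0) (fun _ _ _ => 1) fun _ _ => map_one _
  refine ⟨contractUV (e 0) (e 1) p 0 0 T, isPlanarTraceless_contractUV he p 0 0 hT.1, fun h0 => ?_⟩
  have h1 := umbral_contractUV he p 0 0 hT.1
  rw [h0, hT1 p 0 0 rfl, umbral_lin_pow (T := toComplex (0 : Tensor p)) fun σ β => rfl] at h1
  simp [toComplex] at h1

/-- A kernel vector `w` of the matrix of order `p` gives the solution `X_j = w_j Y` with a fixed planar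
trace-less tensor `Y`; conversely, the components of a nonzero solution are kernel vectors. -/
theorem AdaptedFrame.exists_solution_iff (he : AdaptedFrame l φ e) (hl : mdot l l < 0)
    (hA : CoeffsConverge F (equilibrium l0 l)) :
    (∃ d : Unknowns N, Admissible d ∧ d ≠ 0 ∧ SolvesCharSystem F (equilibrium l0 l) φ d) ↔
      ∃ p : Fin (N + 1), (subMatrix F l0 l φ p).det = 0 := by
  constructor
  · rintro ⟨d, hd, hd0, hsol⟩
    have hX : changeUnknowns (e 0) (e 1) d ≠ 0 := fun h => hd0 <|
      (bijOn_changeUnknowns he.isFrame N).injOn hd admissible_zero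
        (h.trans (changeUnknowns_zero _ _).symm)
    obtain ⟨p, hp⟩ := Function.ne_iff.mp hX
    obtain ⟨j, hj⟩ := Function.ne_iff.mp hp
    obtain ⟨γ, hγ⟩ := Function.ne_iff.mp hj
    refine ⟨p, Matrix.exists_mulVec_eq_zero_iff.mp
      ⟨fun j => changeUnknowns (e 0) (e 1) d p j γ, Function.ne_iff.mpr ⟨j, hγ⟩, ?_⟩⟩
    funext i
    have h := congrFun ((he.solves_iff hl hA hd).mp hsol p i) γ
    simpa [Matrix.mulVec, dotProduct] using h
  · rintro ⟨p, hp⟩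
    obtain ⟨w, hw0, hw⟩ := Matrix.exists_mulVec_eq_zero_iff.mpr hp
    obtain ⟨Y, hY, hY0⟩ := exists_isPlanarTraceless_ne_zero he.isFrame p
    set X : NewUnknowns N := Function.update 0 p fun j => w j • Y with hX
    have hXp : X p = fun j => w j • Y := Function.update_self ..
    have hXq : ∀ q, q ≠ p → X q = 0 := fun q hq => Function.update_of_ne hq ..
    obtain ⟨d, hd, hdX⟩ := (he.bijOn_solutions hl hA).surjOn (a := X) (by
      intro q
      rcases eq_or_ne q p with rfl | hq
      · rw [hXp]
        refine ⟨fun i => hY.smul _, fun i => ?_⟩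
        have h := congrFun hw i
        simp only [Matrix.mulVec, dotProduct, Pi.zero_apply] at h
        simp only [smul_smul, ← Finset.sum_smul, h, zero_smul]
      · rw [hXq q hq]
        refine ⟨fun i => ?_, fun i => by simp⟩
        have hz : IsPlanarTraceless (e 0) (e 1) ((0 : ℝ) • (0 : Tensor q)) := by
          obtain ⟨Z, hZ, -⟩ := exists_isPlanarTraceless_ne_zero he.isFrame q
          simpa using hZ.smul 0
        simpa using hz)
    refine ⟨d, hd.1, ?_, hd.2⟩
    rintro rfl
    rw [changeUnknowns_zero] at hdX
    obtain ⟨j, hj⟩ := Function.ne_iff.mp hw0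
    have h := congrFun (hXp.symm.trans (congrFun hdX p).symm) j
    exact (smul_ne_zero hj hY0) h

end ExtendedThermo

theorem mainTheorem2 (N : ℕ) (hN : 1 ≤ N) (F : (Fin (N + 1) → ℝ) → ℝ)
    (l0 : ℝ) (l : Fin 4 → ℝ) (hl : ExtendedThermo.mdot l l < 0)
    (hF : ∀ q : EuclideanSpace ℝ (Fin 3), q ≠ 0 →
      ContDiffAt ℝ 2 F (ExtendedThermo.args N (ExtendedThermo.equilibrium l0 l) q))
    (hA : ExtendedThermo.CoeffsConverge F (ExtendedThermo.equilibrium l0 l))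
    (ξ η : Fin 4 → ℝ) (hξ : ExtendedThermo.mdot ξ ξ = -1) (hη : ExtendedThermo.mdot η η = 1)
    (hξη : ExtendedThermo.mdot η ξ = 0) (c : ℝ) (φ : Fin 4 → ℝ) (hφ : φ = η - c • ξ)
    (u : Fin 4 → ℝ) (hu : u = ExtendedThermo.vel l) :
    (∀ v : Fin 4 → ℝ, ExtendedThermo.mdot v v = 1 → ExtendedThermo.mdot u v = 0 →
      (∀ a, ∑ b, ExtendedThermo.hLow u a b * ExtendedThermo.eta b * φ b =
        ExtendedThermo.spatialNorm u φ * v a) →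
      -- the change of unknowns is invertible
      Set.BijOn (ExtendedThermo.changeUnknowns u v)
        {d : ExtendedThermo.Unknowns N | ExtendedThermo.Admissible d}
        {X : ExtendedThermo.NewUnknowns N | ExtendedThermo.NewAdmissible u v X} ∧
      -- each projected equation involves only the unknowns of one order `p`, with scalar coefficients
      (∀ d : ExtendedThermo.Unknowns N, ExtendedThermo.Admissible d →
        ∀ (p : Fin (N + 1)) (i : ExtendedThermo.Pairs N p),
          ExtendedThermo.projectedLHS F (ExtendedThermo.equilibrium l0 l) φ u v d p i =
            ∑ j, ExtendedThermo.subMatrix F l0 l φ p i j •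
              ExtendedThermo.changeUnknowns u v d p j) ∧
      -- the characteristic system is equivalent to the subsystems taken together
      (∀ d : ExtendedThermo.Unknowns N, ExtendedThermo.Admissible d →
        (ExtendedThermo.SolvesCharSystem F (ExtendedThermo.equilibrium l0 l) φ d ↔
          ∀ p : Fin (N + 1), ExtendedThermo.SolvesSubsystem (ExtendedThermo.subMatrix F l0 l φ p)
            (ExtendedThermo.changeUnknowns u v d p))) ∧
      -- the subsystems are independent: their solutions can be prescribed separately
      Set.BijOn (ExtendedThermo.changeUnknowns u v)
        {d : ExtendedThermo.Unknowns N | ExtendedThermo.Admissible d ∧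
          ExtendedThermo.SolvesCharSystem F (ExtendedThermo.equilibrium l0 l) φ d}
        {X : ExtendedThermo.NewUnknowns N | ∀ p : Fin (N + 1),
          (∀ i, ExtendedThermo.IsPlanarTraceless u v (X p i)) ∧
          ExtendedThermo.SolvesSubsystem (ExtendedThermo.subMatrix F l0 l φ p) (X p)}) ∧
    -- the wave speeds
    (ExtendedThermo.IsWaveSpeed F (ExtendedThermo.equilibrium l0 l) ξ η c ↔
      ∃ p : Fin (N + 1), (ExtendedThermo.subMatrix F l0 l φ p).det = 0) := by
  subst hu hφ
  have hu := ExtendedThermo.mdot_vel hl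
  have hframe : ∀ v : Fin 4 → ℝ, ExtendedThermo.mdot v v = 1 →
      ExtendedThermo.mdot (ExtendedThermo.vel l) v = 0 →
      (∀ a, ∑ b, ExtendedThermo.hLow (ExtendedThermo.vel l) a b * ExtendedThermo.eta b *
        (η - c • ξ) b = ExtendedThermo.spatialNorm (ExtendedThermo.vel l) (η - c • ξ) * v a) →
      ∃ e, ExtendedThermo.AdaptedFrame l (η - c • ξ) e ∧
        e 0 = ExtendedThermo.vel l ∧ e 1 = v := by
    intro v hv huv hφv
    obtain ⟨e, he, h0, h1⟩ := ExtendedThermo.exists_frame hu hv huv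
    refine ⟨e, ⟨he, h0, fun a => ?_⟩, h0, h1⟩
    have h := hφv a
    rw [ExtendedThermo.sum_hLow] at h
    rw [h0, h1]
    linarith
  refine ⟨fun v hv huv hφv => ?_, ?_⟩
  · obtain ⟨e, he, h0, rfl⟩ := hframe v hv huv hφv
    rw [← h0]
    exact ⟨ExtendedThermo.bijOn_changeUnknowns he.isFrame N,
      fun d hd p i => he.projectedLHS_eq hl hA hd p i, fun d hd => he.solves_iff hl hA hd,
      he.bijOn_solutions hl hA⟩
  · obtain ⟨v, hv, huv, hφv⟩ := ExtendedThermo.exists_direction hu (η - c • ξ)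
    obtain ⟨e, he, -, -⟩ := hframe v hv huv hφv
    exact he.exists_solution_iff hl hA
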